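/- **Setting.** Let $d\ge 1$, $1\le m\le M$ and $T\ge 1$ be integers and $D,G,L,\rho>0$. Let $\mathcal K\subset\mathbb R^d$ be compact and convex with $\|x-y\|\le D$ for all $x,y\in\mathcal K$, and let $x_1\in\mathcal K$. For each machine $i\in[M]$ let $\mathcal Z_i$ be a sample space and, for $z\in\mathcal Z_i$, let $f_i(\cdot;z)$ be differentiable on $\mathcal K$, $G$-Lipschitz and $L$-smooth over $\mathcal K$, i.e. $|f_i(x;z)-f_i(y;z)|\le G\|x-y\|$ and $\|\nabla f_i(x;z)-\nabla f_i(y;z)\|\le L\|x-y\|$ for $x,y\in\mathcal K$. Put $S:=G+2LD$, $\alpha_t:=t$, $\alpha_{1:t}:=\sum_{\tau=1}^t\alpha_\tau$, $$\eta:=\min\Big\{\frac{\rho Dm}{2ST\sqrt d},\frac1{4LT}\Big\},\qquad \sigma_t^2:=\frac{4S^2T}{\rho^2m^2}.$$ **Algorithm (trusted server).** The input is a dataset $(z_{t,i})_{t\in[T],\,i\in[M]}$ with $z_{t,i}\in\mathcal Z_i$. Set $w_1=x_1$ and $q_0=0$. For $t=1,\dots,T$: choose a set $\mathcal M_t\subseteq[M]$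 with $|\mathcal M_t|=m$; each machine $i\in\mathcal M_t$ computes $s_{t,i}=\alpha_t\nabla f_i(x_t;z_{t,i})-\alpha_{t-1}\nabla f_i(x_{t-1};z_{t,i})$ (the second term is absent for $t=1$); the server sets $q_t=q_{t-1}+\frac1m\sum_{i\in\mathcal M_t}s_{t,i}$, draws an independent noise $Y_t\sim\mathcal N(0,\sigma_t^2I)$, and updates $$w_{t+1}=\Pi_{\mathcal K}\big(w_t-\eta(q_t+Y_t)\big),\qquad x_{t+1}=\Big(1-\frac{\alpha_{t+1}}{\alpha_{1:t+1}}\Big)x_t+\frac{\alpha_{t+1}}{\alpha_{1:t+1}}w_{t+1},$$ where $\Pi_{\mathcal K}$ is the Euclidean projection onto $\mathcal K$. The output is $x_T$. **(1) Privacy.** Suppose that the sequence $(\mathcal M_t)_{t\le T}$ of sets of size $m$ is fixed, or random with any law not depending on the data and independent of the noise. Then the query points $(x_1,\dots,x_{T+1})$ are $\frac{\rho^2}2$-zCDP: for any two datasets that differ in a single sample $z_{t,i}$ of a single machine, the laws $P,Q$ of $(x_1,\dots,x_{T+1})$ satisfy, for every $\alpha>1$, $$\frac1{\alpha-1}\log\mathbb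 E_{X\sim P}\Big[\Big(\frac{dP}{dQ}(X)\Big)^{\alpha-1}\Big]\le\frac{\rho^2}2\,\alpha$$ (the left-hand side being $\infty$ if $P$ is not absolutely continuous with respect to $Q$). **(2) Excess loss.** Let $\mathcal D_i$ be a probability distribution on $\mathcal Z_i$ such that the local objective $f_i(x):=\mathbb E_{z\sim\mathcal D_i}f_i(x;z)$ is convex on $\mathcal K$ for each $i$, let $f:=\frac1M\sum_{i=1}^Mf_i$, and let $\sigma,\sigma_L,\xi,\xi_L\ge 0$ be such that, for all $x,y\in\mathcal K$ and $i\in[M]$, $$\mathbb E_{z\sim\mathcal D_i}\|\nabla f_i(x;z)-\nabla f_i(x)\|^2\le\sigma^2,$$ $$\mathbb E_{z\sim\mathcal D_i}\|(\nabla f_i(x;z)-\nabla f_i(x))-(\nabla f_i(y;z)-\nabla f_i(y))\|^2\le\sigma_L^2\|x-y\|^2,$$ $$\frac1M\sum_{j=1}^M\|\nabla f_j(x)-\nabla f(x)\|^2\le\xi^2,$$ $$\frac1M\sum_{j=1}^M\|(\nabla f_j(x)-\nabla f(x))-(\nabla f_j(y)-\nabla f(y))\|^2\le\xi_L^2\|x-y\|^2.$$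 Put $\tilde\sigma:=\sigma+2\sigma_LD$ and $\tilde\xi:=\xi+2\xi_LD$, let $x^*\in\arg\min_{x\in\mathcal K}f(x)$ and $G^*:=\|\nabla f(x^*)\|$. If all samples $z_{t,i}\sim\mathcal D_i$ are independent, and the sets $\mathcal M_t$ are independent of each other, of the samples and of the noise, and uniformly distributed over the subsets of $[M]$ of size $m$, then $$\mathbb E[f(x_T)]-\min_{x\in\mathcal K}f(x)\le 4D\left(\frac{G^*+2LD}{T}+\frac{\sqrt{\tilde\sigma^2+\tilde\xi^2}}{\sqrt{mT}}+\frac{2S\sqrt d}{\rho mT}\right).$$ -/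

import Mathlib

open MeasureTheory ProbabilityTheory

noncomputable section

/-! ### Rényi divergence and zero-concentrated differential privacy -/

open Classical in
/-- The Rényi divergence of order `α > 1`,
`D_α(P‖Q) = (α - 1)⁻¹ log E_{X ∼ P} (dP/dQ (X)) ^ (α - 1)`, with value `∞` unless `P ≪ Q`. -/
def renyiDivergence {Ω : Type*} [MeasurableSpace Ω] (α : ℝ) (P Q : Measure Ω) : EReal :=
  if P ≪ Q then
    (((α - 1)⁻¹ : ℝ) : EReal) * ENNReal.log (∫⁻ x, (P.rnDeriv Q x) ^ (α - 1) ∂P)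
  else ⊤

/-- A federated dataset: machine `i` holds the ordered samples `z_{1,i}, …, z_{T,i}`, where
`z_{t+1,i}` is `S i t`. -/
abbrev FedDataset {M : ℕ} (T : ℕ) (𝒵 : Fin M → Type*) : Type _ := ∀ i, Fin T → 𝒵 i

/-- Two federated datasets are neighbors if they differ at most in a single sample of a single
machine. -/
def FedDataset.Neighbor {M T : ℕ} {𝒵 : Fin M → Type*} (S S' : FedDataset T 𝒵) : Prop :=
  ∃ (i : Fin M) (t : Fin T), ∀ (j : Fin M) (s : Fin T), ¬ (j = i ∧ s = t) → S j s = S' j s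

/-- `(ξ, ρ)`-zero-concentrated differential privacy of a randomized algorithm, given by the law
`A S` of its observable on the dataset `S`. -/
def IsZCDP {M T : ℕ} {𝒵 : Fin M → Type*} {Ω : Type*} [MeasurableSpace Ω]
    (A : FedDataset T 𝒵 → Measure Ω) (ξ ρ : ℝ) : Prop :=
  ∀ S S' : FedDataset T 𝒵, S.Neighbor S' → ∀ α : ℝ, 1 < α →
    renyiDivergence α (A S) (A S') ≤ ((ξ + ρ * α : ℝ) : EReal)

/-! ### The algorithm -/

open Classical in
/-- The projection `Π_K x = argmin_{y ∈ K} ‖x - y‖` (with value `x` if there is no minimizer; for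
a nonempty compact convex `K` the minimizer exists and is unique). -/
def projOn {E : Type*} [NormedAddCommGroup E] (K : Set E) (x : E) : E :=
  if h : ∃ y ∈ K, ∀ y' ∈ K, ‖x - y‖ ≤ ‖x - y'‖ then h.choose else x

/-- The state of the server at the beginning of round `t`: the iterate `w_t`, the query points
`x_t` and `x_{t-1}`, and the gradient estimate `q_{t-1}`. -/
structure ServerState (E : Type*) where
  w : E
  x : E
  xPrev : E
  q : E

/-- `α_{1:t} = α_1 + ⋯ + α_t`. -/
def weightSum (α : ℕ → ℝ) (t : ℕ) : ℝ := ∑ τ ∈ Finset.Icc 1 t, α τ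

/-- Round `t ≥ 1` of the trusted-server algorithm, with participating machines `A`, samples `z`
and noise `Y`. Here `grad i z x` is `∇f_i(x; z)`. -/
def trustedRound {E : Type*} [NormedAddCommGroup E] [InnerProductSpace ℝ E] {M : ℕ}
    {𝒵 : Fin M → Type*} (K : Set E) (grad : ∀ i, 𝒵 i → E → E) (α : ℕ → ℝ) (η : ℝ) (m : ℕ)
    (t : ℕ) (A : Finset (Fin M)) (z : ∀ i, 𝒵 i) (Y : E) (st : ServerState E) : ServerState E :=
  let s : Fin M → E := fun i => α t • grad i (z i) st.x - α (t - 1) • grad i (z i) st.xPrev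
  let q : E := st.q + (m : ℝ)⁻¹ • ∑ i ∈ A, s i
  let w : E := projOn K (st.w - η • (q + Y))
  let θ : ℝ := α (t + 1) / weightSum α (t + 1)
  { w := w, x := (1 - θ) • st.x + θ • w, xPrev := st.x, q := q }

/-- The server state after `k ≤ T` rounds, that is, at the beginning of round `k + 1`. The round
`t = k + 1` uses the machines `sel k`, the samples `S i k` and the noise `Y k`. -/
def trustedState {E : Type*} [NormedAddCommGroup E] [InnerProductSpace ℝ E] {M T : ℕ}
    {𝒵 : Fin M → Type*} (K : Set E) (grad : ∀ i, 𝒵 i → E → E) (α : ℕ → ℝ) (η : ℝ) (m : ℕ)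
    (x₀ : E) (S : FedDataset T 𝒵) (sel : Fin T → Finset (Fin M)) (Y : Fin T → E) :
    ∀ k : ℕ, k ≤ T → ServerState E
  | 0, _ => { w := x₀, x := x₀, xPrev := x₀, q := 0 }
  | k + 1, h =>
      trustedRound K grad α η m (k + 1) (sel ⟨k, h⟩) (fun i => S i ⟨k, h⟩) (Y ⟨k, h⟩)
        (trustedState K grad α η m x₀ S sel Y k (Nat.le_of_succ_le h))

/-- The query points `x_1, …, x_{T+1}` computed by the algorithm; `x_{k+1}` has index `k`. -/
def trustedQueries {E : Type*} [NormedAddCommGroup E] [InnerProductSpace ℝ E] {M T : ℕ}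
    {𝒵 : Fin M → Type*} (K : Set E) (grad : ∀ i, 𝒵 i → E → E) (α : ℕ → ℝ) (η : ℝ) (m : ℕ)
    (x₀ : E) (S : FedDataset T 𝒵) (sel : Fin T → Finset (Fin M)) (Y : Fin T → E) :
    Fin (T + 1) → E :=
  fun k => (trustedState K grad α η m x₀ S sel Y k.1 (Nat.le_of_lt_succ k.2)).x

/-! ### The sources of randomness -/

/-- Independent noises `Y_t ∼ N(0, v_t I)` in `ℝ^d`, `t = 1, …, T`. -/
def gaussianNoise (d : ℕ) {T : ℕ} (v : Fin T → ℝ) :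
    Measure (Fin T → EuclideanSpace ℝ (Fin d)) :=
  Measure.pi fun t => multivariateGaussian 0 (v t • (1 : Matrix (Fin d) (Fin d) ℝ))

/-- Independent, uniformly distributed subsets `𝓜_1, …, 𝓜_T` of `[M]` of size `m`. -/
def uniformSelection (M m T : ℕ) : Measure (Fin T → Finset (Fin M)) :=
  Measure.pi fun _ => uniformOn {A : Finset (Fin M) | A.card = m}

/-- Independent samples, those of machine `i` being distributed according to `𝒟 i`. -/
def sampleLaw {M : ℕ} (T : ℕ) {𝒵 : Fin M → Type*} [∀ i, MeasurableSpace (𝒵 i)]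
    (𝒟 : ∀ i, Measure (𝒵 i)) : Measure (FedDataset T 𝒵) :=
  Measure.pi fun i => Measure.pi fun _ : Fin T => 𝒟 i

/-- The law of the query points of the trusted-server algorithm run on the dataset `S`, when the
sequence of participating subsets has law `ν` and is independent of the noise. -/
def trustedLaw {d M T : ℕ} {𝒵 : Fin M → Type*} (K : Set (EuclideanSpace ℝ (Fin d)))
    (grad : ∀ i, 𝒵 i → EuclideanSpace ℝ (Fin d) → EuclideanSpace ℝ (Fin d))
    (α : ℕ → ℝ) (η : ℝ) (m : ℕ) (v : Fin T → ℝ) (x₀ : EuclideanSpace ℝ (Fin d))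
    (ν : Measure (Fin T → Finset (Fin M))) (S : FedDataset T 𝒵) :
    Measure (Fin (T + 1) → EuclideanSpace ℝ (Fin d)) :=
  (ν.prod (gaussianNoise d v)).map fun ω => trustedQueries K grad α η m x₀ S ω.1 ω.2

/-! ### The objective -/

/-- The local objective `f_i(x) = E_{z ∼ 𝒟_i} f_i(x; z)`. -/
def localLoss {E : Type*} {M : ℕ} {𝒵 : Fin M → Type*} [∀ i, MeasurableSpace (𝒵 i)]
    (f : ∀ i, 𝒵 i → E → ℝ) (𝒟 : ∀ i, Measure (𝒵 i)) (i : Fin M) (x : E) : ℝ :=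
  ∫ z, f i z x ∂(𝒟 i)

/-- The global objective `f(x) = (1/M) ∑ i, f_i(x)`. -/
def globalLoss {E : Type*} {M : ℕ} {𝒵 : Fin M → Type*} [∀ i, MeasurableSpace (𝒵 i)]
    (f : ∀ i, 𝒵 i → E → ℝ) (𝒟 : ∀ i, Measure (𝒵 i)) (x : E) : ℝ :=
  (M : ℝ)⁻¹ * ∑ i, localLoss f 𝒟 i x

/-- The average `(1/M) ∑ i, ∇f_i(x)` of the local gradients, which is `∇f(x)`. -/
def globalGrad {E : Type*} [NormedAddCommGroup E] [InnerProductSpace ℝ E] {M : ℕ}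
    (gradLoc : Fin M → E → E) (x : E) : E :=
  (M : ℝ)⁻¹ • ∑ i, gradLoc i x

end

noncomputable section

open scoped RealInnerProductSpace ENNReal

/-! ### Projection onto a compact convex set -/

section Projection

variable {E : Type*} [NormedAddCommGroup E] {K : Set E}

/-! Privacy. Since `α t = t`, the averaging gives x_{t+1} - x_t = (2/(t+2)) (w_{t+1} - x_t), so
t‖x_{t+1} - x_t‖ ≤ 2D. A message is a gradient plus t times a gradient increment, hence it is
bounded by S = G + 2LD although its weights grow with t (`mul_norm_trustedState_sub_le`,
`norm_roundMessage_le`). A changed sample of round t₀ enters a single message directly; it can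
influence later ones only through the query points. Let u be the resulting change of the averaged
message. If the noise of every round from t₀ on is shifted by u, the neighbouring dataset produces
the same queries (`trustedState_shift`). Here ‖u‖ ≤ 2S/m, and u depends only on the selection and on
the noise before t₀, so given the past this is a translation of Gaussians. The Rényi divergence of
order a between shifted and unshifted noise is at most a T (2S/m)²/(2v) = aρ²/2
(`prod_gaussianNoise_map_shear`, `lintegral_shearDensity_rpow_le`), and passing to the queries does
not increase it (`renyiDivergence_map_le`).

Excess loss. The error ε_t = q_t - t∇f(x_t) is a martingale whose increments have conditional second
moment at most (σ̃² + ξ̃²)/m, so E‖ε_t‖² ≤ t(σ̃² + ξ̃²)/m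
(`StochasticOracle.integral_norm_estimationError_sq_le`). The potential α_{1:t}(f(x_t) - f(x*)) +
‖w_t - x*‖²/(2η) grows in each round by at most G*D + 2LD² + D‖ε_t‖ + (η/2)‖Y_t‖² plus a term of
mean zero (`potential_succ_le`): smoothness and convexity reduce the change of the first summand to
an inner product with w_{t+1} - x*, which the projected step controls. After T - 1 rounds, division
by α_{1:T} = T(T+1)/2 gives the rate. Conditioning on the past is expressed throughout by redrawing
the randomness of one round.

Boundary. Gradients within K are determined only along the directions of K, and G does not control
their normal part. The projection onto K ignores that part, so the gradients may be replaced by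
their tangential parts, precomposed with the projection, without changing the queries
(`trustedState_tangentGrad`). The replacements are bounded by G and L-Lipschitz on the whole space
(`norm_tangentProj_gradient_le`, `norm_tangentGrad_sub_le`), and both statements are proved for
them. -/

lemma projOn_spec (hK : IsCompact K) (hne : K.Nonempty) (x : E) :
    projOn K x ∈ K ∧ ∀ y ∈ K, ‖x - projOn K x‖ ≤ ‖x - y‖ := by
  have h : ∃ y ∈ K, ∀ y' ∈ K, ‖x - y‖ ≤ ‖x - y'‖ := by
    obtain ⟨y, hy, hmin⟩ := hK.exists_isMinOn hne
      (f := fun y => ‖x - y‖) (by fun_prop)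
    exact ⟨y, hy, fun y' hy' => hmin hy'⟩
  unfold projOn
  rw [dif_pos h]
  exact h.choose_spec

lemma projOn_mem (hK : IsCompact K) (hne : K.Nonempty) (x : E) : projOn K x ∈ K :=
  (projOn_spec hK hne x).1

variable [InnerProductSpace ℝ E]

lemma inner_sub_projOn_le (hK : IsCompact K) (hc : Convex ℝ K) (hne : K.Nonempty) (x : E)
    {y : E} (hy : y ∈ K) : ⟪x - projOn K x, y - projOn K x⟫ ≤ 0 := by
  obtain ⟨hp, hmin⟩ := projOn_spec hK hne x
  refine (norm_eq_iInf_iff_real_inner_le_zero hc hp).1 ?_ y hy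
  have : Nonempty K := ⟨⟨_, hp⟩⟩
  refine le_antisymm (le_ciInf fun w => hmin w w.2) ?_
  exact ciInf_le (f := fun w : K => ‖x - w‖) ⟨0, by rintro _ ⟨w, rfl⟩; positivity⟩ ⟨_, hp⟩

/-- Adding the variational inequalities of two candidates gives ‖p - p'‖² ≤ 0. So any point
satisfying the inequality is the minimizer selected by choice in `projOn`. -/
lemma projOn_eq_of_inner_le (hK : IsCompact K) (hc : Convex ℝ K) {x p : E} (hp : p ∈ K)
    (h : ∀ y ∈ K, ⟪x - p, y - p⟫ ≤ 0) : projOn K x = p := by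
  have hne : K.Nonempty := ⟨p, hp⟩
  have h1 := inner_sub_projOn_le hK hc hne x hp
  have h2 := h _ (projOn_mem hK hne x)
  have h3 : ⟪p - projOn K x, p - projOn K x⟫ ≤ 0 := by
    have : p - projOn K x = (x - projOn K x) - (x - p) := by abel
    nth_rewrite 1 [this]
    rw [inner_sub_left]
    have h4 : ⟪x - p, p - projOn K x⟫ = -⟪x - p, projOn K x - p⟫ := by
      rw [← inner_neg_right, neg_sub]
    linarith
  rw [real_inner_self_eq_norm_sq] at h3
  have : ‖p - projOn K x‖ = 0 := by nlinarith [norm_nonneg (p - projOn K x)]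
  exact (sub_eq_zero.1 (norm_eq_zero.1 this)).symm

lemma projOn_of_mem (hK : IsCompact K) (hc : Convex ℝ K) {x : E} (hx : x ∈ K) :
    projOn K x = x :=
  projOn_eq_of_inner_le hK hc hx (by simp)

lemma norm_projOn_sub_le (hK : IsCompact K) (hc : Convex ℝ K) (hne : K.Nonempty) (x y : E) :
    ‖projOn K x - projOn K y‖ ≤ ‖x - y‖ := by
  have h1 := inner_sub_projOn_le hK hc hne x (projOn_mem hK hne y)
  have h2 := inner_sub_projOn_le hK hc hne y (projOn_mem hK hne x)
  set p := projOn K x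
  set q := projOn K y
  have h3 : ⟪p - q, p - q⟫ ≤ ⟪x - y, p - q⟫ := by
    have e1 : ⟪x - p, q - p⟫ = -⟪x - p, p - q⟫ := by rw [← inner_neg_right, neg_sub]
    have e2 : x - y = (x - p) - (y - q) + (p - q) := by abel
    have e3 : ⟪x - y, p - q⟫ = ⟪x - p, p - q⟫ - ⟪y - q, p - q⟫ + ⟪p - q, p - q⟫ := by
      rw [e2, inner_add_left, inner_sub_left]
    linarith
  rw [real_inner_self_eq_norm_sq] at h3
  have h4 := real_inner_le_norm (x - y) (p - q)
  by_contra hlt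
  push Not at hlt
  have : 0 < ‖p - q‖ := (norm_nonneg _).trans_lt hlt
  nlinarith

lemma continuous_projOn (hK : IsCompact K) (hc : Convex ℝ K) (hne : K.Nonempty) :
    Continuous (projOn K) :=
  (LipschitzWith.of_dist_le_mul (K := 1) fun x y => by
    simpa [dist_eq_norm] using norm_projOn_sub_le hK hc hne x y).continuous

/-- The mirror-descent inequality for a projected step. -/
lemma inner_projOn_step_le (hK : IsCompact K) (hc : Convex ℝ K) {w u g : E} {η : ℝ}
    (hη : 0 < η) (hu : u ∈ K) :
    ⟪g, projOn K (w - η • g) - u⟫ ≤ (‖w - u‖ ^ 2 - ‖projOn K (w - η • g) - u‖ ^ 2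
      - ‖w - projOn K (w - η • g)‖ ^ 2) / (2 * η) := by
  have h := inner_sub_projOn_le hK hc ⟨u, hu⟩ (w - η • g) hu
  set p := projOn K (w - η • g)
  have e1 : w - η • g - p = (w - p) - η • g := by abel
  rw [e1, inner_sub_left, inner_smul_left] at h
  have e2 : ‖w - u‖ ^ 2 = ‖w - p‖ ^ 2 - 2 * ⟪w - p, u - p⟫ + ‖u - p‖ ^ 2 := by
    rw [← norm_sub_sq_real]; congr 2; abel
  have e3 : ⟪g, u - p⟫ = -⟪g, p - u⟫ := by rw [← inner_neg_right, neg_sub]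
  rw [norm_sub_rev u p] at e2
  rw [le_div_iff₀ (by positivity)]
  simp only [conj_trivial] at h
  rw [e3] at h
  nlinarith

/-- The component orthogonal to the direction of `K` does not influence the projection. -/
lemma projOn_eq_of_sub_orthogonal (hK : IsCompact K) (hc : Convex ℝ K) (hne : K.Nonempty)
    {x y : E} (h : ∀ a ∈ K, ∀ b ∈ K, ⟪x - y, a - b⟫ = 0) : projOn K x = projOn K y := by
  refine projOn_eq_of_inner_le hK hc (projOn_mem hK hne y) fun a ha => ?_
  have h1 := inner_sub_projOn_le hK hc hne y ha
  have h2 := h a ha _ (projOn_mem hK hne y)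
  have : x - projOn K y = (x - y) + (y - projOn K y) := by abel
  rw [this, inner_add_left]
  linarith

end Projection

/-! ### Gradients within a convex set -/

section Gradient

variable {E : Type*} [NormedAddCommGroup E] [InnerProductSpace ℝ E] [CompleteSpace E] {K : Set E}

lemma HasGradientWithinAt.hasDerivWithinAt_segment {φ : E → ℝ} {g x y : E} {s : ℝ}
    (hc : Convex ℝ K) (hx : x ∈ K) (hy : y ∈ K)
    (h : HasGradientWithinAt φ g K (x + s • (y - x))) :
    HasDerivWithinAt (fun r : ℝ => φ (x + r • (y - x))) ⟪g, y - x⟫ (Set.Icc 0 1) s := by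
  have h1 : HasDerivWithinAt (fun r : ℝ => x + r • (y - x)) (y - x) (Set.Icc 0 1) s := by
    simpa using (((hasDerivAt_id s).smul_const (y - x)).const_add x).hasDerivWithinAt
  have h2 := h.hasFDerivWithinAt.comp_hasDerivWithinAt s h1
    (fun r hr => by
      have := hc.add_smul_sub_mem hx hy hr
      exact this)
  rw [InnerProductSpace.toDual_apply_apply] at h2
  exact h2

/-- Difference quotients along the segment stay below the Lipschitz constant. Only directions
pointing into K are reached, so this alone does not bound the norm of the gradient at a boundary
point. -/
lemma HasGradientWithinAt.abs_inner_le_of_lipschitz {φ : E → ℝ} {g x y : E} {G : ℝ}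
    (hc : Convex ℝ K) (hx : x ∈ K) (hy : y ∈ K) (h : HasGradientWithinAt φ g K x)
    (hL : ∀ x ∈ K, ∀ y ∈ K, |φ x - φ y| ≤ G * ‖x - y‖) : |⟪g, y - x⟫| ≤ G * ‖y - x‖ := by
  have h1 := HasGradientWithinAt.hasDerivWithinAt_segment (s := 0) hc hx hy (by simpa using h)
  rw [hasDerivWithinAt_iff_tendsto_slope] at h1
  have hs : (Set.Icc (0 : ℝ) 1 \ {0}) = Set.Ioc 0 1 := by
    ext r; simp only [Set.mem_sdiff, Set.mem_Icc, Set.mem_singleton_iff, Set.mem_Ioc]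
    constructor
    · rintro ⟨⟨a, b⟩, c⟩; exact ⟨lt_of_le_of_ne a (Ne.symm c), b⟩
    · rintro ⟨a, b⟩; exact ⟨⟨a.le, b⟩, a.ne'⟩
  rw [hs] at h1
  have : (nhdsWithin (0 : ℝ) (Set.Ioc 0 1)).NeBot := by
    rw [nhdsWithin_Ioc_eq_nhdsGT one_pos]; infer_instance
  refine le_of_tendsto h1.abs ?_
  filter_upwards [self_mem_nhdsWithin] with r hr
  have hm : x + r • (y - x) ∈ K := hc.add_smul_sub_mem hx hy ⟨hr.1.le, hr.2⟩
  have h2 := hL _ hm _ hx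
  simp only [slope, vsub_eq_sub, sub_zero, smul_eq_mul, zero_smul, add_zero, abs_mul, abs_inv,
    abs_of_pos hr.1]
  rw [add_sub_cancel_left, norm_smul, Real.norm_eq_abs, abs_of_pos hr.1] at h2
  rw [inv_mul_le_iff₀ hr.1]
  linarith

/-- The descent lemma on a convex set. -/
lemma le_add_inner_add_sq_of_smooth {φ : E → ℝ} {g : E → E} {L : ℝ}
    (hc : Convex ℝ K) (h : ∀ x ∈ K, HasGradientWithinAt φ (g x) K x)
    (hS : ∀ x ∈ K, ∀ y ∈ K, ‖g x - g y‖ ≤ L * ‖x - y‖) {x y : E} (hx : x ∈ K) (hy : y ∈ K) :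
    φ y ≤ φ x + ⟪g x, y - x⟫ + L / 2 * ‖y - x‖ ^ 2 := by
  -- Along the segment, φ minus the claimed quadratic upper model. The slope of φ exceeds its
  -- initial value by at most L r ‖y - x‖², which the quadratic term cancels, so ψ decreases;
  -- compare r = 0 and r = 1.
  let ψ : ℝ → ℝ := fun r => φ (x + r • (y - x)) - r * ⟪g x, y - x⟫ - L / 2 * ‖y - x‖ ^ 2 * r ^ 2
  have hm : ∀ r ∈ Set.Icc (0 : ℝ) 1, x + r • (y - x) ∈ K := fun r hr =>
    hc.add_smul_sub_mem hx hy hr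
  have hd : ∀ r ∈ Set.Icc (0 : ℝ) 1, HasDerivWithinAt ψ (⟪g (x + r • (y - x)), y - x⟫
      - ⟪g x, y - x⟫ - L / 2 * ‖y - x‖ ^ 2 * (2 * r)) (Set.Icc 0 1) r := by
    intro r hr
    have h1 := HasGradientWithinAt.hasDerivWithinAt_segment hc hx hy (h _ (hm r hr))
    have h2 := ((hasDerivAt_id r).mul_const ⟪g x, y - x⟫).hasDerivWithinAt (s := Set.Icc 0 1)
    have h3 := ((hasDerivAt_pow 2 r).const_mul (L / 2 * ‖y - x‖ ^ 2)).hasDerivWithinAt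
      (s := Set.Icc 0 1)
    convert! (h1.sub h2).sub h3 using 1
    simp
  have hanti : AntitoneOn ψ (Set.Icc 0 1) := by
    refine antitoneOn_of_hasDerivWithinAt_nonpos (convex_Icc 0 1)
      (fun r hr => (hd r hr).continuousWithinAt)
      (fun r hr => (hd r (interior_subset hr)).mono interior_subset) ?_
    intro r hr
    have hr' := interior_subset hr
    have h1 : ⟪g (x + r • (y - x)) - g x, y - x⟫ ≤ L * ‖r • (y - x)‖ * ‖y - x‖ := by
      refine (real_inner_le_norm _ _).trans ?_
      gcongr
      have := hS _ (hm r hr') _ hx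
      rwa [add_sub_cancel_left] at this
    rw [inner_sub_left, norm_smul, Real.norm_eq_abs, abs_of_nonneg hr'.1] at h1
    nlinarith
  have := hanti (Set.left_mem_Icc.2 zero_le_one) (Set.right_mem_Icc.2 zero_le_one) zero_le_one
  simp only [ψ, one_smul, zero_smul, add_zero] at this
  rw [add_sub_cancel] at this
  linarith

/-- The first-order convexity inequality. -/
lemma ConvexOn.add_inner_le {φ : E → ℝ} {g x y : E} (hφ : ConvexOn ℝ K φ)
    (h : HasGradientWithinAt φ g K x) (hx : x ∈ K) (hy : y ∈ K) :
    φ x + ⟪g, y - x⟫ ≤ φ y := by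
  have h1 := HasGradientWithinAt.hasDerivWithinAt_segment (s := 0) hφ.1 hx hy (by simpa using h)
  rw [hasDerivWithinAt_iff_tendsto_slope] at h1
  have h1 := h1.mono_left (nhdsWithin_mono 0 (show Set.Ioo (0 : ℝ) 1 ⊆ Set.Icc 0 1 \ {0} from
    fun r hr => ⟨⟨hr.1.le, hr.2.le⟩, hr.1.ne'⟩))
  have : (nhdsWithin (0 : ℝ) (Set.Ioo 0 1)).NeBot := by
    rw [nhdsWithin_Ioo_eq_nhdsGT one_pos]; infer_instance
  have h2 : ⟪g, y - x⟫ ≤ φ y - φ x := by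
    refine le_of_tendsto h1 ?_
    filter_upwards [self_mem_nhdsWithin] with r hr
    have h3 := hφ.2 hx hy (sub_nonneg.2 hr.2.le) hr.1.le (by ring)
    have e : (1 - r) • x + r • y = x + r • (y - x) := by
      rw [sub_smul, one_smul, smul_sub]; abel
    rw [e] at h3
    simp only [slope, vsub_eq_sub, sub_zero, smul_eq_mul, zero_smul, add_zero] at h3 ⊢
    rw [inv_mul_le_iff₀ hr.1]
    linarith
  linarith

/-- Gradients within a convex set are unique along its directions. -/
lemma HasGradientWithinAt.inner_eq {φ : E → ℝ} {g g' x y : E} (hc : Convex ℝ K)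
    (h : HasGradientWithinAt φ g K x) (h' : HasGradientWithinAt φ g' K x) (hx : x ∈ K)
    (hy : y ∈ K) : ⟪g, y - x⟫ = ⟪g', y - x⟫ := by
  have := HasFDerivWithinAt.unique_on h.hasFDerivWithinAt h'.hasFDerivWithinAt
    (mem_tangentConeAt_of_segment_subset (hc.segment_subset hx hy))
  simpa using this

end Gradient

/-! ### The tangential part of a gradient -/

section Tangential

variable {E : Type*} [NormedAddCommGroup E] [InnerProductSpace ℝ E] [FiniteDimensional ℝ E]
  {K : Set E}

/-- The orthogonal projection onto the direction of the affine span of `K`. -/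
abbrev tangentProj (K : Set E) : E →L[ℝ] E := (vectorSpan ℝ K).starProjection

lemma inner_tangentProj {a b : E} (v : E) (ha : a ∈ K) (hb : b ∈ K) :
    ⟪tangentProj K v, a - b⟫ = ⟪v, a - b⟫ := by
  have := (vectorSpan ℝ K).starProjection_inner_eq_zero v (a - b)
    (vsub_mem_vectorSpan ℝ ha hb)
  rw [inner_sub_left] at this
  exact (sub_eq_zero.1 this).symm

/-- The differences y - x with y ∈ K span the direction of K, so testing against them determines the
tangential part. -/
lemma tangentProj_eq_of_inner_eq {x u v : E} (hx : x ∈ K)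
    (h : ∀ y ∈ K, ⟪u, y - x⟫ = ⟪v, y - x⟫) : tangentProj K u = tangentProj K v := by
  rw [← sub_eq_zero, ← map_sub, Submodule.starProjection_apply_eq_zero_iff]
  rw [Submodule.mem_orthogonal', vectorSpan_eq_span_vsub_set_right ℝ hx]
  intro w hw
  induction hw using Submodule.span_induction with
  | mem w hw =>
    obtain ⟨y, hy, rfl⟩ := hw
    simp only [vsub_eq_sub, inner_sub_left, h y hy, sub_self]
  | zero => simp
  | add a b _ _ ha hb => rw [inner_add_right, ha, hb, add_zero]
  | smul c a _ ha => rw [inner_smul_right, ha, mul_zero]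

lemma norm_tangentProj_le (v : E) : ‖tangentProj K v‖ ≤ ‖v‖ := by
  simpa using (tangentProj K).le_of_opNorm_le (vectorSpan ℝ K).starProjection_norm_le v

/-- A nonempty convex set contains a relative ball. -/
lemma exists_relative_ball (hc : Convex ℝ K) (hne : K.Nonempty) :
    ∃ c ∈ K, ∃ r > 0, ∀ u ∈ vectorSpan ℝ K, ‖u‖ < r → c + u ∈ K := by
  obtain ⟨c, hci⟩ := hne.intrinsicInterior hc
  obtain ⟨c', hc', rfl⟩ := mem_intrinsicInterior.1 hci
  obtain ⟨r, hr, hball⟩ := Metric.isOpen_iff.1 isOpen_interior c' hc'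
  refine ⟨c', intrinsicInterior_subset hci, r, hr, fun u hu hur => ?_⟩
  have hm : (c' : E) + u ∈ affineSpan ℝ K := by
    rw [add_comm]
    exact AffineSubspace.vadd_mem_of_mem_direction (by rwa [direction_affineSpan]) c'.2
  have : (⟨_, hm⟩ : affineSpan ℝ K) ∈ Metric.ball c' r := by
    rw [Metric.mem_ball, Subtype.dist_eq]
    simpa [dist_eq_norm] using hur
  exact (interior_subset (hball this) :)

/-- The tangential part of the gradient of a Lipschitz function is bounded by its Lipschitz
constant, also at boundary points. -/
lemma norm_tangentProj_gradient_le {φ : E → ℝ} {g : E → E} {G L : ℝ} (hG : 0 ≤ G)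
    (hc : Convex ℝ K) (h : ∀ x ∈ K, HasGradientWithinAt φ (g x) K x)
    (hLip : ∀ x ∈ K, ∀ y ∈ K, |φ x - φ y| ≤ G * ‖x - y‖)
    (hS : ∀ x ∈ K, ∀ y ∈ K, ‖g x - g y‖ ≤ L * ‖x - y‖) {x : E} (hx : x ∈ K) :
    ‖tangentProj K (g x)‖ ≤ G := by
  obtain ⟨c, hcK, r, hr, hball⟩ := exists_relative_ball hc ⟨x, hx⟩
  have key : ∀ u ∈ vectorSpan ℝ K, ‖u‖ < r → ⟪g x, u⟫ ≤ G * ‖u‖ := by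
    intro u hu hur
    -- The points x + s(c - x) and x + s(c + u - x) both lie in K and differ by s u. Thus every
    -- small tangential direction u is admissible at the first point, and the Lipschitz bound
    -- applies there; continuity of the gradient carries it to x as s → 0.
    have hs : ∀ s ∈ Set.Ioo (0 : ℝ) 1, ⟪g x, u⟫ ≤ G * ‖u‖ + L * (s * ‖c - x‖) * ‖u‖ := by
      intro s hs
      have hs' : s ∈ Set.Icc (0 : ℝ) 1 := ⟨hs.1.le, hs.2.le⟩
      have hp : x + s • (c - x) ∈ K := hc.add_smul_sub_mem hx hcK hs'
      have hq : x + s • (c + u - x) ∈ K := hc.add_smul_sub_mem hx (hball u hu hur) hs'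
      have e : x + s • (c + u - x) - (x + s • (c - x)) = s • u := by
        rw [add_sub_add_left_eq_sub, ← smul_sub]; congr 1; abel
      have h1 := HasGradientWithinAt.abs_inner_le_of_lipschitz hc hp hq (h _ hp) hLip
      rw [e, inner_smul_right, abs_mul, norm_smul, Real.norm_eq_abs, abs_of_pos hs.1] at h1
      have h2 : |⟪g (x + s • (c - x)), u⟫| ≤ G * ‖u‖ := by
        have := hs.1
        by_contra hcon
        push Not at hcon
        nlinarith
      have h3 : ⟪g x - g (x + s • (c - x)), u⟫ ≤ L * (s * ‖c - x‖) * ‖u‖ := by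
        refine (real_inner_le_norm _ _).trans ?_
        gcongr
        have := hS _ hx _ hp
        rwa [sub_add_cancel_left, norm_neg, norm_smul, Real.norm_eq_abs, abs_of_pos hs.1] at this
      rw [inner_sub_left] at h3
      linarith [le_abs_self ⟪g (x + s • (c - x)), u⟫]
    have ht : Filter.Tendsto (fun s : ℝ => G * ‖u‖ + L * (s * ‖c - x‖) * ‖u‖)
        (nhdsWithin 0 (Set.Ioo 0 1)) (nhds (G * ‖u‖ + L * (0 * ‖c - x‖) * ‖u‖)) := by
      apply tendsto_nhdsWithin_of_tendsto_nhds
      exact (by fun_prop : Continuous fun s : ℝ => G * ‖u‖ + L * (s * ‖c - x‖) * ‖u‖).tendsto 0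
    have : (nhdsWithin (0 : ℝ) (Set.Ioo 0 1)).NeBot := by
      rw [nhdsWithin_Ioo_eq_nhdsGT one_pos]; infer_instance
    have := ge_of_tendsto ht (by filter_upwards [self_mem_nhdsWithin] with s hs' using hs s hs')
    simpa using this
  set p := tangentProj K (g x) with hp
  have hpm : p ∈ vectorSpan ℝ K := Submodule.starProjection_apply_mem _ _
  have hpp : ⟪g x, p⟫ = ‖p‖ ^ 2 := by
    have := (vectorSpan ℝ K).starProjection_inner_eq_zero (g x) p hpm
    rw [inner_sub_left, ← hp, real_inner_self_eq_norm_sq] at this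
    linarith
  by_contra hcon
  push Not at hcon
  have hpos : 0 < ‖p‖ := hG.trans_lt hcon
  -- Test with the tangential part itself, rescaled to norm r/2 so that it stays in the relative
  -- ball.
  have h1 := key ((r / (2 * ‖p‖)) • p) (Submodule.smul_mem _ _ hpm) (by
    rw [norm_smul, Real.norm_eq_abs, abs_of_pos (by positivity)]
    field_simp; linarith)
  rw [inner_smul_right, norm_smul, Real.norm_eq_abs, abs_of_pos (by positivity), hpp] at h1
  have h2 : 0 < r / (2 * ‖p‖) := by positivity
  have h3 : ‖p‖ ^ 2 ≤ G * ‖p‖ := by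
    by_contra hh
    push Not at hh
    nlinarith
  nlinarith

end Tangential

/-! ### The trajectory of the algorithm -/

lemma weightSum_natCast {α : ℕ → ℝ} (hα : ∀ t, α t = t) (t : ℕ) :
    weightSum α t = t * (t + 1) / 2 := by
  unfold weightSum
  induction t with
  | zero => simp
  | succ t ih => rw [Finset.sum_Icc_succ_top (by omega), ih, hα]; push_cast; ring

lemma weight_div_weightSum {α : ℕ → ℝ} (hα : ∀ t, α t = t) (t : ℕ) :
    α (t + 1) / weightSum α (t + 1) = 2 / (t + 2) := by
  rw [weightSum_natCast hα, hα]
  push_cast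
  field_simp
  ring

section Trajectory

variable {E : Type*} [NormedAddCommGroup E] [InnerProductSpace ℝ E] {M T : ℕ}
  {𝒵 : Fin M → Type*} {K : Set E} {grad : ∀ i, 𝒵 i → E → E} {α : ℕ → ℝ} {η : ℝ} {m : ℕ}
  {x₀ : E} {S : FedDataset T 𝒵} {sel : Fin T → Finset (Fin M)} {Y : Fin T → E}

/-- The difference `α_{k+1} ∇f_i(x_{k+1}; z) - α_k ∇f_i(x_k; z)` sent by machine `i`. -/
def roundMessage (grad : ∀ i, 𝒵 i → E → E) (α : ℕ → ℝ) (k : ℕ) (x xPrev : E) (i : Fin M)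
    (z : 𝒵 i) : E :=
  α (k + 1) • grad i z x - α k • grad i z xPrev

lemma trustedState_succ_q {k : ℕ} (h : k + 1 ≤ T) :
    (trustedState K grad α η m x₀ S sel Y (k + 1) h).q =
      (trustedState K grad α η m x₀ S sel Y k (Nat.le_of_succ_le h)).q + (m : ℝ)⁻¹ •
        ∑ i ∈ sel ⟨k, h⟩, roundMessage grad α k
          (trustedState K grad α η m x₀ S sel Y k (Nat.le_of_succ_le h)).x
          (trustedState K grad α η m x₀ S sel Y k (Nat.le_of_succ_le h)).xPrev i (S i ⟨k, h⟩) :=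
  rfl

lemma trustedState_succ_w {k : ℕ} (h : k + 1 ≤ T) :
    (trustedState K grad α η m x₀ S sel Y (k + 1) h).w =
      projOn K ((trustedState K grad α η m x₀ S sel Y k (Nat.le_of_succ_le h)).w - η •
        ((trustedState K grad α η m x₀ S sel Y (k + 1) h).q + Y ⟨k, h⟩)) :=
  rfl

lemma trustedState_succ_xPrev {k : ℕ} (h : k + 1 ≤ T) :
    (trustedState K grad α η m x₀ S sel Y (k + 1) h).xPrev =
      (trustedState K grad α η m x₀ S sel Y k (Nat.le_of_succ_le h)).x :=
  rfl

lemma trustedState_succ_x (hα : ∀ t, α t = t) {k : ℕ} (h : k + 1 ≤ T) :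
    (trustedState K grad α η m x₀ S sel Y (k + 1) h).x =
      (trustedState K grad α η m x₀ S sel Y k (Nat.le_of_succ_le h)).x +
        (2 / ((k : ℝ) + 3)) • ((trustedState K grad α η m x₀ S sel Y (k + 1) h).w -
          (trustedState K grad α η m x₀ S sel Y k (Nat.le_of_succ_le h)).x) := by
  have h1 := weight_div_weightSum hα (k + 1)
  -- After k + 1 rounds the state holds x_{k+2}, whose averaging weight is α_{k+2}/α_{1:k+2} =
  -- 2/(k+3).
  have e : (2 : ℝ) / ((k : ℝ) + 3) = α (k + 1 + 1) / weightSum α (k + 1 + 1) := by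
    rw [h1]; push_cast; congr 1; ring
  rw [e]
  generalize hw : (trustedState K grad α η m x₀ S sel Y (k + 1) h).w = w
  change (1 - α (k + 1 + 1) / weightSum α (k + 1 + 1)) • _ +
    (α (k + 1 + 1) / weightSum α (k + 1 + 1)) • (trustedState K grad α η m x₀ S sel Y (k + 1) h).w
      = _
  rw [hw, sub_smul, one_smul, smul_sub]
  abel

lemma trustedState_mem (hK : IsCompact K) (hc : Convex ℝ K) (hx₀ : x₀ ∈ K)
    (hα : ∀ t, α t = t) (k : ℕ) (h : k ≤ T) :
    (trustedState K grad α η m x₀ S sel Y k h).w ∈ K ∧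
    (trustedState K grad α η m x₀ S sel Y k h).x ∈ K ∧
    (trustedState K grad α η m x₀ S sel Y k h).xPrev ∈ K := by
  induction k with
  | zero => exact ⟨hx₀, hx₀, hx₀⟩
  | succ k ih =>
    obtain ⟨h1, h2, h3⟩ := ih (Nat.le_of_succ_le h)
    have hw : (trustedState K grad α η m x₀ S sel Y (k + 1) h).w ∈ K :=
      projOn_mem hK ⟨x₀, hx₀⟩ _
    refine ⟨hw, ?_, h2⟩
    rw [trustedState_succ_x hα]
    refine hc.add_smul_sub_mem h2 hw ⟨by positivity, ?_⟩
    rw [div_le_one (by positivity)]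
    have : (0 : ℝ) ≤ k := by positivity
    linarith

/-- One averaging step moves the query by a fraction of order 2/k of a vector joining two points of
K. This slow motion offsets the growing weights in the messages. -/
lemma mul_norm_trustedState_sub_le (hK : IsCompact K) (hc : Convex ℝ K) (hx₀ : x₀ ∈ K)
    (hα : ∀ t, α t = t) {D : ℝ} (hD : ∀ x ∈ K, ∀ y ∈ K, ‖x - y‖ ≤ D) (k : ℕ) (h : k ≤ T) :
    k * ‖(trustedState K grad α η m x₀ S sel Y k h).x -
      (trustedState K grad α η m x₀ S sel Y k h).xPrev‖ ≤ 2 * D := by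
  have hD0 : 0 ≤ D := by simpa using hD _ hx₀ _ hx₀
  cases k with
  | zero => simpa using hD0
  | succ k =>
    obtain ⟨-, h2, -⟩ := trustedState_mem (grad := grad) (η := η) (m := m) (S := S) (sel := sel)
      (Y := Y) hK hc hx₀ hα k (Nat.le_of_succ_le h)
    obtain ⟨h1, -, -⟩ := trustedState_mem (grad := grad) (η := η) (m := m) (S := S) (sel := sel)
      (Y := Y) hK hc hx₀ hα (k + 1) h
    rw [trustedState_succ_xPrev, trustedState_succ_x hα, add_sub_cancel_left, norm_smul,
      Real.norm_eq_abs, abs_of_pos (by positivity)]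
    have := hD _ h1 _ h2
    push_cast
    have e : ((k : ℝ) + 1) * (2 / (k + 3)) ≤ 2 := by
      rw [mul_div_assoc', div_le_iff₀ (by positivity)]; linarith
    rw [← mul_assoc]
    exact mul_le_mul e this (norm_nonneg _) zero_le_two

/-- Because α_{k+1} - α_k = 1, the message is one gradient plus k times a gradient increment. The
bound is uniform in the round and is the sensitivity S. -/
lemma norm_roundMessage_le {G L D : ℝ} (hα : ∀ t, α t = t) (hL : 0 ≤ L)
    (hgG : ∀ i z x, ‖grad i z x‖ ≤ G)
    (hgL : ∀ i z x y, ‖grad i z x - grad i z y‖ ≤ L * ‖x - y‖) {k : ℕ} {x xPrev : E}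
    (hx : k * ‖x - xPrev‖ ≤ 2 * D) (i : Fin M) (z : 𝒵 i) :
    ‖roundMessage grad α k x xPrev i z‖ ≤ G + 2 * L * D := by
  have e : roundMessage grad α k x xPrev i z =
      grad i z x + (k : ℝ) • (grad i z x - grad i z xPrev) := by
    simp only [roundMessage, hα, smul_sub]
    push_cast
    rw [add_smul, one_smul]; abel
  rw [e]
  refine (norm_add_le _ _).trans ?_
  rw [norm_smul, Real.norm_natCast]
  have h1 := hgG i z x
  have h2 := hgL i z x xPrev
  have h3 : (k : ℝ) * ‖grad i z x - grad i z xPrev‖ ≤ k * (L * ‖x - xPrev‖) := by gcongr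
  nlinarith

/-- Causality: rounds from k + 1 on do not affect the state after k rounds. This makes the noise
shift adapted to the past and allows the randomness of a round to be redrawn without altering the
state at its beginning. -/
lemma trustedState_congr {S' : FedDataset T 𝒵} {sel' : Fin T → Finset (Fin M)} {Y' : Fin T → E}
    (k : ℕ) (h : k ≤ T) (hS : ∀ (t : Fin T), t.1 < k → ∀ i, S i t = S' i t)
    (hsel : ∀ (t : Fin T), t.1 < k → sel t = sel' t) (hY : ∀ (t : Fin T), t.1 < k → Y t = Y' t) :
    trustedState K grad α η m x₀ S sel Y k h = trustedState K grad α η m x₀ S' sel' Y' k h := by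
  induction k with
  | zero => rfl
  | succ k ih =>
    have := ih (Nat.le_of_succ_le h) (fun t ht => hS t (by omega)) (fun t ht => hsel t (by omega))
      (fun t ht => hY t (by omega))
    simp only [trustedState, this, hsel ⟨k, h⟩ (Nat.lt_succ_self k), hY ⟨k, h⟩ (Nat.lt_succ_self k),
      hS ⟨k, h⟩ (Nat.lt_succ_self k)]

/-- Changing one sample in round `t₀` can be compensated by shifting the noise of all rounds from
`t₀` on by the change of the message. -/
lemma trustedState_shift {S' : FedDataset T 𝒵} {i₀ : Fin M} {t₀ : Fin T}
    (hSS' : ∀ (j : Fin M) (s : Fin T), ¬ (j = i₀ ∧ s = t₀) → S j s = S' j s) {u : E}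
    (hu : u = (m : ℝ)⁻¹ • if i₀ ∈ sel t₀ then
      roundMessage grad α t₀ (trustedState K grad α η m x₀ S sel Y t₀ t₀.2.le).x
        (trustedState K grad α η m x₀ S sel Y t₀ t₀.2.le).xPrev i₀ (S i₀ t₀) -
      roundMessage grad α t₀ (trustedState K grad α η m x₀ S sel Y t₀ t₀.2.le).x
        (trustedState K grad α η m x₀ S sel Y t₀ t₀.2.le).xPrev i₀ (S' i₀ t₀) else 0)
    (k : ℕ) (h : k ≤ T) :
    (trustedState K grad α η m x₀ S' sel (fun t => Y t + if t₀ ≤ t then u else 0) k h).w =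
      (trustedState K grad α η m x₀ S sel Y k h).w ∧
    (trustedState K grad α η m x₀ S' sel (fun t => Y t + if t₀ ≤ t then u else 0) k h).x =
      (trustedState K grad α η m x₀ S sel Y k h).x ∧
    (trustedState K grad α η m x₀ S' sel (fun t => Y t + if t₀ ≤ t then u else 0) k h).xPrev =
      (trustedState K grad α η m x₀ S sel Y k h).xPrev ∧
    (trustedState K grad α η m x₀ S sel Y k h).q =
      (trustedState K grad α η m x₀ S' sel (fun t => Y t + if t₀ ≤ t then u else 0) k h).q
        + if t₀.1 < k then u else 0 := by
  induction k with
  | zero => exact ⟨rfl, rfl, rfl, by simp [trustedState]⟩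
  | succ k ih =>
    obtain ⟨h1, h2, h3, h4⟩ := ih (Nat.le_of_succ_le h)
    set Y' : Fin T → E := fun t => Y t + if t₀ ≤ t then u else 0
    have hq : (trustedState K grad α η m x₀ S sel Y (k + 1) h).q =
        (trustedState K grad α η m x₀ S' sel Y' (k + 1) h).q
          + if t₀.1 < k + 1 then u else 0 := by
      rw [trustedState_succ_q, trustedState_succ_q, h2, h3, h4]
      -- After round t₀ the messages agree again, because the queries coincide, but q keeps the
      -- offset u; this is why the shift must persist in all later rounds. In round t₀ the messages
      -- differ by exactly u, before it not at all.
      rcases lt_trichotomy t₀.1 k with hlt | heq | hgt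
      · rw [if_pos hlt, if_pos (by omega), add_right_comm]
        congr 3
        refine Finset.sum_congr rfl fun i _ => ?_
        rw [hSS' i ⟨k, h⟩]
        rintro ⟨-, h5⟩
        rw [← h5] at hlt
        exact lt_irrefl _ hlt
      · have ht : (⟨k, h⟩ : Fin T) = t₀ := Fin.ext heq.symm
        rw [if_neg (by omega), if_pos (by omega), add_zero, add_assoc, hu, ← smul_add]
        congr 2
        subst heq
        rw [ht, ← sub_eq_iff_eq_add', ← Finset.sum_sub_distrib]
        rw [← Finset.sum_ite_eq (sel t₀) i₀ (fun i => roundMessage grad α t₀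
          (trustedState K grad α η m x₀ S sel Y t₀ t₀.2.le).x
          (trustedState K grad α η m x₀ S sel Y t₀ t₀.2.le).xPrev i (S i t₀) -
          roundMessage grad α t₀ (trustedState K grad α η m x₀ S sel Y t₀ t₀.2.le).x
          (trustedState K grad α η m x₀ S sel Y t₀ t₀.2.le).xPrev i (S' i t₀))]
        refine Finset.sum_congr rfl fun i _ => ?_
        split_ifs with hi
        · rfl
        · rw [hSS' i t₀ (fun h5 => hi h5.1.symm), sub_self]
      · rw [if_neg (by omega), if_neg (by omega), add_zero, add_zero]
        congr 2
        refine Finset.sum_congr rfl fun i _ => ?_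
        rw [hSS' i ⟨k, h⟩]
        rintro ⟨-, h5⟩
        rw [← h5] at hgt
        exact lt_irrefl _ hgt
    have hw : (trustedState K grad α η m x₀ S' sel Y' (k + 1) h).w =
        (trustedState K grad α η m x₀ S sel Y (k + 1) h).w := by
      rw [trustedState_succ_w, trustedState_succ_w, h1, hq]
      congr 3
      simp only [Y', Fin.le_def]
      by_cases hk : t₀.1 ≤ k
      · rw [if_pos hk, if_pos (by omega)]; abel
      · rw [if_neg hk, if_neg (by omega)]; abel
    refine ⟨hw, ?_, h2, hq⟩
    change (1 - _) • _ + _ • (trustedState K grad α η m x₀ S' sel Y' (k + 1) h).w =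
      (1 - _) • _ + _ • (trustedState K grad α η m x₀ S sel Y (k + 1) h).w
    rw [hw, h2]

/-- Measurability of the gradients is required only after composition with the data map. So the
lemma serves a fixed dataset, where the sample spaces need no σ-algebra, as well as random data. -/
lemma measurable_trustedState [FiniteDimensional ℝ E] [MeasurableSpace E] [BorelSpace E]
    (hK : IsCompact K) (hc : Convex ℝ K) (hx₀ : x₀ ∈ K) {Ω : Type*} [MeasurableSpace Ω]
    {Sω : Ω → FedDataset T 𝒵} {selω : Ω → Fin T → Finset (Fin M)} {Yω : Ω → Fin T → E}
    (hg : ∀ i t (X : Ω → E), Measurable X → Measurable fun ω => grad i (Sω ω i t) (X ω))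
    (hsel : Measurable selω) (hY : Measurable Yω) (k : ℕ) (h : k ≤ T) :
    Measurable (fun ω => (trustedState K grad α η m x₀ (Sω ω) (selω ω) (Yω ω) k h).w) ∧
    Measurable (fun ω => (trustedState K grad α η m x₀ (Sω ω) (selω ω) (Yω ω) k h).x) ∧
    Measurable (fun ω => (trustedState K grad α η m x₀ (Sω ω) (selω ω) (Yω ω) k h).xPrev) ∧
    Measurable (fun ω => (trustedState K grad α η m x₀ (Sω ω) (selω ω) (Yω ω) k h).q) := by
  induction k with
  | zero => exact ⟨measurable_const, measurable_const, measurable_const, measurable_const⟩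
  | succ k ih =>
    obtain ⟨h1, h2, h3, h4⟩ := ih (Nat.le_of_succ_le h)
    have hq : Measurable fun ω =>
        (trustedState K grad α η m x₀ (Sω ω) (selω ω) (Yω ω) (k + 1) h).q := by
      simp_rw [trustedState_succ_q]
      refine h4.add (Measurable.const_smul ?_ _)
      have e : ∀ ω, ∑ i ∈ selω ω ⟨k, h⟩, roundMessage grad α k
          (trustedState K grad α η m x₀ (Sω ω) (selω ω) (Yω ω) k (Nat.le_of_succ_le h)).x
          (trustedState K grad α η m x₀ (Sω ω) (selω ω) (Yω ω) k (Nat.le_of_succ_le h)).xPrev i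
          (Sω ω i ⟨k, h⟩) = ∑ i, if i ∈ selω ω ⟨k, h⟩ then roundMessage grad α k
          (trustedState K grad α η m x₀ (Sω ω) (selω ω) (Yω ω) k (Nat.le_of_succ_le h)).x
          (trustedState K grad α η m x₀ (Sω ω) (selω ω) (Yω ω) k (Nat.le_of_succ_le h)).xPrev i
          (Sω ω i ⟨k, h⟩) else 0 := fun ω => by
        rw [← Finset.sum_filter]; simp
      simp_rw [e]
      refine Finset.measurable_sum _ fun i _ => Measurable.ite ?_ ?_ measurable_const
      · exact ((measurable_pi_apply _).comp hsel) (measurableSet_mem_finset i)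
      · exact ((hg i _ _ h2).const_smul _).sub ((hg i _ _ h3).const_smul _)
    have hw : Measurable fun ω =>
        (trustedState K grad α η m x₀ (Sω ω) (selω ω) (Yω ω) (k + 1) h).w := by
      simp_rw [trustedState_succ_w]
      refine (continuous_projOn hK hc ⟨x₀, hx₀⟩).measurable.comp (h1.sub ?_)
      exact (hq.add ((measurable_pi_apply _).comp hY)).const_smul η
    exact ⟨hw, (h2.const_smul _).add (hw.const_smul _), h2, hq⟩

end Trajectory

/-! ### Reduction to tangential gradients -/

section Reduction

variable {E : Type*} [NormedAddCommGroup E] [InnerProductSpace ℝ E] [FiniteDimensional ℝ E]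
  {M T : ℕ} {𝒵 : Fin M → Type*} {K : Set E} {grad : ∀ i, 𝒵 i → E → E} {α : ℕ → ℝ} {η : ℝ} {m : ℕ}
  {x₀ : E} {S : FedDataset T 𝒵} {sel : Fin T → Finset (Fin M)} {Y : Fin T → E}

/-- The tangential gradients, extended from `K` to the whole space. -/
def tangentGrad (K : Set E) (grad : ∀ i, 𝒵 i → E → E) : ∀ i, 𝒵 i → E → E :=
  fun i z x => tangentProj K (grad i z (projOn K x))

/-- The two runs differ only in the component of q orthogonal to the direction of K, and the
projected update does not see that component. -/
lemma trustedState_tangentGrad (hK : IsCompact K) (hc : Convex ℝ K) (hx₀ : x₀ ∈ K)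
    (hα : ∀ t, α t = t) (k : ℕ) (h : k ≤ T) :
    (trustedState K (tangentGrad K grad) α η m x₀ S sel Y k h).w =
      (trustedState K grad α η m x₀ S sel Y k h).w ∧
    (trustedState K (tangentGrad K grad) α η m x₀ S sel Y k h).x =
      (trustedState K grad α η m x₀ S sel Y k h).x ∧
    (trustedState K (tangentGrad K grad) α η m x₀ S sel Y k h).xPrev =
      (trustedState K grad α η m x₀ S sel Y k h).xPrev ∧
    (trustedState K (tangentGrad K grad) α η m x₀ S sel Y k h).q =
      tangentProj K (trustedState K grad α η m x₀ S sel Y k h).q := by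
  induction k with
  | zero => exact ⟨rfl, rfl, rfl, (map_zero (tangentProj K)).symm⟩
  | succ k ih =>
    obtain ⟨h1, h2, h3, h4⟩ := ih (Nat.le_of_succ_le h)
    obtain ⟨-, m2, m3⟩ := trustedState_mem (grad := grad) (η := η) (m := m) (S := S) (sel := sel)
      (Y := Y) hK hc hx₀ hα k (Nat.le_of_succ_le h)
    have hq : (trustedState K (tangentGrad K grad) α η m x₀ S sel Y (k + 1) h).q =
        tangentProj K (trustedState K grad α η m x₀ S sel Y (k + 1) h).q := by
      rw [trustedState_succ_q, trustedState_succ_q, h2, h3, h4]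
      simp only [roundMessage, tangentGrad, projOn_of_mem hK hc m2, projOn_of_mem hK hc m3,
        map_add, map_smul, map_sum, map_sub]
    have hw : (trustedState K (tangentGrad K grad) α η m x₀ S sel Y (k + 1) h).w =
        (trustedState K grad α η m x₀ S sel Y (k + 1) h).w := by
      rw [trustedState_succ_w, trustedState_succ_w, h1, hq]
      refine projOn_eq_of_sub_orthogonal hK hc ⟨x₀, hx₀⟩ fun a ha b hb => ?_
      rw [sub_sub_sub_cancel_left, ← smul_sub, add_sub_add_right_eq_sub, inner_smul_left,
        inner_sub_left, inner_tangentProj _ ha hb, sub_self, mul_zero]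
    refine ⟨hw, ?_, h2, hq⟩
    rw [trustedState_succ_x hα, trustedState_succ_x hα, hw, h2]

lemma trustedQueries_tangentGrad (hK : IsCompact K) (hc : Convex ℝ K) (hx₀ : x₀ ∈ K)
    (hα : ∀ t, α t = t) :
    trustedQueries K grad α η m x₀ S sel Y =
      trustedQueries K (tangentGrad K grad) α η m x₀ S sel Y :=
  funext fun k => (trustedState_tangentGrad hK hc hx₀ hα k.1 _).2.1.symm

lemma norm_tangentGrad_sub_le (hK : IsCompact K) (hc : Convex ℝ K) (hne : K.Nonempty) {L : ℝ}
    (hL : 0 ≤ L) (hS : ∀ i z, ∀ x ∈ K, ∀ y ∈ K, ‖grad i z x - grad i z y‖ ≤ L * ‖x - y‖)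
    (i : Fin M) (z : 𝒵 i) (x y : E) :
    ‖tangentGrad K grad i z x - tangentGrad K grad i z y‖ ≤ L * ‖x - y‖ := by
  rw [tangentGrad, tangentGrad, ← map_sub]
  refine (norm_tangentProj_le _).trans ((hS i z _ (projOn_mem hK hne x) _
    (projOn_mem hK hne y)).trans ?_)
  gcongr
  exact norm_projOn_sub_le hK hc hne x y

end Reduction

/-! ### Data processing for the Rényi divergence -/

section Renyi

lemma lintegral_withDensity_mul {X : Type*} [MeasurableSpace X] (μ : Measure X) {f g : X → ℝ≥0∞}
    (hf : Measurable f) (hg : Measurable g) :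
    ∫⁻ x, g x ∂(μ.withDensity f) = ∫⁻ x, f x * g x ∂μ :=
  lintegral_withDensity_eq_lintegral_mul _ hf hg

variable {Ω₀ Ω : Type*} [MeasurableSpace Ω₀] [MeasurableSpace Ω]

/-- The density r of the image measures, pulled back by F, has the same integrals as p against
functions of F. Testing with r^(α-1) and applying Young's inequality yields A ≤ B/α + (1 - 1/α)A for
the two α-moments, hence A ≤ B. The subtraction needs A finite, which is why r is first truncated at
n. -/
lemma lintegral_rnDeriv_rpow_map_le {Q₀ : Measure Ω₀} [IsFiniteMeasure Q₀] {p : Ω₀ → ℝ≥0∞}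
    (hp : Measurable p) [IsFiniteMeasure (Q₀.withDensity p)] {F : Ω₀ → Ω} (hF : Measurable F)
    {α : ℝ} (hα : 1 < α) :
    ∫⁻ x, ((Q₀.withDensity p).map F).rnDeriv (Q₀.map F) x ^ (α - 1) ∂((Q₀.withDensity p).map F)
      ≤ ∫⁻ y, p y ^ α ∂Q₀ := by
  set P := (Q₀.withDensity p).map F with hP
  set Q := Q₀.map F with hQ
  set r := P.rnDeriv Q with hr
  have hrm : Measurable r := Measure.measurable_rnDeriv P Q
  have hac : P ≪ Q := (withDensity_absolutelyContinuous Q₀ p).map hF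
  have hwd : Q.withDensity r = P := Measure.withDensity_rnDeriv_eq P Q hac
  have hα0 : 0 < α := by linarith
  have key : ∀ ψ : Ω → ℝ≥0∞, Measurable ψ →
      ∫⁻ y, r (F y) * ψ (F y) ∂Q₀ = ∫⁻ y, p y * ψ (F y) ∂Q₀ ∧
      ∫⁻ x, ψ x ∂P = ∫⁻ y, r (F y) * ψ (F y) ∂Q₀ := by
    intro ψ hψ
    have h1 : ∫⁻ x, ψ x ∂P = ∫⁻ y, p y * ψ (F y) ∂Q₀ := by
      rw [hP, lintegral_map hψ hF]
      exact lintegral_withDensity_mul _ hp (hψ.comp hF)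
    have h2 : ∫⁻ x, ψ x ∂P = ∫⁻ y, r (F y) * ψ (F y) ∂Q₀ := by
      rw [← hwd, lintegral_withDensity_mul _ hrm hψ, hQ]
      exact lintegral_map (hrm.mul hψ) hF
    exact ⟨h2.symm.trans h1, h2⟩
  set B := ∫⁻ y, p y ^ α ∂Q₀ with hB
  have hconj : α.HolderConjugate (α / (α - 1)) := Real.HolderConjugate.conjExponent hα
  have htr : ∀ n : ℕ, ∫⁻ y, min (r (F y)) n ^ α ∂Q₀ ≤ B := by
    intro n
    -- The conjugate exponent α/(α-1) turns this test function back into min(r, n)^α.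
    set ψ : Ω → ℝ≥0∞ := fun x => min (r x) n ^ (α - 1) with hψ
    have hψm : Measurable ψ := (hrm.min measurable_const).pow_const _
    set A := ∫⁻ y, min (r (F y)) n ^ α ∂Q₀ with hA
    have hAfin : A ≠ ∞ := by
      refine ne_top_of_le_ne_top (b := ∫⁻ _, (n : ℝ≥0∞) ^ α ∂Q₀) ?_
        (lintegral_mono fun y => ENNReal.rpow_le_rpow (min_le_right _ _) hα0.le)
      rw [lintegral_const]
      exact ENNReal.mul_ne_top (ENNReal.rpow_ne_top_of_nonneg hα0.le (ENNReal.natCast_ne_top n))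
        (measure_ne_top _ _)
    have h1 : A ≤ ∫⁻ y, r (F y) * ψ (F y) ∂Q₀ := by
      refine lintegral_mono fun y => ?_
      have : min (r (F y)) n ^ α = min (r (F y)) n * min (r (F y)) n ^ (α - 1) := by
        have h := ENNReal.rpow_add_of_nonneg (x := min (r (F y)) n) 1 (α - 1) zero_le_one
          (by linarith)
        rw [ENNReal.rpow_one] at h
        rw [← h]; congr 1; ring
      change min (r (F y)) n ^ α ≤ _
      rw [this]
      exact mul_le_mul' (min_le_left _ _) le_rfl
    have h2 : ∫⁻ y, p y * ψ (F y) ∂Q₀ ≤ B / ENNReal.ofReal α +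
        A / ENNReal.ofReal (α / (α - 1)) := by
      have hpt : ∀ y, p y * ψ (F y) ≤ p y ^ α / ENNReal.ofReal α +
          min (r (F y)) n ^ α / ENNReal.ofReal (α / (α - 1)) := by
        intro y
        refine (ENNReal.young_inequality _ _ hconj).trans (le_of_eq ?_)
        have : ψ (F y) ^ (α / (α - 1)) = min (r (F y)) n ^ α := by
          rw [hψ, ← ENNReal.rpow_mul]
          congr 1
          field_simp [show α - 1 ≠ 0 by linarith]
        rw [this]
      refine (lintegral_mono hpt).trans (le_of_eq ?_)
      have hm : Measurable fun y => min (r (F y)) (n : ℝ≥0∞) ^ α :=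
        ((hrm.comp hF).min measurable_const).pow_const _
      simp only [div_eq_mul_inv]
      rw [lintegral_add_left (by fun_prop), lintegral_mul_const _ (by fun_prop),
        lintegral_mul_const _ hm]
    rw [(key ψ hψm).1] at h1
    have h3 := h1.trans h2
    by_cases hBt : B = ∞
    · rw [hBt]; exact le_top
    clear_value A B
    lift A to NNReal using hAfin
    lift B to NNReal using hBt
    have ha : ENNReal.ofReal α = ((α.toNNReal : NNReal) : ℝ≥0∞) := rfl
    have hb : ENNReal.ofReal (α / (α - 1)) = (((α / (α - 1)).toNNReal : NNReal) : ℝ≥0∞) := rfl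
    have hq0 : 0 < α / (α - 1) := div_pos hα0 (by linarith)
    rw [ha, hb, ← ENNReal.coe_div (by simpa using hα0), ← ENNReal.coe_div (by simpa using hq0),
      ← ENNReal.coe_add, ENNReal.coe_le_coe, ← NNReal.coe_le_coe] at h3
    push_cast [Real.coe_toNNReal _ hα0.le, Real.coe_toNNReal _ hq0.le] at h3
    rw [ENNReal.coe_le_coe, ← NNReal.coe_le_coe]
    have e : (A : ℝ) / (α / (α - 1)) = A - A / α := by
      field_simp [show α - 1 ≠ 0 by linarith]
    rw [e] at h3
    have h4 : (A : ℝ) / α ≤ B / α := by linarith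
    exact (div_le_div_iff_of_pos_right hα0).1 h4
  have hlim : Filter.Tendsto (fun n : ℕ => ∫⁻ y, min (r (F y)) n ^ α ∂Q₀) Filter.atTop
      (nhds (∫⁻ y, r (F y) ^ α ∂Q₀)) := by
    refine lintegral_tendsto_of_tendsto_of_monotone
      (fun n => (((hrm.comp hF).min measurable_const).pow_const _).aemeasurable) ?_ ?_
    · refine Filter.Eventually.of_forall fun y a b hab => ?_
      exact ENNReal.rpow_le_rpow (min_le_min le_rfl (by exact_mod_cast hab)) hα0.le
    · refine Filter.Eventually.of_forall fun y => ?_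
      have h1 : Filter.Tendsto (fun n : ℕ => min (r (F y)) (n : ℝ≥0∞)) Filter.atTop
          (nhds (min (r (F y)) ⊤)) := tendsto_const_nhds.min ENNReal.tendsto_nat_nhds_top
      rw [min_top_right] at h1
      exact (ENNReal.continuous_rpow_const.tendsto _).comp h1
  have hfin := le_of_tendsto' hlim htr
  refine le_trans (le_of_eq ?_) hfin
  rw [(key (fun x => r x ^ (α - 1)) (hrm.pow_const _)).2]
  refine lintegral_congr fun y => ?_
  have h := ENNReal.rpow_add_of_nonneg (x := r (F y)) 1 (α - 1) zero_le_one (by linarith)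
  rw [ENNReal.rpow_one] at h
  rw [← h]; congr 1; ring

lemma renyiDivergence_map_le {Q₀ : Measure Ω₀} [IsFiniteMeasure Q₀] {p : Ω₀ → ℝ≥0∞}
    (hp : Measurable p) [IsFiniteMeasure (Q₀.withDensity p)] {F : Ω₀ → Ω} (hF : Measurable F)
    {α c : ℝ} (hα : 1 < α) (hc : ∫⁻ y, p y ^ α ∂Q₀ ≤ ENNReal.ofReal (Real.exp ((α - 1) * c))) :
    renyiDivergence α ((Q₀.withDensity p).map F) (Q₀.map F) ≤ (c : EReal) := by
  rw [renyiDivergence, if_pos ((withDensity_absolutelyContinuous Q₀ p).map hF)]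
  have h := (lintegral_rnDeriv_rpow_map_le hp hF hα).trans hc
  have h1 := ENNReal.log_monotone h
  rw [ENNReal.log_ofReal_of_pos (Real.exp_pos _), Real.log_exp] at h1
  have hinv : (0 : EReal) ≤ (((α - 1)⁻¹ : ℝ) : EReal) := by
    exact_mod_cast inv_nonneg.2 (by linarith)
  refine (mul_le_mul_of_nonneg_left h1 hinv).trans (le_of_eq ?_)
  rw [← EReal.coe_mul, inv_mul_cancel_left₀ (by linarith)]

end Renyi

/-! ### Shifts of Gaussian noise -/

section Gaussian

lemma map_withDensity_comp {X Y : Type*} [MeasurableSpace X] [MeasurableSpace Y] (μ : Measure X)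
    {g : X → Y} (hg : Measurable g) {f : Y → ℝ≥0∞} (hf : Measurable f) :
    (μ.withDensity (fun x => f (g x))).map g = (μ.map g).withDensity f := by
  ext s hs
  rw [Measure.map_apply hg hs, withDensity_apply _ (hg hs), withDensity_apply _ hs,
    setLIntegral_map hs hf hg]

lemma pi_withDensity {ι : Type*} [Fintype ι] {X : ι → Type*} [∀ i, MeasurableSpace (X i)]
    (μ : ∀ i, Measure (X i)) [∀ i, IsProbabilityMeasure (μ i)] {f : ∀ i, X i → ℝ≥0∞}
    (hf : ∀ i, Measurable (f i)) [∀ i, SigmaFinite ((μ i).withDensity (f i))] :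
    Measure.pi (fun i => (μ i).withDensity (f i)) =
      (Measure.pi μ).withDensity (fun x => ∏ i, f i (x i)) := by
  refine Measure.pi_eq fun s hs => ?_
  rw [withDensity_apply _ (MeasurableSet.univ_pi hs), ← lintegral_indicator (.univ_pi hs)]
  have e : ∀ x : ∀ i, X i, (Set.univ.pi s).indicator (fun x => ∏ i, f i (x i)) x =
      ∏ i, (s i).indicator (f i) (x i) := by
    intro x
    by_cases hx : x ∈ Set.univ.pi s
    · rw [Set.indicator_of_mem hx]
      exact Finset.prod_congr rfl fun i _ => (Set.indicator_of_mem (hx i trivial) _).symm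
    · rw [Set.indicator_of_notMem hx]
      simp only [Set.mem_pi, Set.mem_univ, true_implies, not_forall] at hx
      obtain ⟨i, hi⟩ := hx
      exact (Finset.prod_eq_zero (Finset.mem_univ i) (Set.indicator_of_notMem hi _)).symm
  simp_rw [e]
  have hm : ∀ i, Measurable ((s i).indicator (f i)) := fun i => (hf i).indicator (hs i)
  rw [lintegral_prod_eq_prod_lintegral_of_indepFun Finset.univ
    (fun i (x : ∀ i, X i) => (s i).indicator (f i) (x i))
    (iIndepFun_pi (fun i => (hm i).aemeasurable))
    (fun i => (hm i).comp (measurable_pi_apply i))]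
  refine Finset.prod_congr rfl fun i _ => ?_
  rw [(measurePreserving_eval μ i).lintegral_comp (hm i), lintegral_indicator (hs i),
    withDensity_apply _ (hs i)]

/-- The density of `N(h, v I)` with respect to `N(0, v I)`. -/
def gaussianTilt {E : Type*} [NormedAddCommGroup E] [InnerProductSpace ℝ E] (v : ℝ) (h y : E) :
    ℝ≥0∞ :=
  ENNReal.ofReal (Real.exp (⟪h, y⟫ / v - ‖h‖ ^ 2 / (2 * v)))

variable {d T : ℕ}

@[fun_prop]
lemma measurable_gaussianTilt_uncurry {E : Type*} [NormedAddCommGroup E] [InnerProductSpace ℝ E]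
    [FiniteDimensional ℝ E] [MeasurableSpace E] [BorelSpace E] {Ω : Type*} [MeasurableSpace Ω]
    {v : ℝ} {h y : Ω → E} (hh : Measurable h) (hy : Measurable y) :
    Measurable fun ω => gaussianTilt v (h ω) (y ω) := by
  unfold gaussianTilt
  exact (Real.measurable_exp.comp (((hh.inner hy).div_const _).sub
    ((hh.norm.pow_const 2).div_const _))).ennreal_ofReal

@[fun_prop]
lemma measurable_gaussianTilt {E : Type*} [NormedAddCommGroup E] [InnerProductSpace ℝ E]
    [FiniteDimensional ℝ E] [MeasurableSpace E] [BorelSpace E] (v : ℝ) (h : E) :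
    Measurable (gaussianTilt v h) :=
  measurable_gaussianTilt_uncurry measurable_const measurable_id

@[simp]
lemma gaussianTilt_zero {E : Type*} [NormedAddCommGroup E] [InnerProductSpace ℝ E] (v : ℝ)
    (y : E) : gaussianTilt v 0 y = 1 := by
  simp [gaussianTilt]

/-- The a-th power of a tilt by h is, up to a constant, the tilt by a h. Tilts have total mass one,
so the constant is the Rényi moment. -/
lemma gaussianTilt_rpow {E : Type*} [NormedAddCommGroup E] [InnerProductSpace ℝ E] (v a : ℝ)
    (h y : E) : gaussianTilt v h y ^ a =
      gaussianTilt v (a • h) y * ENNReal.ofReal (Real.exp (a * (a - 1) * ‖h‖ ^ 2 / (2 * v))) := by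
  unfold gaussianTilt
  rw [ENNReal.ofReal_rpow_of_pos (Real.exp_pos _), ← Real.exp_mul,
    ← ENNReal.ofReal_mul (Real.exp_pos _).le, ← Real.exp_add]
  congr 2
  rw [inner_smul_left, norm_smul, Real.norm_eq_abs, mul_pow, sq_abs]
  simp only [conj_trivial]
  ring

lemma gaussianReal_map_add_const_eq_withDensity {v : ℝ} (hv : 0 < v) (h : ℝ) :
    (gaussianReal 0 v.toNNReal).map (· + h) =
      (gaussianReal 0 v.toNNReal).withDensity (gaussianTilt v h) := by
  have hv' : v.toNNReal ≠ 0 := by simpa using hv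
  rw [gaussianReal_map_add_const, gaussianReal_of_var_ne_zero _ hv',
    gaussianReal_of_var_ne_zero _ hv', ← withDensity_mul _ (measurable_gaussianPDF _ _)
      (measurable_gaussianTilt _ _)]
  congr 1
  ext x
  rw [Pi.mul_apply, gaussianPDF, gaussianPDF, gaussianTilt, gaussianPDFReal, gaussianPDFReal,
    ← ENNReal.ofReal_mul (by positivity), mul_assoc _ (Real.exp _), ← Real.exp_add]
  congr 3
  rw [Real.coe_toNNReal _ hv.le, Real.norm_eq_abs, sq_abs]
  simp only [RCLike.inner_apply, conj_trivial]
  field_simp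
  ring

/-- Both sides have the same characteristic function. This reduces shifts in ℝ^d to shifts of
independent real Gaussians. -/
lemma multivariateGaussian_smul_one_eq_map {v : ℝ} (hv : 0 < v) :
    multivariateGaussian 0 (v • (1 : Matrix (Fin d) (Fin d) ℝ)) =
      (Measure.pi fun _ : Fin d => gaussianReal 0 v.toNNReal).map (WithLp.toLp 2) := by
  have hS : (v • (1 : Matrix (Fin d) (Fin d) ℝ)).PosSemidef := Matrix.PosSemidef.one.smul hv.le
  apply Measure.ext_of_charFun (E := EuclideanSpace ℝ (Fin d))
  ext t
  rw [charFun_multivariateGaussian hS]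
  simp_rw [charFun_pi, charFun_gaussianReal, ← Complex.exp_sum]
  congr 1
  simp [Matrix.smul_mulVec, Finset.sum_neg_distrib, ← Finset.sum_div, dotProduct,
    Real.coe_toNNReal _ hv.le]
  exact Finset.sum_congr rfl fun i _ => by ring

instance isProbabilityMeasure_multivariateGaussian {v : ℝ} : IsProbabilityMeasure
    (multivariateGaussian 0 (v • (1 : Matrix (Fin d) (Fin d) ℝ))) := inferInstance

lemma multivariateGaussian_map_add_const {v : ℝ} (hv : 0 < v) (h : EuclideanSpace ℝ (Fin d)) :
    (multivariateGaussian 0 (v • (1 : Matrix (Fin d) (Fin d) ℝ))).map (· + h) =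
      (multivariateGaussian 0 (v • (1 : Matrix (Fin d) (Fin d) ℝ))).withDensity
        (gaussianTilt v h) := by
  have hm : Measurable (WithLp.toLp 2 : (Fin d → ℝ) → EuclideanSpace ℝ (Fin d)) := by fun_prop
  have hp : ∀ i, IsProbabilityMeasure ((gaussianReal 0 v.toNNReal).withDensity
      (gaussianTilt v (h i))) := fun i => by
    rw [← gaussianReal_map_add_const_eq_withDensity hv]
    exact Measure.isProbabilityMeasure_map (by fun_prop)
  rw [multivariateGaussian_smul_one_eq_map hv, Measure.map_map (by fun_prop) hm,
    ← map_withDensity_comp _ hm (measurable_gaussianTilt _ _)]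
  have e : (fun x : EuclideanSpace ℝ (Fin d) => x + h) ∘ WithLp.toLp 2 =
      WithLp.toLp 2 ∘ (fun (y : Fin d → ℝ) i => y i + h i) := by
    ext y i; simp
  rw [e, ← Measure.map_map hm (by fun_prop)]
  congr 1
  have := fun i => Measure.isProbabilityMeasure_map (μ := gaussianReal 0 v.toNNReal)
    (f := (· + h i)) (by fun_prop)
  rw [Measure.pi_map_pi (f := fun i x => x + h i) (fun i => by fun_prop)]
  simp_rw [gaussianReal_map_add_const_eq_withDensity hv]
  rw [pi_withDensity _ (fun i => measurable_gaussianTilt _ _)]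
  congr 1
  ext y
  simp only [gaussianTilt]
  rw [← ENNReal.ofReal_prod_of_nonneg (fun i _ => (Real.exp_pos _).le), ← Real.exp_sum]
  congr 2
  rw [Finset.sum_sub_distrib, ← Finset.sum_div, ← Finset.sum_div, EuclideanSpace.norm_sq_eq,
    PiLp.inner_apply]

lemma gaussianNoise_map_add {v : Fin T → ℝ} (hv : ∀ t, 0 < v t)
    (h : Fin T → EuclideanSpace ℝ (Fin d)) :
    (gaussianNoise d v).map (fun Y t => Y t + h t) =
      (gaussianNoise d v).withDensity (fun Y => ∏ t, gaussianTilt (v t) (h t) (Y t)) := by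
  unfold gaussianNoise
  have hp : ∀ t, IsProbabilityMeasure ((multivariateGaussian 0
      (v t • (1 : Matrix (Fin d) (Fin d) ℝ))).withDensity (gaussianTilt (v t) (h t))) := fun t => by
    rw [← multivariateGaussian_map_add_const (hv t)]
    exact Measure.isProbabilityMeasure_map (by fun_prop)
  have := fun t => Measure.isProbabilityMeasure_map (μ := multivariateGaussian 0
    (v t • (1 : Matrix (Fin d) (Fin d) ℝ))) (f := (· + h t)) (by fun_prop)
  rw [Measure.pi_map_pi (f := fun t x => x + h t) (fun t => by fun_prop),
    funext fun t => multivariateGaussian_map_add_const (hv t) (h t),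
      pi_withDensity _ (fun i => measurable_gaussianTilt _ _)]

instance isProbabilityMeasure_gaussianNoise {v : Fin T → ℝ} :
    IsProbabilityMeasure (gaussianNoise d v) := by
  unfold gaussianNoise; infer_instance

lemma lintegral_prod_gaussianTilt_rpow {v : Fin T → ℝ} (hv : ∀ t, 0 < v t)
    (h : Fin T → EuclideanSpace ℝ (Fin d)) {a : ℝ} (ha : 0 ≤ a) :
    ∫⁻ Y, (∏ t, gaussianTilt (v t) (h t) (Y t)) ^ a ∂(gaussianNoise d v) =
      ENNReal.ofReal (Real.exp (∑ t, a * (a - 1) * ‖h t‖ ^ 2 / (2 * v t))) := by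
  simp_rw [← ENNReal.prod_rpow_of_nonneg ha, gaussianTilt_rpow, Finset.prod_mul_distrib]
  have hm : ∀ h : Fin T → EuclideanSpace ℝ (Fin d),
      Measurable fun Y : Fin T → EuclideanSpace ℝ (Fin d) =>
        ∏ t, gaussianTilt (v t) (h t) (Y t) := fun h =>
    Finset.measurable_prod _ fun t _ =>
      measurable_gaussianTilt_uncurry measurable_const (measurable_pi_apply t)
  rw [lintegral_mul_const _ (hm _), ← ENNReal.ofReal_prod_of_nonneg
    (fun i _ => (Real.exp_pos _).le), ← Real.exp_sum]
  have h1 : ∫⁻ Y, ∏ t, gaussianTilt (v t) (a • h t) (Y t) ∂(gaussianNoise d v) = 1 := by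
    rw [← setLIntegral_univ, ← withDensity_apply _ MeasurableSet.univ,
      ← gaussianNoise_map_add hv (fun t => a • h t),
      Measure.map_apply (by fun_prop) MeasurableSet.univ, Set.preimage_univ, measure_univ]
  rw [h1, one_mul]

end Gaussian

/-! ### Shears of product measures -/

section Shear

/-- Coordinates picked from two independent copies have the original law. With the earlier rounds
from one copy and the later ones from the other, the inner integral of the product plays the role of
a conditional expectation given the past. -/
lemma measurePreserving_pi_ite {ι : Type*} [Fintype ι] {X : ι → Type*}
    [∀ i, MeasurableSpace (X i)] (μ : ∀ i, Measure (X i)) [∀ i, IsProbabilityMeasure (μ i)]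
    (p : ι → Prop) [DecidablePred p] :
    MeasurePreserving (fun (x : (∀ i, X i) × (∀ i, X i)) i => if p i then x.1 i else x.2 i)
      ((Measure.pi μ).prod (Measure.pi μ)) (Measure.pi μ) := by
  have hm : Measurable (fun (x : (∀ i, X i) × (∀ i, X i)) i => if p i then x.1 i else x.2 i) := by
    refine measurable_pi_lambda _ fun i => ?_
    split_ifs <;> fun_prop
  refine ⟨hm, (Measure.pi_eq fun s hs => ?_).symm⟩
  rw [Measure.map_apply hm (.univ_pi hs)]
  have e : (fun (x : (∀ i, X i) × (∀ i, X i)) i => if p i then x.1 i else x.2 i) ⁻¹'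
      Set.univ.pi s = (Set.univ.pi fun i => if p i then s i else Set.univ) ×ˢ
        (Set.univ.pi fun i => if p i then Set.univ else s i) := by
    ext x
    simp only [Set.mem_preimage, Set.mem_pi, Set.mem_univ, true_implies, Set.mem_prod,
      ← forall_and]
    refine forall_congr' fun i => ?_
    split_ifs <;> simp
  rw [e, Measure.prod_prod, Measure.pi_pi, Measure.pi_pi, ← Finset.prod_mul_distrib]
  refine Finset.prod_congr rfl fun i _ => ?_
  split_ifs <;> simp

variable {d T : ℕ} {v : Fin T → ℝ}

lemma measurePreserving_gaussianNoise_ite (t₀ : Fin T) :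
    MeasurePreserving (fun (x : (Fin T → EuclideanSpace ℝ (Fin d)) ×
        (Fin T → EuclideanSpace ℝ (Fin d))) t => if t < t₀ then x.1 t else x.2 t)
      ((gaussianNoise d v).prod (gaussianNoise d v)) (gaussianNoise d v) :=
  measurePreserving_pi_ite _ _

/-- Resampling the noise from round `t₀` on. -/
lemma lintegral_gaussianNoise_ite (t₀ : Fin T)
    {G : (Fin T → EuclideanSpace ℝ (Fin d)) → ℝ≥0∞} (hG : Measurable G) :
    ∫⁻ Y, G Y ∂(gaussianNoise d v) = ∫⁻ Y, ∫⁻ Y', G (fun t => if t < t₀ then Y t else Y' t)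
      ∂(gaussianNoise d v) ∂(gaussianNoise d v) := by
  have hmp := measurePreserving_gaussianNoise_ite (d := d) (v := v) t₀
  rw [← hmp.lintegral_comp hG]
  exact lintegral_prod _ (hG.comp hmp.measurable).aemeasurable

/-- The density of a shear that shifts the noise from round `t₀` on by a vector that depends on
the earlier noise only. -/
def shearDensity (v : Fin T → ℝ) (t₀ : Fin T)
    (u : (Fin T → EuclideanSpace ℝ (Fin d)) → EuclideanSpace ℝ (Fin d))
    (Y : Fin T → EuclideanSpace ℝ (Fin d)) : ℝ≥0∞ :=
  ∏ t, gaussianTilt (v t) (if t₀ ≤ t then u Y else 0) (Y t)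

/-- Once the noise before t₀ is frozen, u is a constant vector and the density becomes that of an
ordinary translation; the factors before t₀ equal one. -/
lemma shearDensity_ite {t₀ : Fin T}
    {u : (Fin T → EuclideanSpace ℝ (Fin d)) → EuclideanSpace ℝ (Fin d)}
    (hu : ∀ Y Y', (∀ t < t₀, Y t = Y' t) → u Y = u Y')
    (Y Y' : Fin T → EuclideanSpace ℝ (Fin d)) :
    shearDensity v t₀ u (fun t => if t < t₀ then Y t else Y' t) =
      ∏ t, gaussianTilt (v t) (if t₀ ≤ t then u Y else 0) (Y' t) := by
  unfold shearDensity
  rw [hu (fun t => if t < t₀ then Y t else Y' t) Y (fun t ht => if_pos ht)]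
  refine Finset.prod_congr rfl fun t _ => ?_
  by_cases ht : t₀ ≤ t
  · simp only [if_pos ht, if_neg (not_lt.2 ht)]
  · rw [if_neg ht, gaussianTilt_zero, gaussianTilt_zero]

lemma measurable_shearDensity {Ω : Type*} [MeasurableSpace Ω] {t₀ : Fin T}
    {u : Ω → (Fin T → EuclideanSpace ℝ (Fin d)) → EuclideanSpace ℝ (Fin d)}
    (hum : Measurable (Function.uncurry u)) :
    Measurable fun x : Ω × (Fin T → EuclideanSpace ℝ (Fin d)) =>
      shearDensity v t₀ (u x.1) x.2 := by
  refine Finset.measurable_prod _ fun t _ => measurable_gaussianTilt_uncurry ?_ (by fun_prop)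
  split_ifs
  · exact hum
  · exact measurable_const

lemma measurable_shearDensity_apply {t₀ : Fin T}
    {u : (Fin T → EuclideanSpace ℝ (Fin d)) → EuclideanSpace ℝ (Fin d)} (hum : Measurable u) :
    Measurable (shearDensity v t₀ u) := by
  refine Finset.measurable_prod _ fun t _ =>
    measurable_gaussianTilt_uncurry ?_ (measurable_pi_apply t)
  split_ifs
  · exact hum
  · exact measurable_const

/-- Change of variables for an adapted shift: given the noise before t₀, the later noise is
translated by a fixed vector, so the Gaussian shift formula applies in the inner integral. -/
lemma lintegral_shear (hv : ∀ t, 0 < v t) {t₀ : Fin T}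
    {u : (Fin T → EuclideanSpace ℝ (Fin d)) → EuclideanSpace ℝ (Fin d)} (hum : Measurable u)
    (hu : ∀ Y Y', (∀ t < t₀, Y t = Y' t) → u Y = u Y')
    {G : (Fin T → EuclideanSpace ℝ (Fin d)) → ℝ≥0∞} (hG : Measurable G) :
    ∫⁻ Y, G (fun t => Y t + if t₀ ≤ t then u Y else 0) ∂(gaussianNoise d v) =
      ∫⁻ Y, shearDensity v t₀ u Y * G Y ∂(gaussianNoise d v) := by
  have hshift : Measurable fun Y : Fin T → EuclideanSpace ℝ (Fin d) =>
      fun t => Y t + if t₀ ≤ t then u Y else 0 := by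
    refine measurable_pi_lambda _ fun t => ?_
    split_ifs <;> fun_prop
  have hdens : Measurable (shearDensity v t₀ u) := measurable_shearDensity_apply hum
  have hGs : Measurable fun Y : Fin T → EuclideanSpace ℝ (Fin d) =>
      G (fun t => Y t + if t₀ ≤ t then u Y else 0) := hG.comp hshift
  have hdG : Measurable fun Y => shearDensity v t₀ u Y * G Y := hdens.mul hG
  rw [lintegral_gaussianNoise_ite t₀ hGs, lintegral_gaussianNoise_ite t₀ hdG]
  refine lintegral_congr fun Y => ?_
  simp_rw [shearDensity_ite hu]
  have e : ∀ Y' : Fin T → EuclideanSpace ℝ (Fin d),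
      (fun t => (if t < t₀ then Y t else Y' t) + if t₀ ≤ t then
        u (fun i => if i < t₀ then Y i else Y' i) else 0) =
      fun t => if t < t₀ then Y t else (fun t => Y' t + if t₀ ≤ t then u Y else 0) t := by
    intro Y'
    rw [hu (fun t => if t < t₀ then Y t else Y' t) Y (fun t ht => if_pos ht)]
    funext t
    by_cases ht : t₀ ≤ t
    · simp [ht, not_lt.2 ht]
    · simp [ht, not_le.1 ht]
  simp_rw [e]
  let H : (Fin T → EuclideanSpace ℝ (Fin d)) → ℝ≥0∞ :=
    fun Y' => G (fun t => if t < t₀ then Y t else Y' t)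
  have hHm : Measurable H := by
    refine hG.comp (measurable_pi_lambda _ fun t => ?_)
    split_ifs <;> fun_prop
  have h1 := gaussianNoise_map_add hv (fun t => if t₀ ≤ t then u Y else 0)
  have hpm : Measurable fun Y' : Fin T → EuclideanSpace ℝ (Fin d) =>
      ∏ t, gaussianTilt (v t) (if t₀ ≤ t then u Y else 0) (Y' t) :=
    Finset.measurable_prod _ fun t _ =>
      (measurable_gaussianTilt _ _).comp (measurable_pi_apply t)
  have h2 := lintegral_withDensity_mul (gaussianNoise d v) hpm hHm
  rw [← h1, lintegral_map hHm (by fun_prop)] at h2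
  exact h2

lemma prod_gaussianNoise_map_shear (hv : ∀ t, 0 < v t) {B : Type*} [MeasurableSpace B]
    (ν : Measure B) [IsProbabilityMeasure ν] {t₀ : Fin T}
    {u : B → (Fin T → EuclideanSpace ℝ (Fin d)) → EuclideanSpace ℝ (Fin d)}
    (hum : Measurable (Function.uncurry u))
    (hu : ∀ b Y Y', (∀ t < t₀, Y t = Y' t) → u b Y = u b Y') :
    (ν.prod (gaussianNoise d v)).map
        (fun x => (x.1, fun t => x.2 t + if t₀ ≤ t then u x.1 x.2 else 0)) =
      (ν.prod (gaussianNoise d v)).withDensity (fun x => shearDensity v t₀ (u x.1) x.2) := by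
  have hΦ : Measurable fun x : B × (Fin T → EuclideanSpace ℝ (Fin d)) =>
      ((x.1, fun t => x.2 t + if t₀ ≤ t then u x.1 x.2 else 0) :
        B × (Fin T → EuclideanSpace ℝ (Fin d))) := by
    refine measurable_fst.prodMk (measurable_pi_lambda _ fun t => ?_)
    split_ifs
    · exact ((measurable_pi_apply t).comp measurable_snd).add hum
    · fun_prop
  have hd := measurable_shearDensity (v := v) (t₀ := t₀) hum
  refine Measure.ext_of_lintegral _ fun G hG => ?_
  rw [lintegral_map hG hΦ, lintegral_withDensity_mul _ hd hG]
  refine (lintegral_prod _ (hG.comp hΦ).aemeasurable).trans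
    (Eq.trans ?_ (lintegral_prod _ (hd.mul hG).aemeasurable).symm)
  refine lintegral_congr fun b => ?_
  exact lintegral_shear hv (hum.comp measurable_prodMk_left) (hu b)
    (hG.comp measurable_prodMk_left)

/-- Given the past, the moment of a translation is explicit and increases with the squared norm of
the shift. All T rounds are charged with c², including those before t₀ where the shift vanishes, so
the bound does not depend on t₀. -/
lemma lintegral_shearDensity_rpow_le (hv : ∀ t, 0 < v t) {B : Type*} [MeasurableSpace B]
    (ν : Measure B) [IsProbabilityMeasure ν] {t₀ : Fin T}
    {u : B → (Fin T → EuclideanSpace ℝ (Fin d)) → EuclideanSpace ℝ (Fin d)}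
    (hum : Measurable (Function.uncurry u))
    (hu : ∀ b Y Y', (∀ t < t₀, Y t = Y' t) → u b Y = u b Y') {c : ℝ}
    (hc : ∀ b Y, ‖u b Y‖ ≤ c) {a : ℝ} (ha : 1 ≤ a) :
    ∫⁻ x, shearDensity v t₀ (u x.1) x.2 ^ a ∂(ν.prod (gaussianNoise d v)) ≤
      ENNReal.ofReal (Real.exp (∑ t, a * (a - 1) * c ^ 2 / (2 * v t))) := by
  have hd := (measurable_shearDensity (v := v) (t₀ := t₀) hum).pow_const a
  rw [lintegral_prod _ hd.aemeasurable]
  refine (lintegral_mono (g := fun _ => ENNReal.ofReal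
    (Real.exp (∑ t, a * (a - 1) * c ^ 2 / (2 * v t)))) fun b => ?_).trans (by simp)
  have hdb : Measurable fun Y => shearDensity v t₀ (u b) Y ^ a :=
    (measurable_shearDensity_apply (hum.comp measurable_prodMk_left)).pow_const a
  rw [lintegral_gaussianNoise_ite t₀ hdb]
  refine (lintegral_mono (g := fun _ => ENNReal.ofReal
    (Real.exp (∑ t, a * (a - 1) * c ^ 2 / (2 * v t)))) fun Y => ?_).trans (by simp)
  simp_rw [shearDensity_ite (hu b)]
  refine (lintegral_prod_gaussianTilt_rpow hv _ (by linarith)).trans_le ?_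
  refine ENNReal.ofReal_le_ofReal (Real.exp_le_exp.2 (Finset.sum_le_sum fun t _ => ?_))
  have := hv t
  have h2 : ‖if t₀ ≤ t then u b Y else 0‖ ≤ c := by
    split_ifs
    · exact hc b Y
    · simpa using (norm_nonneg _).trans (hc b Y)
  have h3 : 0 ≤ a * (a - 1) := mul_nonneg (by linarith) (by linarith)
  gcongr

end Shear

/-! ### Privacy -/

section Privacy

variable {d M m T : ℕ} {𝒵 : Fin M → Type*} {K : Set (EuclideanSpace ℝ (Fin d))}
  {x₀ : EuclideanSpace ℝ (Fin d)} {α : ℕ → ℝ} {η G L D ρ S : ℝ} {v : Fin T → ℝ}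

theorem isZCDP_trustedLaw_of_bounded (hm : 1 ≤ m) (hT : 1 ≤ T) (hρ : 0 < ρ)
    (hK : IsCompact K) (hc : Convex ℝ K) (hD : ∀ x ∈ K, ∀ y ∈ K, ‖x - y‖ ≤ D) (hx₀ : x₀ ∈ K)
    (hL : 0 ≤ L) {g : ∀ i, 𝒵 i → EuclideanSpace ℝ (Fin d) → EuclideanSpace ℝ (Fin d)}
    (hgG : ∀ i z x, ‖g i z x‖ ≤ G) (hgL : ∀ i z x y, ‖g i z x - g i z y‖ ≤ L * ‖x - y‖)
    (hS : S = G + 2 * L * D) (hS0 : 0 < S) (hα : ∀ t, α t = t)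
    (hv : ∀ t, v t = 4 * S ^ 2 * T / (ρ ^ 2 * m ^ 2))
    (ν : Measure (Fin T → Finset (Fin M))) [IsProbabilityMeasure ν] :
    IsZCDP (fun Dat : FedDataset T 𝒵 => trustedLaw K g α η m v x₀ ν Dat) 0 (ρ ^ 2 / 2) := by
  rintro Dat Dat' ⟨i₀, t₀, hDat⟩ a ha
  have hm0 : (0 : ℝ) < m := by exact_mod_cast hm
  have hT0 : (0 : ℝ) < T := by exact_mod_cast hT
  have hv0 : ∀ t, 0 < v t := fun t => by rw [hv]; positivity
  have hgc : ∀ i z, Measurable (g i z) := fun i z =>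
    (LipschitzWith.of_dist_le_mul (K := L.toNNReal) fun x y => by
      simpa [dist_eq_norm, Real.coe_toNNReal _ hL] using hgL i z x y).continuous.measurable
  have hst := fun (Da : FedDataset T 𝒵) k h => measurable_trustedState (grad := g) (α := α)
    (η := η) (m := m) (Ω := (Fin T → Finset (Fin M)) × (Fin T → EuclideanSpace ℝ (Fin d)))
    (Sω := fun _ => Da) (selω := fun ω => ω.1) (Yω := fun ω => ω.2) hK hc hx₀
    (fun i t X hX => (hgc i _).comp hX) measurable_fst measurable_snd k h
  have hF : ∀ Da : FedDataset T 𝒵, Measurable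
      fun ω : (Fin T → Finset (Fin M)) × (Fin T → EuclideanSpace ℝ (Fin d)) =>
        trustedQueries K g α η m x₀ Da ω.1 ω.2 := fun Da =>
    measurable_pi_lambda _ fun k => (hst Da k.1 _).2.1
  -- The change of the averaged message of round t₀, evaluated at the queries of the run on `Dat`.
  -- It vanishes if machine i₀ does not participate in that round.
  let u : (Fin T → Finset (Fin M)) → (Fin T → EuclideanSpace ℝ (Fin d)) →
      EuclideanSpace ℝ (Fin d) := fun sel Y =>
    (m : ℝ)⁻¹ • if i₀ ∈ sel t₀ then
      roundMessage g α t₀ (trustedState K g α η m x₀ Dat sel Y t₀ t₀.2.le).x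
        (trustedState K g α η m x₀ Dat sel Y t₀ t₀.2.le).xPrev i₀ (Dat i₀ t₀) -
      roundMessage g α t₀ (trustedState K g α η m x₀ Dat sel Y t₀ t₀.2.le).x
        (trustedState K g α η m x₀ Dat sel Y t₀ t₀.2.le).xPrev i₀ (Dat' i₀ t₀) else 0
  have hum : Measurable (Function.uncurry u) := by
    obtain ⟨-, h2, h3, -⟩ := hst Dat t₀ t₀.2.le
    have hmsg := fun z : 𝒵 i₀ => (((hgc i₀ z).comp h2).const_smul (α (t₀ + 1))).sub
      (((hgc i₀ z).comp h3).const_smul (α t₀))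
    have hsel : Measurable
        fun ω : (Fin T → Finset (Fin M)) × (Fin T → EuclideanSpace ℝ (Fin d)) => ω.1 t₀ :=
      (measurable_pi_apply t₀).comp measurable_fst
    have hset := hsel (measurableSet_mem_finset i₀)
    exact (Measurable.ite hset ((hmsg (Dat i₀ t₀)).sub (hmsg (Dat' i₀ t₀)))
      measurable_const).const_smul (m : ℝ)⁻¹
  have hu : ∀ sel Y Y', (∀ t < t₀, Y t = Y' t) → u sel Y = u sel Y' := by
    intro sel Y Y' h
    have := trustedState_congr (K := K) (grad := g) (α := α) (η := η) (m := m) (x₀ := x₀)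
      (S := Dat) (S' := Dat) (sel := sel) (sel' := sel) t₀ t₀.2.le (fun _ _ _ => rfl)
      (fun _ _ => rfl) (fun t ht => h t ht)
    simp only [u, this]
  have huc : ∀ sel Y, ‖u sel Y‖ ≤ 2 * S / m := by
    intro sel Y
    have hb := fun z => norm_roundMessage_le (α := α) hα hL hgG hgL
      (mul_norm_trustedState_sub_le (grad := g) (η := η) (m := m) (S := Dat) (sel := sel)
        (Y := Y) hK hc hx₀ hα hD t₀ t₀.2.le) i₀ z
    simp only [u]
    rw [norm_smul, norm_inv, Real.norm_natCast, ← div_eq_inv_mul]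
    gcongr
    split_ifs
    · refine (norm_sub_le _ _).trans ?_
      linarith [hb (Dat i₀ t₀), hb (Dat' i₀ t₀)]
    · simpa using hS0.le
  -- Coupling: the queries on `Dat` are those on `Dat'` with sheared noise. Both laws thus become
  -- images of comparable measures under one and the same map.
  have hlaw : trustedLaw K g α η m v x₀ ν Dat =
      ((ν.prod (gaussianNoise d v)).withDensity (fun x => shearDensity v t₀ (u x.1) x.2)).map
        fun ω => trustedQueries K g α η m x₀ Dat' ω.1 ω.2 := by
    rw [← prod_gaussianNoise_map_shear hv0 ν hum hu, Measure.map_map (hF Dat')]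
    · unfold trustedLaw
      congr 1
      funext ω k
      exact (trustedState_shift (grad := g) (α := α) (η := η) (x₀ := x₀) (K := K) (m := m)
        (Y := ω.2) hDat rfl k.1 _).2.1.symm
    · refine measurable_fst.prodMk (measurable_pi_lambda _ fun t => ?_)
      split_ifs
      · exact ((measurable_pi_apply t).comp measurable_snd).add hum
      · fun_prop
  have hfin : IsFiniteMeasure
      ((ν.prod (gaussianNoise d v)).withDensity (fun x => shearDensity v t₀ (u x.1) x.2)) := by
    rw [← prod_gaussianNoise_map_shear hv0 ν hum hu]
    infer_instance
  simp only
  rw [hlaw]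
  refine renyiDivergence_map_le (measurable_shearDensity hum) (hF Dat') ha ?_
  refine (lintegral_shearDensity_rpow_le hv0 ν hum hu huc ha.le).trans (le_of_eq ?_)
  congr 2
  -- The variance is calibrated so that T (2S/m)²/(2v) = ρ²/2.
  simp_rw [hv]
  rw [Finset.sum_const, Finset.card_univ, Fintype.card_fin, nsmul_eq_mul]
  field_simp
  ring

theorem isZCDP_trustedLaw (hm : 1 ≤ m) (hT : 1 ≤ T) (hρ : 0 < ρ)
    (hK : IsCompact K) (hc : Convex ℝ K) (hD : ∀ x ∈ K, ∀ y ∈ K, ‖x - y‖ ≤ D) (hx₀ : x₀ ∈ K)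
    (hG : 0 ≤ G) (hL : 0 ≤ L) (f : ∀ i, 𝒵 i → EuclideanSpace ℝ (Fin d) → ℝ)
    {grad : ∀ i, 𝒵 i → EuclideanSpace ℝ (Fin d) → EuclideanSpace ℝ (Fin d)}
    (hgrad : ∀ i z, ∀ x ∈ K, HasGradientWithinAt (f i z) (grad i z x) K x)
    (hLip : ∀ i z, ∀ x ∈ K, ∀ y ∈ K, |f i z x - f i z y| ≤ G * ‖x - y‖)
    (hSmooth : ∀ i z, ∀ x ∈ K, ∀ y ∈ K, ‖grad i z x - grad i z y‖ ≤ L * ‖x - y‖)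
    (hS : S = G + 2 * L * D) (hS0 : 0 < S) (hα : ∀ t, α t = t)
    (hv : ∀ t, v t = 4 * S ^ 2 * T / (ρ ^ 2 * m ^ 2))
    (ν : Measure (Fin T → Finset (Fin M))) [IsProbabilityMeasure ν] :
    IsZCDP (fun Dat : FedDataset T 𝒵 => trustedLaw K grad α η m v x₀ ν Dat) 0 (ρ ^ 2 / 2) := by
  have h := isZCDP_trustedLaw_of_bounded (η := η) hm hT hρ hK hc hD hx₀ hL
    (g := tangentGrad K grad)
    (fun i z x => norm_tangentProj_gradient_le hG hc (hgrad i z) (hLip i z) (hSmooth i z)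
      (projOn_mem hK ⟨x₀, hx₀⟩ x))
    (norm_tangentGrad_sub_le hK hc ⟨x₀, hx₀⟩ hL hSmooth) hS hS0 hα hv ν
  unfold trustedLaw at h ⊢
  simp_rw [trustedQueries_tangentGrad (grad := grad) hK hc hx₀ hα]
  exact h

end Privacy

/-! ### Resampling coordinates of product measures -/

section Resampling

/-- Combines resampling maps for independent sources (samples, subsets, noise) into one for their
product. -/
lemma MeasureTheory.MeasurePreserving.prod_interchange {A B C D A' B' : Type*}
    [MeasurableSpace A] [MeasurableSpace B]
    [MeasurableSpace C] [MeasurableSpace D] [MeasurableSpace A'] [MeasurableSpace B']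
    {μa : Measure A} {μb : Measure B}
    {μc : Measure C} {μd : Measure D} [SFinite μa] [SFinite μb] [SFinite μc] [SFinite μd]
    {μa' : Measure A'} {μb' : Measure B'} [SFinite μa'] [SFinite μb']
    {f : A × C → A'} {g : B × D → B'}
    (hf : MeasurePreserving f (μa.prod μc) μa') (hg : MeasurePreserving g (μb.prod μd) μb') :
    MeasurePreserving (fun x : (A × B) × (C × D) => (f (x.1.1, x.2.1), g (x.1.2, x.2.2)))
      ((μa.prod μb).prod (μc.prod μd)) (μa'.prod μb') := by
  have h1 : MeasurePreserving (fun x : B × (C × D) => (x.2.1, (x.1, x.2.2)))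
      (μb.prod (μc.prod μd)) (μc.prod (μb.prod μd)) := by
    have e1 := (measurePreserving_prodAssoc μb μc μd).symm
    have e2 : MeasurePreserving (Prod.map Prod.swap id : (B × C) × D → (C × B) × D)
      ((μb.prod μc).prod μd) ((μc.prod μb).prod μd) :=
      Measure.measurePreserving_swap.prod (MeasurePreserving.id μd)
    exact (measurePreserving_prodAssoc μc μb μd).comp (e2.comp e1)
  have h2 : MeasurePreserving (fun x : (A × B) × (C × D) => ((x.1.1, x.2.1), (x.1.2, x.2.2)))
      ((μa.prod μb).prod (μc.prod μd)) ((μa.prod μc).prod (μb.prod μd)) :=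
    ((measurePreserving_prodAssoc μa μc (μb.prod μd)).symm.comp
      ((MeasurePreserving.id μa).prod h1)).comp
      (measurePreserving_prodAssoc μa μb (μc.prod μd))
  exact (hf.prod hg).comp h2

variable {ι : Type*} [Fintype ι]

lemma measurePreserving_pi_zip {X Y : ι → Type*} [∀ i, MeasurableSpace (X i)]
    [∀ i, MeasurableSpace (Y i)] (μ : ∀ i, Measure (X i)) (ν : ∀ i, Measure (Y i))
    [∀ i, SigmaFinite (μ i)] [∀ i, SigmaFinite (ν i)] :
    MeasurePreserving (fun (x : (∀ i, X i) × (∀ i, Y i)) i => (x.1 i, x.2 i))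
      ((Measure.pi μ).prod (Measure.pi ν)) (Measure.pi fun i => (μ i).prod (ν i)) := by
  have hm : Measurable (fun (x : (∀ i, X i) × (∀ i, Y i)) i => (x.1 i, x.2 i)) := by fun_prop
  refine ⟨hm, (Measure.pi_eq_generateFrom (fun i => generateFrom_prod) (fun i => isPiSystem_prod)
    (fun i => (μ i).toFiniteSpanningSetsIn.prod (ν i).toFiniteSpanningSetsIn) ?_).symm⟩
  intro s hs
  choose a ha b hb hab using hs
  have e : (fun (x : (∀ i, X i) × (∀ i, Y i)) i => (x.1 i, x.2 i)) ⁻¹' Set.univ.pi s =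
      (Set.univ.pi a) ×ˢ (Set.univ.pi b) := by
    ext x
    simp only [Set.mem_preimage, Set.mem_pi, Set.mem_univ, true_implies, Set.mem_prod,
      ← forall_and, ← hab]
  have hsm : MeasurableSet (Set.univ.pi s) :=
    MeasurableSet.univ_pi fun i => hab i ▸ (ha i).prod (hb i)
  rw [Measure.map_apply hm hsm, e, Measure.prod_prod, Measure.pi_pi, Measure.pi_pi,
    ← Finset.prod_mul_distrib]
  refine Finset.prod_congr rfl fun i _ => ?_
  rw [← hab, Measure.prod_prod]

/-- The basic form of independence in the excess-loss argument: integrating over a fresh copy of one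
coordinate replaces conditioning on all the others. -/
lemma measurePreserving_pi_update [DecidableEq ι] {X : ι → Type*} [∀ i, MeasurableSpace (X i)]
    (μ : ∀ i, Measure (X i)) [∀ i, IsProbabilityMeasure (μ i)] (k : ι) :
    MeasurePreserving (fun (x : (∀ i, X i) × X k) => Function.update x.1 k x.2)
      ((Measure.pi μ).prod (μ k)) (Measure.pi μ) := by
  have hm : Measurable (fun (x : (∀ i, X i) × X k) => Function.update x.1 k x.2) := by
    refine measurable_pi_lambda _ fun i => ?_
    by_cases hi : i = k
    · subst hi; simpa using measurable_snd
    · simp only [Function.update_of_ne hi]; fun_prop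
  refine ⟨hm, (Measure.pi_eq fun s hs => ?_).symm⟩
  rw [Measure.map_apply hm (.univ_pi hs)]
  have e : (fun (x : (∀ i, X i) × X k) => Function.update x.1 k x.2) ⁻¹' Set.univ.pi s =
      (Set.univ.pi (Function.update s k Set.univ)) ×ˢ s k := by
    ext x
    simp only [Set.mem_preimage, Set.mem_pi, Set.mem_univ, true_implies, Set.mem_prod]
    constructor
    · intro h
      refine ⟨fun i => ?_, by simpa using h k⟩
      by_cases hi : i = k
      · subst hi; simp
      · simpa [Function.update_of_ne hi] using h i
    · rintro ⟨h1, h2⟩ i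
      by_cases hi : i = k
      · subst hi; simpa using h2
      · simpa [Function.update_of_ne hi] using h1 i
  rw [e, Measure.prod_prod, Measure.pi_pi, ← Finset.prod_erase_mul _ _ (Finset.mem_univ k),
    ← Finset.prod_erase_mul Finset.univ (fun i => μ i (s i)) (Finset.mem_univ k),
    Function.update_self, measure_univ, mul_one]
  congr 1
  refine Finset.prod_congr rfl fun i hi => ?_
  rw [Function.update_of_ne (Finset.ne_of_mem_erase hi)]

/-- A conditional bound after resampling gives a bound of expectations. -/
lemma MeasureTheory.MeasurePreserving.integral_le_of_resample {Ω R : Type*} [MeasurableSpace Ω]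
    [MeasurableSpace R] {P : Measure Ω} {ρ : Measure R} [SFinite P] [SFinite ρ] {U : Ω × R → Ω}
    (hU : MeasurePreserving U (P.prod ρ) P) {G H : Ω → ℝ} (hG : Integrable G P)
    (hH : Integrable H P) (h : ∀ ω, ∫ r, G (U (ω, r)) ∂ρ ≤ H ω) :
    ∫ ω, G ω ∂P ≤ ∫ ω, H ω ∂P := by
  have h1 : Integrable (fun x => G (U x)) (P.prod ρ) := hU.integrable_comp_of_integrable hG
  have h2 := integral_map (f := G) hU.measurable.aemeasurable (by rw [hU.map_eq]; exact hG.1)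
  rw [hU.map_eq] at h2
  rw [h2, integral_prod _ h1]
  exact integral_mono h1.integral_prod_left hH h

end Resampling

/-! ### Second moments -/

section Moments

lemma integrable_of_norm_le {X E : Type*} [MeasurableSpace X] {μ : Measure X} [IsFiniteMeasure μ]
    [NormedAddCommGroup E] {f : X → E} (hf : AEStronglyMeasurable f μ) {C : ℝ}
    (h : ∀ x, ‖f x‖ ≤ C) : Integrable f μ :=
  Integrable.of_bound hf C (.of_forall h)

lemma integral_norm_add_sq {E : Type*} [NormedAddCommGroup E] [InnerProductSpace ℝ E]
    [CompleteSpace E] {X : Type*} [MeasurableSpace X] {μ : Measure X}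
    [IsProbabilityMeasure μ] {f : X → E} (hf : MemLp f 2 μ) (h0 : ∫ x, f x ∂μ = 0) (a : E) :
    ∫ x, ‖a + f x‖ ^ 2 ∂μ = ‖a‖ ^ 2 + ∫ x, ‖f x‖ ^ 2 ∂μ := by
  have hi : Integrable f μ := hf.integrable one_le_two
  have h2 : Integrable (fun x => ‖f x‖ ^ 2) μ := hf.integrable_norm_pow two_ne_zero
  have e : ∀ x, ‖a + f x‖ ^ 2 = ‖a‖ ^ 2 + 2 * ⟪a, f x⟫ + ‖f x‖ ^ 2 := fun x =>
    norm_add_sq_real a (f x)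
  have h3 : Integrable (fun x => ‖a‖ ^ 2 + 2 * ⟪a, f x⟫) μ :=
    (integrable_const _).add ((hi.const_inner a).const_mul 2)
  simp_rw [e]
  rw [integral_add h3 h2, integral_add (integrable_const _) ((hi.const_inner a).const_mul 2),
    integral_const,
    integral_const_mul, integral_inner hi, h0]
  simp

/-- Second moment of a sum of independent centered vectors. -/
lemma integral_norm_add_sum_sq_le {E : Type*} [NormedAddCommGroup E] [InnerProductSpace ℝ E]
    [FiniteDimensional ℝ E] [MeasurableSpace E] [BorelSpace E] {ι : Type*} [Fintype ι]
    [DecidableEq ι] {X : ι → Type*} [∀ i, MeasurableSpace (X i)] (μ : ∀ i, Measure (X i)) [∀ i, IsProbabilityMeasure (μ i)]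
    {f : ∀ i, X i → E} (hf : ∀ i, Measurable (f i)) {C : ℝ} (hC : ∀ i x, ‖f i x‖ ≤ C)
    (h0 : ∀ i, ∫ x, f i x ∂(μ i) = 0) (a : E) (A : Finset ι) :
    ∫ z, ‖a + ∑ i ∈ A, f i (z i)‖ ^ 2 ∂(Measure.pi μ) ≤
      ‖a‖ ^ 2 + ∑ i ∈ A, ∫ x, ‖f i x‖ ^ 2 ∂(μ i) := by
  have hint : ∀ A : Finset ι, Integrable (fun z : ∀ i, X i => ‖a + ∑ i ∈ A, f i (z i)‖ ^ 2)
      (Measure.pi μ) := by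
    intro A
    have hm : Measurable fun z : ∀ i, X i => a + ∑ i ∈ A, f i (z i) :=
      (Finset.measurable_sum _ fun i _ => (hf i).comp (measurable_pi_apply i)).const_add a
    refine integrable_of_norm_le (hm.norm.pow_const 2).aestronglyMeasurable
      (C := (‖a‖ + ∑ i ∈ A, C) ^ 2) fun z => ?_
    rw [norm_pow, norm_norm]
    gcongr
    refine (norm_add_le _ _).trans ?_
    gcongr
    exact norm_sum_le_of_le _ fun i _ => hC i _
  induction A using Finset.induction_on with
  | empty => simp
  | insert j A hj ih =>
    have hmem : MemLp (f j) 2 (μ j) :=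
      MemLp.of_bound (hf j).aestronglyMeasurable C (.of_forall (hC j))
    -- Redrawing coordinate j leaves the rest of the sum fixed; the new term is centered, so its
    -- cross term vanishes and only its own second moment is added.
    have h1 := (measurePreserving_pi_update μ j).integral_le_of_resample
      (hint (insert j A)) ((hint A).add (integrable_const (∫ x, ‖f j x‖ ^ 2 ∂(μ j)))) (by
        intro z
        have e : ∀ r, a + ∑ i ∈ insert j A, f i (Function.update z j r i) =
            (a + ∑ i ∈ A, f i (z i)) + f j r := by
          intro r
          rw [Finset.sum_insert hj, Function.update_self, add_comm (f j r), add_assoc]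
          congr 2
          refine Finset.sum_congr rfl fun i hi => ?_
          rw [Function.update_of_ne (ne_of_mem_of_not_mem hi hj)]
        simp only [e]
        rw [integral_norm_add_sq hmem (h0 j)]
        exact le_rfl)
    refine h1.trans ?_
    rw [integral_add' (hint A) (integrable_const _), integral_const, Finset.sum_insert hj]
    simp only [probReal_univ, one_smul]
    linarith

lemma le_add_sq_of_forall_young {X A B : ℝ} (hA : 0 ≤ A) (hB : 0 ≤ B)
    (h : ∀ t > 0, X ≤ (1 + t) * A ^ 2 + (1 + t⁻¹) * B ^ 2) : X ≤ (A + B) ^ 2 := by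
  refine le_of_forall_pos_le_add fun e he => ?_
  set δ := e / (A + B + 1) with hδ
  have hδ0 : 0 < δ := by positivity
  -- The optimal parameter is B/A; the perturbation by δ keeps it positive and finite when A or B
  -- vanishes.
  have h1 := h ((B + δ) / (A + δ)) (by positivity)
  have hA' : A ^ 2 / (A + δ) ≤ A := by
    rw [div_le_iff₀ (by positivity)]; nlinarith
  have hB' : B ^ 2 / (B + δ) ≤ B := by
    rw [div_le_iff₀ (by positivity)]; nlinarith
  have h2 : (1 + (B + δ) / (A + δ)) * A ^ 2 + (1 + ((B + δ) / (A + δ))⁻¹) * B ^ 2 =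
      A ^ 2 + B ^ 2 + (B + δ) * (A ^ 2 / (A + δ)) + (A + δ) * (B ^ 2 / (B + δ)) := by
    field_simp
    ring
  have h3 : (B + δ) * (A ^ 2 / (A + δ)) ≤ (B + δ) * A := by gcongr
  have h4 : (A + δ) * (B ^ 2 / (B + δ)) ≤ (A + δ) * B := by gcongr
  have h5 : δ * (A + B) ≤ e := by
    rw [hδ, div_mul_eq_mul_div, div_le_iff₀ (by positivity)]
    nlinarith
  nlinarith

lemma norm_add_sq_le_young {E : Type*} [NormedAddCommGroup E] (a b : E) {t : ℝ} (ht : 0 < t) :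
    ‖a + b‖ ^ 2 ≤ (1 + t) * ‖a‖ ^ 2 + (1 + t⁻¹) * ‖b‖ ^ 2 := by
  have h1 : ‖a + b‖ ^ 2 ≤ (‖a‖ + ‖b‖) ^ 2 := by gcongr; exact norm_add_le _ _
  have h2 : 2 * ‖a‖ * ‖b‖ ≤ t * ‖a‖ ^ 2 + t⁻¹ * ‖b‖ ^ 2 := by
    have : t * ‖a‖ ^ 2 + t⁻¹ * ‖b‖ ^ 2 - 2 * ‖a‖ * ‖b‖ = t⁻¹ * (t * ‖a‖ - ‖b‖) ^ 2 := by
      field_simp; ring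
    have : 0 ≤ t⁻¹ * (t * ‖a‖ - ‖b‖) ^ 2 := by positivity
    linarith
  nlinarith

/-- Minkowski's inequality for second moments. -/
lemma integral_norm_add_sq_le {E : Type*} [NormedAddCommGroup E] {X : Type*}
    [MeasurableSpace X] {μ : Measure X} {f g : X → E}
    (hf : MemLp f 2 μ) (hg : MemLp g 2 μ) {A B : ℝ} (hA : 0 ≤ A) (hB : 0 ≤ B)
    (hfA : ∫ x, ‖f x‖ ^ 2 ∂μ ≤ A ^ 2) (hgB : ∫ x, ‖g x‖ ^ 2 ∂μ ≤ B ^ 2) :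
    ∫ x, ‖f x + g x‖ ^ 2 ∂μ ≤ (A + B) ^ 2 := by
  have h1 : Integrable (fun x => ‖f x‖ ^ 2) μ := hf.integrable_norm_pow two_ne_zero
  have h2 : Integrable (fun x => ‖g x‖ ^ 2) μ := hg.integrable_norm_pow two_ne_zero
  refine le_add_sq_of_forall_young hA hB fun t ht => ?_
  have h3 := integral_mono (μ := μ) ((hf.add hg).integrable_norm_pow two_ne_zero)
    ((h1.const_mul (1 + t)).add (h2.const_mul (1 + t⁻¹)))
    (fun x => norm_add_sq_le_young (f x) (g x) ht)
  refine h3.trans ?_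
  rw [integral_add' (h1.const_mul (1 + t)) (h2.const_mul (1 + t⁻¹)), integral_const_mul,
    integral_const_mul]
  gcongr

lemma sum_norm_add_sq_le {E : Type*} [NormedAddCommGroup E] {ι : Type*} [Fintype ι] {c : ℝ}
    (hc : 0 ≤ c) {f g : ι → E} {A B : ℝ}
    (hA : 0 ≤ A) (hB : 0 ≤ B) (hfA : c * ∑ i, ‖f i‖ ^ 2 ≤ A ^ 2)
    (hgB : c * ∑ i, ‖g i‖ ^ 2 ≤ B ^ 2) : c * ∑ i, ‖f i + g i‖ ^ 2 ≤ (A + B) ^ 2 := by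
  refine le_add_sq_of_forall_young hA hB fun t ht => ?_
  calc c * ∑ i, ‖f i + g i‖ ^ 2
      ≤ c * ∑ i, ((1 + t) * ‖f i‖ ^ 2 + (1 + t⁻¹) * ‖g i‖ ^ 2) := by
        gcongr with i
        exact norm_add_sq_le_young (f i) (g i) ht
    _ = (1 + t) * (c * ∑ i, ‖f i‖ ^ 2) + (1 + t⁻¹) * (c * ∑ i, ‖g i‖ ^ 2) := by
        rw [Finset.sum_add_distrib, ← Finset.mul_sum, ← Finset.mul_sum]; ring
    _ ≤ _ := by gcongr

end Moments

/-! ### Uniform subsets -/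

section Subsets

variable {E : Type*} [NormedAddCommGroup E] [InnerProductSpace ℝ E] {M m : ℕ}

lemma integral_uniformOn_card (hmM : m ≤ M) {F : Type*} [NormedAddCommGroup F] [NormedSpace ℝ F]
    [CompleteSpace F] (φ : Finset (Fin M) → F) :
    ∫ A, φ A ∂(uniformOn {A : Finset (Fin M) | A.card = m}) =
      (M.choose m : ℝ)⁻¹ • ∑ A ∈ Finset.powersetCard m Finset.univ, φ A := by
  set s : Set (Finset (Fin M)) := {A : Finset (Fin M) | A.card = m} with hs
  have hsm : s = (Finset.powersetCard m (Finset.univ : Finset (Fin M)) : Set (Finset (Fin M))) := by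
    ext A; simp [hs]
  have hne : s.Nonempty := by
    rw [hsm, Finset.coe_nonempty, Finset.powersetCard_nonempty]; simpa using hmM
  have := isProbabilityMeasure_uniformOn s.toFinite hne
  rw [integral_fintype (.of_finite), Finset.smul_sum]
  rw [← Finset.sum_subset (Finset.subset_univ (Finset.powersetCard m Finset.univ))]
  · refine Finset.sum_congr rfl fun A hA => ?_
    congr 1
    have hA' : A ∈ s := by rw [hsm]; exact hA
    rw [uniformOn, Measure.real, cond_apply s.toFinite.measurableSet,
      Set.inter_eq_right.2 (Set.singleton_subset_iff.2 hA'), hsm, Measure.count_apply_finset,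
      Measure.count_singleton]
    simp
  · intro A _ hA
    have hA' : A ∉ s := by rw [hsm]; exact hA
    have : uniformOn s {A} = 0 := by
      rw [uniformOn_eq_zero_iff s.toFinite]
      exact Set.inter_singleton_eq_empty.2 hA'
    rw [Measure.real, this]
    simp

lemma sum_powersetCard_sum (φ : Fin M → E) :
    ∑ A ∈ Finset.powersetCard m Finset.univ, ∑ i ∈ A, φ i =
      ∑ i, (((Finset.powersetCard m (Finset.univ : Finset (Fin M))).filter (i ∈ ·)).card : ℝ) •
        φ i := by
  have : ∀ A : Finset (Fin M), ∑ i ∈ A, φ i = ∑ i, if i ∈ A then φ i else 0 := fun A => by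
    rw [← Finset.sum_filter]; simp
  simp_rw [this]
  rw [Finset.sum_comm]
  refine Finset.sum_congr rfl fun i _ => ?_
  rw [← Finset.sum_filter, Finset.sum_const, Nat.cast_smul_eq_nsmul]

lemma card_filter_mem_powersetCard (hm : 1 ≤ m) (i : Fin M) :
    ((Finset.powersetCard m (Finset.univ : Finset (Fin M))).filter (i ∈ ·)).card =
      (M - 1).choose (m - 1) := by
  have := Finset.card_filter_powersetCard_subset {i} (Finset.univ : Finset (Fin M)) m
    (Finset.subset_univ _) (by simpa using hm)
  simpa using this

/-- Only the symmetry matters: the number of m-subsets containing a given pair does not depend on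
the pair. Its value is never used. -/
lemma exists_card_filter_mem_mem_powersetCard :
    ∃ c : ℕ, ∀ i j : Fin M, i ≠ j →
      ((Finset.powersetCard m (Finset.univ : Finset (Fin M))).filter
        (fun A => i ∈ A ∧ j ∈ A)).card = c := by
  by_cases hm : 2 ≤ m
  · refine ⟨(M - 2).choose (m - 2), fun i j hij => ?_⟩
    have hc : ({i, j} : Finset (Fin M)).card = 2 := Finset.card_pair hij
    have := Finset.card_filter_powersetCard_subset {i, j} (Finset.univ : Finset (Fin M)) m
      (Finset.subset_univ _) (by rw [hc]; exact hm)
    rw [hc] at this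
    simpa [Finset.insert_subset_iff] using this
  · refine ⟨0, fun i j hij => ?_⟩
    rw [Finset.card_eq_zero, Finset.filter_eq_empty_iff]
    rintro A hA ⟨hi, hj⟩
    have h1 : ({i, j} : Finset (Fin M)) ⊆ A := by
      simp [Finset.insert_subset_iff, hi, hj]
    have h2 := Finset.card_le_card h1
    rw [Finset.card_pair hij, (Finset.mem_powersetCard.1 hA).2] at h2
    exact hm h2

lemma card_mul_choose_eq (hm : 1 ≤ m) (hmM : m ≤ M) :
    M * (M - 1).choose (m - 1) = m * M.choose m := by
  obtain ⟨m, rfl⟩ := Nat.exists_eq_add_of_le' hm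
  obtain ⟨M, rfl⟩ := Nat.exists_eq_add_of_le' (hm.trans hmM)
  simpa [mul_comm] using Nat.add_one_mul_choose_eq M m

/-- Sampling without replacement reduces the variance at least as much as sampling with
replacement. -/
lemma integral_uniformOn_norm_add_sum_sq_le (hm : 1 ≤ m) (hmM : m ≤ M) {φ : Fin M → E}
    (hφ : ∑ i, φ i = 0) (a : E) :
    ∫ A, ‖a + (m : ℝ)⁻¹ • ∑ i ∈ A, φ i‖ ^ 2 ∂(uniformOn {A : Finset (Fin M) | A.card = m}) ≤
      ‖a‖ ^ 2 + ((M : ℝ)⁻¹ * ∑ i, ‖φ i‖ ^ 2) / m := by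
  obtain ⟨c₂, hc₂⟩ := exists_card_filter_mem_mem_powersetCard (M := M) (m := m)
  set c₁ := (M - 1).choose (m - 1) with hc₁
  set Q := Finset.powersetCard m (Finset.univ : Finset (Fin M)) with hQ
  have hN : (0 : ℝ) < M.choose m := by exact_mod_cast Nat.choose_pos hmM
  have hm0 : (0 : ℝ) < m := by exact_mod_cast hm
  have hM0 : (0 : ℝ) < M := by exact_mod_cast hm.trans hmM
  have hlin : ∑ A ∈ Q, ∑ i ∈ A, φ i = 0 := by
    rw [sum_powersetCard_sum]
    simp_rw [card_filter_mem_powersetCard hm]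
    rw [← Finset.smul_sum, hφ, smul_zero]
  have hsq : ∑ A ∈ Q, ‖∑ i ∈ A, φ i‖ ^ 2 ≤ c₁ * ∑ i, ‖φ i‖ ^ 2 := by
    have e1 : ∀ A : Finset (Fin M), ‖∑ i ∈ A, φ i‖ ^ 2 =
        ∑ i, ∑ j, if i ∈ A ∧ j ∈ A then ⟪φ i, φ j⟫ else 0 := by
      intro A
      have : ∑ i ∈ A, φ i = ∑ i, if i ∈ A then φ i else 0 := by
        rw [← Finset.sum_filter]; simp
      rw [← real_inner_self_eq_norm_sq, this, sum_inner]
      refine Finset.sum_congr rfl fun i _ => ?_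
      rw [inner_sum]
      refine Finset.sum_congr rfl fun j _ => ?_
      by_cases hi : i ∈ A <;> by_cases hj : j ∈ A <;> simp [hi, hj]
    -- Every off-diagonal pair has the same weight c₂. As ∑ φ i = 0, the off-diagonal part sums to
    -- -c₂ ∑ ‖φ i‖² ≤ 0: draws without replacement are negatively correlated and the diagonal bound
    -- suffices.
    have e2 : ∀ i j : Fin M, (∑ A ∈ Q, if i ∈ A ∧ j ∈ A then ⟪φ i, φ j⟫ else 0) =
        (if i = j then ((c₁ : ℝ) - c₂) * ‖φ i‖ ^ 2 else 0) + c₂ * ⟪φ i, φ j⟫ := by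
      intro i j
      rw [← Finset.sum_filter, Finset.sum_const, nsmul_eq_mul]
      by_cases hij : i = j
      · subst hij
        simp only [and_self, if_true]
        rw [card_filter_mem_powersetCard hm, real_inner_self_eq_norm_sq]
        ring
      · rw [hc₂ i j hij, if_neg hij, zero_add]
    simp_rw [e1]
    rw [Finset.sum_comm]
    simp_rw [Finset.sum_comm (s := Q), e2, Finset.sum_add_distrib, Finset.sum_ite_eq,
      Finset.mem_univ, if_true, ← Finset.mul_sum, ← inner_sum]
    rw [hφ]
    simp only [inner_zero_right, Finset.sum_const_zero, mul_zero, add_zero]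
    have : 0 ≤ ∑ i, ‖φ i‖ ^ 2 := Finset.sum_nonneg fun i _ => by positivity
    have : (0 : ℝ) ≤ c₂ := by positivity
    nlinarith
  rw [integral_uniformOn_card hmM]
  have e3 : ∀ A : Finset (Fin M), ‖a + (m : ℝ)⁻¹ • ∑ i ∈ A, φ i‖ ^ 2 =
      ‖a‖ ^ 2 + 2 * (m : ℝ)⁻¹ * ⟪a, ∑ i ∈ A, φ i⟫ + (m : ℝ)⁻¹ ^ 2 * ‖∑ i ∈ A, φ i‖ ^ 2 := by
    intro A
    rw [norm_add_sq_real, inner_smul_right, norm_smul, norm_inv, Real.norm_natCast, mul_pow]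
    ring
  simp_rw [e3, Finset.sum_add_distrib, ← Finset.mul_sum, ← inner_sum]
  rw [hlin, inner_zero_right, mul_zero, add_zero, Finset.sum_const, Finset.card_powersetCard,
    Finset.card_univ, Fintype.card_fin, nsmul_eq_mul, smul_eq_mul, mul_add,
    inv_mul_cancel_left₀ hN.ne']
  gcongr
  have hk : (M : ℝ) * c₁ = m * M.choose m := by exact_mod_cast card_mul_choose_eq hm hmM
  have hk' : (c₁ : ℝ) = m * M.choose m / M := by rw [← hk]; field_simp
  calc (M.choose m : ℝ)⁻¹ * ((m : ℝ)⁻¹ ^ 2 * ∑ A ∈ Q, ‖∑ i ∈ A, φ i‖ ^ 2)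
      ≤ (M.choose m : ℝ)⁻¹ * ((m : ℝ)⁻¹ ^ 2 * (c₁ * ∑ i, ‖φ i‖ ^ 2)) := by gcongr
    _ = ((M : ℝ)⁻¹ * ∑ i, ‖φ i‖ ^ 2) / m := by rw [hk']; field_simp

end Subsets

/-! ### The gradient estimation error -/

section Oracle

variable {E : Type*} [NormedAddCommGroup E] [InnerProductSpace ℝ E]
  [MeasurableSpace E] {M : ℕ} {𝒵 : Fin M → Type*} [∀ i, MeasurableSpace (𝒵 i)]

/-- The mean gradient of machine `i`. -/
def meanGrad (g : ∀ i, 𝒵 i → E → E) (𝒟 : ∀ i, Measure (𝒵 i)) (i : Fin M) (x : E) : E :=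
  ∫ z, g i z x ∂(𝒟 i)

/-- A bounded Lipschitz stochastic first-order oracle with bounded variance, variance of the
increments, heterogeneity, and heterogeneity of the increments. -/
structure StochasticOracle (K : Set E) (g : ∀ i, 𝒵 i → E → E) (𝒟 : ∀ i, Measure (𝒵 i))
    (G L σ σL ξ ξL : ℝ) : Prop where
  measurable : ∀ i, Measurable fun p : 𝒵 i × E => g i p.1 p.2
  bound : ∀ i z x, ‖g i z x‖ ≤ G
  lipschitz : ∀ i z x y, ‖g i z x - g i z y‖ ≤ L * ‖x - y‖
  variance : ∀ i, ∀ x ∈ K, ∫ z, ‖g i z x - meanGrad g 𝒟 i x‖ ^ 2 ∂(𝒟 i) ≤ σ ^ 2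
  variance_increment : ∀ i, ∀ x ∈ K, ∀ y ∈ K,
    ∫ z, ‖(g i z x - meanGrad g 𝒟 i x) - (g i z y - meanGrad g 𝒟 i y)‖ ^ 2 ∂(𝒟 i) ≤
      (σL * ‖x - y‖) ^ 2
  heterogeneity : ∀ x ∈ K,
    (M : ℝ)⁻¹ * ∑ i, ‖meanGrad g 𝒟 i x - globalGrad (meanGrad g 𝒟) x‖ ^ 2 ≤ ξ ^ 2
  heterogeneity_increment : ∀ x ∈ K, ∀ y ∈ K,
    (M : ℝ)⁻¹ * ∑ i, ‖(meanGrad g 𝒟 i x - globalGrad (meanGrad g 𝒟) x) -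
      (meanGrad g 𝒟 i y - globalGrad (meanGrad g 𝒟) y)‖ ^ 2 ≤ (ξL * ‖x - y‖) ^ 2

variable {K : Set E} {g : ∀ i, 𝒵 i → E → E} {𝒟 : ∀ i, Measure (𝒵 i)}
  {G L σ σL ξ ξL D : ℝ} {α : ℕ → ℝ} {m : ℕ}

namespace StochasticOracle

lemma measurable_apply (h : StochasticOracle K g 𝒟 G L σ σL ξ ξL) (i : Fin M) (x : E) :
    Measurable fun z => g i z x :=
  (h.measurable i).comp (measurable_id.prodMk measurable_const)

/-- The decomposition behind σ + 2σL D and ξ + 2ξL D: the deviation of a message is a deviation of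
gradients plus k times the increment of that deviation, and k‖x - p‖ ≤ 2D. -/
lemma _root_.weighted_increment_sub_eq {E : Type*} [AddCommGroup E] [Module ℝ E] {α : ℕ → ℝ}
    (hα : ∀ t, α t = t) (k : ℕ) (x p : E) (u v : E → E) :
    (α (k + 1) • u x - α k • u p) - (α (k + 1) • v x - α k • v p) =
      (u x - v x) + (k : ℝ) • ((u x - v x) - (u p - v p)) := by
  simp only [hα]
  push_cast
  module

lemma sum_norm_meanMessage_sub_sq_le (h : StochasticOracle K g 𝒟 G L σ σL ξ ξL)
    (hα : ∀ t, α t = t) (hξ : 0 ≤ ξ) (hξL : 0 ≤ ξL) {k : ℕ} {x p : E} (hx : x ∈ K) (hp : p ∈ K)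
    (hxp : k * ‖x - p‖ ≤ 2 * D) :
    (M : ℝ)⁻¹ * ∑ i, ‖(α (k + 1) • meanGrad g 𝒟 i x - α k • meanGrad g 𝒟 i p) -
      (α (k + 1) • globalGrad (meanGrad g 𝒟) x - α k • globalGrad (meanGrad g 𝒟) p)‖ ^ 2 ≤
      (ξ + 2 * ξL * D) ^ 2 := by
  have e : ∀ i, (α (k + 1) • meanGrad g 𝒟 i x - α k • meanGrad g 𝒟 i p) -
      (α (k + 1) • globalGrad (meanGrad g 𝒟) x - α k • globalGrad (meanGrad g 𝒟) p) = _ := fun i =>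
    weighted_increment_sub_eq hα k x p (meanGrad g 𝒟 i) (globalGrad (meanGrad g 𝒟))
  simp_rw [e]
  refine (sum_norm_add_sq_le (by positivity) hξ (B := k * (ξL * ‖x - p‖)) (by positivity)
    (h.heterogeneity x hx) ?_).trans ?_
  · simp only [norm_smul, mul_pow, Real.norm_natCast]
    rw [← Finset.mul_sum, mul_left_comm]
    refine mul_le_mul_of_nonneg_left ?_ (by positivity)
    have := h.heterogeneity_increment x hx p hp
    rwa [mul_pow] at this
  · have : k * (ξL * ‖x - p‖) ≤ 2 * ξL * D := by nlinarith
    gcongr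

variable [FiniteDimensional ℝ E] [BorelSpace E]

lemma measurable_roundMessage (h : StochasticOracle K g 𝒟 G L σ σL ξ ξL) (k : ℕ) (x p : E)
    (i : Fin M) : Measurable (roundMessage g α k x p i) :=
  ((h.measurable_apply i x).const_smul _).sub ((h.measurable_apply i p).const_smul _)

variable [∀ i, IsProbabilityMeasure (𝒟 i)]

lemma memLp (h : StochasticOracle K g 𝒟 G L σ σL ξ ξL) (i : Fin M) (x : E) :
    MemLp (fun z => g i z x) 2 (𝒟 i) :=
  MemLp.of_bound (h.measurable_apply i x).aestronglyMeasurable G (.of_forall fun z => h.bound i z x)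

lemma integrable (h : StochasticOracle K g 𝒟 G L σ σL ξ ξL) (i : Fin M) (x : E) :
    Integrable (fun z => g i z x) (𝒟 i) :=
  (h.memLp i x).integrable one_le_two

lemma norm_meanGrad_sub_le (h : StochasticOracle K g 𝒟 G L σ σL ξ ξL) (i : Fin M) (x y : E) :
    ‖meanGrad g 𝒟 i x - meanGrad g 𝒟 i y‖ ≤ L * ‖x - y‖ := by
  unfold meanGrad
  rw [← integral_sub (h.integrable i x) (h.integrable i y)]
  refine (norm_integral_le_of_norm_le_const (C := L * ‖x - y‖)
    (.of_forall fun z => h.lipschitz i z x y)).trans ?_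
  simp

lemma norm_globalGrad_sub_le (h : StochasticOracle K g 𝒟 G L σ σL ξ ξL) (hM : 1 ≤ M) (x y : E) :
    ‖globalGrad (meanGrad g 𝒟) x - globalGrad (meanGrad g 𝒟) y‖ ≤ L * ‖x - y‖ := by
  have hM0 : (0 : ℝ) < M := by exact_mod_cast hM
  unfold globalGrad
  rw [← smul_sub, ← Finset.sum_sub_distrib, norm_smul, norm_inv, Real.norm_natCast,
    inv_mul_le_iff₀ hM0]
  refine (norm_sum_le_of_le _ fun i _ => h.norm_meanGrad_sub_le i x y).trans ?_
  simp

lemma continuous_globalGrad (h : StochasticOracle K g 𝒟 G L σ σL ξ ξL) (hM : 1 ≤ M)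
    (hL : 0 ≤ L) : Continuous (globalGrad (meanGrad g 𝒟)) :=
  (LipschitzWith.of_dist_le_mul (K := L.toNNReal) fun x y => by
    simpa [dist_eq_norm, Real.coe_toNNReal _ hL] using h.norm_globalGrad_sub_le hM x y).continuous

lemma integral_roundMessage (h : StochasticOracle K g 𝒟 G L σ σL ξ ξL) (k : ℕ) (x p : E)
    (i : Fin M) : ∫ z, roundMessage g α k x p i z ∂(𝒟 i) =
      α (k + 1) • meanGrad g 𝒟 i x - α k • meanGrad g 𝒟 i p := by
  have hi : ∀ (c : ℝ) y, Integrable (fun z => c • g i z y) (𝒟 i) := fun c y =>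
    (h.integrable i y).smul c
  unfold roundMessage meanGrad
  rw [integral_sub (hi _ x) (hi _ p), integral_smul, integral_smul]

lemma integral_norm_roundMessage_sub_sq_le (h : StochasticOracle K g 𝒟 G L σ σL ξ ξL)
    (hα : ∀ t, α t = t) (hσ : 0 ≤ σ) (hσL : 0 ≤ σL) {k : ℕ} {x p : E} (hx : x ∈ K) (hp : p ∈ K)
    (hxp : k * ‖x - p‖ ≤ 2 * D) (i : Fin M) :
    ∫ z, ‖roundMessage g α k x p i z - (α (k + 1) • meanGrad g 𝒟 i x -
      α k • meanGrad g 𝒟 i p)‖ ^ 2 ∂(𝒟 i) ≤ (σ + 2 * σL * D) ^ 2 := by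
  have h1 : ∀ y, MemLp (fun z => g i z y - meanGrad g 𝒟 i y) 2 (𝒟 i) := fun y =>
    (h.memLp i y).sub (memLp_const _)
  have e : ∀ z, roundMessage g α k x p i z - (α (k + 1) • meanGrad g 𝒟 i x -
      α k • meanGrad g 𝒟 i p) = (g i z x - meanGrad g 𝒟 i x) +
        (k : ℝ) • ((g i z x - meanGrad g 𝒟 i x) - (g i z p - meanGrad g 𝒟 i p)) := fun z =>
    weighted_increment_sub_eq hα k x p (g i z) (meanGrad g 𝒟 i)
  simp_rw [e]
  refine (integral_norm_add_sq_le (h1 x) (((h1 x).sub (h1 p)).const_smul (k : ℝ)) hσ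
    (B := k * (σL * ‖x - p‖)) (by positivity) (h.variance i x hx) ?_).trans ?_
  · simp only [Pi.smul_apply, Pi.sub_apply, norm_smul, mul_pow, Real.norm_natCast]
    rw [integral_const_mul]
    gcongr
    have := h.variance_increment i x hx p hp
    rwa [mul_pow] at this
  · have : k * (σL * ‖x - p‖) ≤ 2 * σL * D := by nlinarith
    gcongr

/-- The conditional second moment of the estimation error after one round. -/
lemma integral_norm_add_roundError_sq_le (h : StochasticOracle K g 𝒟 G L σ σL ξ ξL)
    (hα : ∀ t, α t = t) (hm : 1 ≤ m) (hmM : m ≤ M) (hL : 0 ≤ L) (hσ : 0 ≤ σ) (hσL : 0 ≤ σL)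
    (hξ : 0 ≤ ξ) (hξL : 0 ≤ ξL) {k : ℕ} {x p : E} (hx : x ∈ K) (hp : p ∈ K)
    (hxp : k * ‖x - p‖ ≤ 2 * D) (e : E) (γ : Measure E) [IsProbabilityMeasure γ] :
    ∫ r : (∀ i, 𝒵 i) × (Finset (Fin M) × E),
      ‖e + ((m : ℝ)⁻¹ • ∑ i ∈ r.2.1, roundMessage g α k x p i (r.1 i) -
        (α (k + 1) • globalGrad (meanGrad g 𝒟) x - α k • globalGrad (meanGrad g 𝒟) p))‖ ^ 2
        ∂((Measure.pi 𝒟).prod ((uniformOn {A : Finset (Fin M) | A.card = m}).prod γ)) ≤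
      ‖e‖ ^ 2 + ((σ + 2 * σL * D) ^ 2 + (ξ + 2 * ξL * D) ^ 2) / m := by
  set s : E := α (k + 1) • globalGrad (meanGrad g 𝒟) x - α k • globalGrad (meanGrad g 𝒟) p with hs
  set c : Fin M → E := fun i => α (k + 1) • meanGrad g 𝒟 i x - α k • meanGrad g 𝒟 i p with hc
  set V := (σ + 2 * σL * D) ^ 2 with hV
  have hm0 : (0 : ℝ) < m := by exact_mod_cast hm
  have hM0 : (0 : ℝ) < M := by exact_mod_cast hm.trans hmM
  have hne : {A : Finset (Fin M) | A.card = m}.Nonempty := by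
    obtain ⟨A, -, hA⟩ := Finset.exists_subset_card_eq
      (s := (Finset.univ : Finset (Fin M))) (n := m) (by simpa using hmM)
    exact ⟨A, hA⟩
  have hprob := isProbabilityMeasure_uniformOn (Set.toFinite _) hne
  have hb := norm_roundMessage_le (α := α) hα hL h.bound h.lipschitz hxp
  -- The machine means average to the global message, so the choice of a uniform subset introduces
  -- no bias.
  have hcs : ∑ i, (c i - s) = 0 := by
    have hg : ∀ y, (M : ℝ) • globalGrad (meanGrad g 𝒟) y = ∑ i, meanGrad g 𝒟 i y := fun y =>
      smul_inv_smul₀ hM0.ne' _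
    rw [Finset.sum_sub_distrib c (fun _ => s), Finset.sum_const, Finset.card_univ,
      Fintype.card_fin, ← Nat.cast_smul_eq_nsmul ℝ, hs, hc, smul_sub,
      smul_comm (M : ℝ) (α (k + 1)), smul_comm (M : ℝ) (α k), hg, hg, Finset.sum_sub_distrib,
      Finset.smul_sum, Finset.smul_sum, sub_self]
  -- For a fixed subset only the samples are random: independence across machines gives a variance
  -- term, and the remaining bias of the subset is averaged over A afterwards.
  have hinner : ∀ A : Finset (Fin M),
      ∫ z, ‖e + ((m : ℝ)⁻¹ • ∑ i ∈ A, roundMessage g α k x p i (z i) - s)‖ ^ 2 ∂(Measure.pi 𝒟) ≤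
        ‖e + ((m : ℝ)⁻¹ • ∑ i ∈ A, c i - s)‖ ^ 2 + A.card * ((m : ℝ)⁻¹ ^ 2 * V) := by
    intro A
    have hC : ∀ i, ‖c i‖ ≤ G + 2 * L * D := fun i => by
      have := norm_integral_le_of_norm_le_const (μ := 𝒟 i) (.of_forall (hb i))
      rw [h.integral_roundMessage] at this
      simpa using this
    have h1 := integral_norm_add_sum_sq_le 𝒟
      (f := fun i z => (m : ℝ)⁻¹ • (roundMessage g α k x p i z - c i))
      (fun i => ((h.measurable_roundMessage k x p i).sub_const _).const_smul _)
      (C := (m : ℝ)⁻¹ * ((G + 2 * L * D) + (G + 2 * L * D)))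
      (fun i z => by
        rw [norm_smul, norm_inv, Real.norm_natCast]
        gcongr
        exact (norm_sub_le _ _).trans (add_le_add (hb i z) (hC i)))
      (fun i => by
        rw [integral_smul, integral_sub _ (integrable_const _), h.integral_roundMessage,
          integral_const]
        · simp [hc]
        · exact ((h.integrable i x).smul _).sub ((h.integrable i p).smul _))
      (e + ((m : ℝ)⁻¹ • ∑ i ∈ A, c i - s)) A
    have e1 : ∀ z : ∀ i, 𝒵 i, e + ((m : ℝ)⁻¹ • ∑ i ∈ A, c i - s) +
        ∑ i ∈ A, (m : ℝ)⁻¹ • (roundMessage g α k x p i (z i) - c i) =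
        e + ((m : ℝ)⁻¹ • ∑ i ∈ A, roundMessage g α k x p i (z i) - s) := by
      intro z
      rw [← Finset.smul_sum, Finset.sum_sub_distrib (fun i => roundMessage g α k x p i (z i)) c,
        smul_sub]
      abel
    simp_rw [e1] at h1
    refine h1.trans ?_
    gcongr
    rw [← nsmul_eq_mul, ← Finset.sum_const]
    refine Finset.sum_le_sum fun i _ => ?_
    simp_rw [norm_smul, mul_pow, norm_inv, Real.norm_natCast]
    rw [integral_const_mul]
    gcongr
    exact h.integral_norm_roundMessage_sub_sq_le hα hσ hσL hx hp hxp i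
  have hmeas : Measurable fun r : (∀ i, 𝒵 i) × (Finset (Fin M) × E) =>
      e + ((m : ℝ)⁻¹ • ∑ i ∈ r.2.1, roundMessage g α k x p i (r.1 i) - s) := by
    have e1 : ∀ r : (∀ i, 𝒵 i) × (Finset (Fin M) × E),
        ∑ i ∈ r.2.1, roundMessage g α k x p i (r.1 i) =
        ∑ i, if i ∈ r.2.1 then roundMessage g α k x p i (r.1 i) else 0 := fun r => by
      rw [← Finset.sum_filter]; simp
    simp_rw [e1]
    refine (((Finset.measurable_sum _ fun i _ => ?_).const_smul _).sub_const _).const_add _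
    have h2 : Measurable fun r : (∀ i, 𝒵 i) × (Finset (Fin M) × E) => r.2.1 := by fun_prop
    have h3 : Measurable fun r : (∀ i, 𝒵 i) × (Finset (Fin M) × E) => r.1 i := by fun_prop
    exact Measurable.ite (h2 (measurableSet_mem_finset i))
      ((h.measurable_roundMessage k x p i).comp h3) measurable_const
  have hint : Integrable (fun r : (∀ i, 𝒵 i) × (Finset (Fin M) × E) =>
      ‖e + ((m : ℝ)⁻¹ • ∑ i ∈ r.2.1, roundMessage g α k x p i (r.1 i) - s)‖ ^ 2)
      ((Measure.pi 𝒟).prod ((uniformOn {A : Finset (Fin M) | A.card = m}).prod γ)) := by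
    refine integrable_of_norm_le (hmeas.norm.pow_const 2).aestronglyMeasurable
      (C := (‖e‖ + ((m : ℝ)⁻¹ * ∑ i : Fin M, (G + 2 * L * D) + ‖s‖)) ^ 2) fun r => ?_
    rw [norm_pow, norm_norm]
    gcongr
    refine (norm_add_le _ _).trans ?_
    gcongr
    refine (norm_sub_le _ _).trans ?_
    rw [norm_smul, norm_inv, Real.norm_natCast]
    gcongr
    refine (norm_sum_le_of_le _ fun i _ => hb i (r.1 i)).trans ?_
    refine Finset.sum_le_sum_of_subset_of_nonneg (Finset.subset_univ _) fun i _ _ => ?_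
    have : Nonempty (𝒵 i) := nonempty_of_isProbabilityMeasure (𝒟 i)
    exact (norm_nonneg _).trans (hb i (Classical.arbitrary _))
  rw [integral_prod_symm _ hint]
  set H : Finset (Fin M) → ℝ := fun A =>
    ‖e + ((m : ℝ)⁻¹ • ∑ i ∈ A, c i - s)‖ ^ 2 + A.card * ((m : ℝ)⁻¹ ^ 2 * V) with hH
  have hHi : Integrable H (uniformOn {A : Finset (Fin M) | A.card = m}) := .of_finite
  refine (integral_mono hint.integral_prod_right (hHi.comp_fst γ) fun y => hinner y.1).trans ?_
  rw [integral_fun_fst, probReal_univ, one_smul, integral_uniformOn_card hmM]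
  have e2 : ∑ A ∈ Finset.powersetCard m Finset.univ, H A =
      ∑ A ∈ Finset.powersetCard m (Finset.univ : Finset (Fin M)),
        (‖e + (m : ℝ)⁻¹ • ∑ i ∈ A, (c i - s)‖ ^ 2 + V / m) := by
    refine Finset.sum_congr rfl fun A hA => ?_
    have hAm : (A.card : ℝ) = m := by exact_mod_cast (Finset.mem_powersetCard.1 hA).2
    rw [hH]
    simp only
    rw [Finset.sum_sub_distrib c (fun _ => s), Finset.sum_const, ← Nat.cast_smul_eq_nsmul ℝ, hAm,
      smul_sub,
      inv_smul_smul₀ hm0.ne']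
    congr 1
    field_simp
  rw [e2, ← integral_uniformOn_card hmM (fun A : Finset (Fin M) =>
    ‖e + (m : ℝ)⁻¹ • ∑ i ∈ A, (c i - s)‖ ^ 2 + V / m), integral_add .of_finite
    (integrable_const _), integral_const, probReal_univ, one_smul]
  have h4 := integral_uniformOn_norm_add_sum_sq_le hm hmM hcs e
  have h5 := h.sum_norm_meanMessage_sub_sq_le (α := α) hα hξ hξL hx hp hxp
  have h6 : ((M : ℝ)⁻¹ * ∑ i, ‖c i - s‖ ^ 2) / m ≤ (ξ + 2 * ξL * D) ^ 2 / m := by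
    gcongr
  rw [add_div]
  linarith

end StochasticOracle

end Oracle

/-! ### Expectations along the trajectory -/

lemma isProbabilityMeasure_uniformOn_card {M m : ℕ} (hmM : m ≤ M) :
    IsProbabilityMeasure (uniformOn {A : Finset (Fin M) | A.card = m}) := by
  obtain ⟨A, -, hA⟩ := Finset.exists_subset_card_eq
    (s := (Finset.univ : Finset (Fin M))) (n := m) (by simpa using hmM)
  exact isProbabilityMeasure_uniformOn (Set.toFinite _) ⟨A, hA⟩

section Expectation

variable {d M m T : ℕ} {𝒵 : Fin M → Type*} [∀ i, MeasurableSpace (𝒵 i)]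

/-- The sample space of the excess-loss analysis. -/
abbrev TrustedSpace (d M T : ℕ) (𝒵 : Fin M → Type*) : Type _ :=
  FedDataset T 𝒵 × (Fin T → Finset (Fin M)) × (Fin T → EuclideanSpace ℝ (Fin d))

/-- The randomness of one round. -/
abbrev RoundSpace (d M : ℕ) (𝒵 : Fin M → Type*) : Type _ :=
  (∀ i, 𝒵 i) × (Finset (Fin M) × EuclideanSpace ℝ (Fin d))

/-- Replace the randomness of round `k`. -/
def resampleRound (k : Fin T) (x : TrustedSpace d M T 𝒵 × RoundSpace d M 𝒵) :
    TrustedSpace d M T 𝒵 :=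
  (fun i => Function.update (x.1.1 i) k (x.2.1 i),
    Function.update x.1.2.1 k x.2.2.1, Function.update x.1.2.2 k x.2.2.2)

/-- The law of all the randomness of the algorithm. -/
abbrev trustedMeasure (m : ℕ) (𝒟 : ∀ i, Measure (𝒵 i)) (v : Fin T → ℝ) :
    Measure (TrustedSpace d M T 𝒵) :=
  (sampleLaw T 𝒟).prod ((uniformSelection M m T).prod (gaussianNoise d v))

/-- The law of the randomness of one round. -/
abbrev roundMeasure (d m : ℕ) (𝒟 : ∀ i, Measure (𝒵 i)) (v : ℝ) :
    Measure (RoundSpace d M 𝒵) :=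
  (Measure.pi 𝒟).prod ((uniformOn {A : Finset (Fin M) | A.card = m}).prod
    (multivariateGaussian 0 (v • (1 : Matrix (Fin d) (Fin d) ℝ))))

instance isProbabilityMeasure_sampleLaw (𝒟 : ∀ i, Measure (𝒵 i))
    [∀ i, IsProbabilityMeasure (𝒟 i)] : IsProbabilityMeasure (sampleLaw T 𝒟) := by
  unfold sampleLaw; infer_instance

lemma isProbabilityMeasure_trustedMeasure (hmM : m ≤ M) (𝒟 : ∀ i, Measure (𝒵 i))
    [∀ i, IsProbabilityMeasure (𝒟 i)] (v : Fin T → ℝ) :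
    IsProbabilityMeasure (trustedMeasure (d := d) m 𝒟 v) := by
  have := isProbabilityMeasure_uniformOn_card hmM
  unfold trustedMeasure uniformSelection
  infer_instance

lemma measurePreserving_resampleRound (hmM : m ≤ M) (𝒟 : ∀ i, Measure (𝒵 i))
    [∀ i, IsProbabilityMeasure (𝒟 i)] (v : Fin T → ℝ) (k : Fin T) :
    MeasurePreserving (resampleRound k)
      ((trustedMeasure (d := d) m 𝒟 v).prod (roundMeasure d m 𝒟 (v k)))
      (trustedMeasure m 𝒟 v) := by
  have := isProbabilityMeasure_uniformOn_card hmM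
  have h1 : MeasurePreserving
      (fun (x : FedDataset T 𝒵 × (∀ i, 𝒵 i)) i => Function.update (x.1 i) k (x.2 i))
      ((sampleLaw T 𝒟).prod (Measure.pi 𝒟)) (sampleLaw T 𝒟) := by
    have e1 := measurePreserving_pi_zip (fun i => Measure.pi fun _ : Fin T => 𝒟 i) 𝒟
    have e2 := measurePreserving_pi (fun i => (Measure.pi fun _ : Fin T => 𝒟 i).prod (𝒟 i))
      (fun i => Measure.pi fun _ : Fin T => 𝒟 i)
      (fun i => measurePreserving_pi_update (fun _ : Fin T => 𝒟 i) k)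
    exact e2.comp e1
  have h2 := measurePreserving_pi_update
    (fun _ : Fin T => uniformOn {A : Finset (Fin M) | A.card = m}) k
  have h3 := measurePreserving_pi_update
    (fun t => multivariateGaussian 0 (v t • (1 : Matrix (Fin d) (Fin d) ℝ))) k
  exact h1.prod_interchange (h2.prod_interchange h3)

/-- The second moment of the Gaussian noise of one round. -/
lemma integral_norm_sq_multivariateGaussian {v : ℝ} (hv : 0 ≤ v) :
    ∫ y : EuclideanSpace ℝ (Fin d), ‖y‖ ^ 2
      ∂(multivariateGaussian 0 (v • (1 : Matrix (Fin d) (Fin d) ℝ))) = d * v := by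
  have hS : (v • (1 : Matrix (Fin d) (Fin d) ℝ)).PosSemidef := Matrix.PosSemidef.one.smul hv
  have hmp : ∀ i : Fin d, MeasurePreserving (fun x : EuclideanSpace ℝ (Fin d) => x i)
      (multivariateGaussian 0 (v • (1 : Matrix (Fin d) (Fin d) ℝ)))
      (gaussianReal 0 v.toNNReal) := fun i => by
    simpa using measurePreserving_eval_multivariateGaussian (μ := 0) hS (i := i)
  have hmem : ∀ i : Fin d, MemLp (fun x : EuclideanSpace ℝ (Fin d) => x i) 2
      (multivariateGaussian 0 (v • (1 : Matrix (Fin d) (Fin d) ℝ))) := fun i =>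
    (memLp_id_gaussianReal' 2 (by simp)).comp_measurePreserving (hmp i)
  simp_rw [EuclideanSpace.norm_sq_eq, Real.norm_eq_abs, sq_abs]
  rw [integral_finsetSum _ fun i _ => (hmem i).integrable_sq]
  have h1 : ∀ i : Fin d, ∫ x : EuclideanSpace ℝ (Fin d), x i ^ 2
      ∂(multivariateGaussian 0 (v • (1 : Matrix (Fin d) (Fin d) ℝ))) = v := by
    intro i
    have hvar := variance_eval_multivariateGaussian (μ := 0) hS i
    rw [variance_eq_sub (hmem i)] at hvar
    have h0 : ∫ x : EuclideanSpace ℝ (Fin d), x i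
        ∂(multivariateGaussian 0 (v • (1 : Matrix (Fin d) (Fin d) ℝ))) = 0 := by
      have := integral_map (μ := multivariateGaussian 0 (v • (1 : Matrix (Fin d) (Fin d) ℝ)))
        (hmp i).measurable.aemeasurable (f := fun x : ℝ => x) (by fun_prop)
      rw [(hmp i).map_eq, integral_id_gaussianReal] at this
      exact this.symm
    rw [h0] at hvar
    simpa using hvar
  simp [h1]

end Expectation

/-! ### The potential of the trajectory -/

section Estimation

variable {E : Type*} [NormedAddCommGroup E] [InnerProductSpace ℝ E] {M T : ℕ}
  {𝒵 : Fin M → Type*} [∀ i, MeasurableSpace (𝒵 i)]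

/-- The error `q_k - α_k ∇f(x_k)` of the gradient estimate. -/
def estimationError (K : Set E) (g : ∀ i, 𝒵 i → E → E) (𝒟 : ∀ i, Measure (𝒵 i)) (α : ℕ → ℝ)
    (η : ℝ) (m : ℕ) (x₀ : E) (S : FedDataset T 𝒵) (sel : Fin T → Finset (Fin M)) (Y : Fin T → E)
    (k : ℕ) (h : k ≤ T) : E :=
  (trustedState K g α η m x₀ S sel Y k h).q -
    α k • globalGrad (meanGrad g 𝒟) (trustedState K g α η m x₀ S sel Y k h).xPrev

variable {K : Set E} {g : ∀ i, 𝒵 i → E → E} {𝒟 : ∀ i, Measure (𝒵 i)} {α : ℕ → ℝ} {η : ℝ} {m : ℕ}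
  {x₀ : E} {S : FedDataset T 𝒵} {sel : Fin T → Finset (Fin M)} {Y : Fin T → E}

lemma estimationError_zero (hα : ∀ t, α t = t) :
    estimationError K g 𝒟 α η m x₀ S sel Y 0 (Nat.zero_le T) = 0 := by
  simp [estimationError, trustedState, hα]

lemma estimationError_succ {k : ℕ} (h : k + 1 ≤ T) :
    estimationError K g 𝒟 α η m x₀ S sel Y (k + 1) h =
      estimationError K g 𝒟 α η m x₀ S sel Y k (Nat.le_of_succ_le h) + ((m : ℝ)⁻¹ •
        ∑ i ∈ sel ⟨k, h⟩, roundMessage g α k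
          (trustedState K g α η m x₀ S sel Y k (Nat.le_of_succ_le h)).x
          (trustedState K g α η m x₀ S sel Y k (Nat.le_of_succ_le h)).xPrev i (S i ⟨k, h⟩) -
        (α (k + 1) • globalGrad (meanGrad g 𝒟)
          (trustedState K g α η m x₀ S sel Y k (Nat.le_of_succ_le h)).x -
         α k • globalGrad (meanGrad g 𝒟)
          (trustedState K g α η m x₀ S sel Y k (Nat.le_of_succ_le h)).xPrev)) := by
  unfold estimationError
  rw [trustedState_succ_q, trustedState_succ_xPrev]
  abel

/-- One step of the potential `A_k (F(x_k) - F(x*)) + ‖w_k - x*‖² / (2 η)`. -/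
lemma potential_succ_le (hK : IsCompact K) (hc : Convex ℝ K) (hx₀ : x₀ ∈ K)
    (hα : ∀ t, α t = t) (hη : 0 < η) {D L Gs : ℝ} (hL : 0 ≤ L)
    (hD : ∀ x ∈ K, ∀ y ∈ K, ‖x - y‖ ≤ D) {F : E → ℝ}
    (hF₁ : ∀ x ∈ K, ∀ y ∈ K, F y ≤ F x + ⟪globalGrad (meanGrad g 𝒟) x, y - x⟫ +
      L / 2 * ‖y - x‖ ^ 2)
    (hF₂ : ∀ x ∈ K, ∀ y ∈ K, F x + ⟪globalGrad (meanGrad g 𝒟) x, y - x⟫ ≤ F y)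
    (hGs : ∀ x ∈ K, ‖globalGrad (meanGrad g 𝒟) x‖ ≤ Gs + L * D) {xs : E} (hxs : xs ∈ K)
    {k : ℕ} (h : k + 1 ≤ T) :
    ((k : ℝ) + 2) * (k + 3) / 2 * (F (trustedState K g α η m x₀ S sel Y (k + 1) h).x - F xs) +
      ‖(trustedState K g α η m x₀ S sel Y (k + 1) h).w - xs‖ ^ 2 / (2 * η) ≤
    ((k : ℝ) + 1) * (k + 2) / 2 *
        (F (trustedState K g α η m x₀ S sel Y k (Nat.le_of_succ_le h)).x - F xs) +
      ‖(trustedState K g α η m x₀ S sel Y k (Nat.le_of_succ_le h)).w - xs‖ ^ 2 / (2 * η) +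
      (Gs * D + 2 * L * D ^ 2) +
      D * ‖estimationError K g 𝒟 α η m x₀ S sel Y (k + 1) h‖ -
      ⟪Y ⟨k, h⟩, (trustedState K g α η m x₀ S sel Y k (Nat.le_of_succ_le h)).w - xs⟫ +
      η / 2 * ‖Y ⟨k, h⟩‖ ^ 2 := by
  obtain ⟨hwK, hxK, -⟩ := trustedState_mem (grad := g) (η := η) (m := m) (S := S) (sel := sel)
    (Y := Y) hK hc hx₀ hα k (Nat.le_of_succ_le h)
  obtain ⟨hwK', hxK', -⟩ := trustedState_mem (grad := g) (η := η) (m := m) (S := S) (sel := sel)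
    (Y := Y) hK hc hx₀ hα (k + 1) h
  have hstep := inner_projOn_step_le (w := (trustedState K g α η m x₀ S sel Y k
    (Nat.le_of_succ_le h)).w) (u := xs) (g := (trustedState K g α η m x₀ S sel Y (k + 1) h).q +
      Y ⟨k, h⟩) hK hc hη hxs
  rw [← trustedState_succ_w] at hstep
  have hx' := trustedState_succ_x (K := K) (grad := g) (η := η) (m := m) (x₀ := x₀) (S := S)
    (sel := sel) (Y := Y) hα h
  have hε : (trustedState K g α η m x₀ S sel Y (k + 1) h).q =
      estimationError K g 𝒟 α η m x₀ S sel Y (k + 1) h + ((k : ℝ) + 1) •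
      globalGrad (meanGrad g 𝒟) (trustedState K g α η m x₀ S sel Y k (Nat.le_of_succ_le h)).x := by
    unfold estimationError
    rw [trustedState_succ_xPrev, hα]
    push_cast
    abel
  rw [hε] at hstep
  generalize estimationError K g 𝒟 α η m x₀ S sel Y (k + 1) h = ε at *
  generalize (trustedState K g α η m x₀ S sel Y k (Nat.le_of_succ_le h)).w = w at *
  generalize (trustedState K g α η m x₀ S sel Y k (Nat.le_of_succ_le h)).x = x at *
  generalize (trustedState K g α η m x₀ S sel Y (k + 1) h).w = w' at *
  generalize (trustedState K g α η m x₀ S sel Y (k + 1) h).x = x' at *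
  generalize Y ⟨k, h⟩ = y at *
  set u := globalGrad (meanGrad g 𝒟) x with hu
  have hk : (0 : ℝ) ≤ k := Nat.cast_nonneg k
  have hD0 : 0 ≤ D := by simpa using hD _ hx₀ _ hx₀
  set θ : ℝ := 2 / (k + 3) with hθ
  have hθ1 : θ * (k + 3) = 2 := by rw [hθ]; field_simp
  have hθ0 : 0 < θ := by positivity
  -- the smoothness step
  have h1 := hF₁ x hxK x' hxK'
  rw [hx', add_sub_cancel_left, ← hu, inner_smul_right, norm_smul, Real.norm_eq_abs,
    abs_of_pos hθ0, mul_pow] at h1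
  rw [← hx'] at h1
  have h2 := hF₂ x hxK xs hxs
  rw [← hu] at h2
  have h3 : ‖w' - x‖ ^ 2 ≤ D ^ 2 := by gcongr; exact hD _ hwK' _ hxK
  have hsm : ((k : ℝ) + 2) * (k + 3) / 2 * F x' ≤ ((k : ℝ) + 2) * (k + 3) / 2 * F x +
      (k + 2) * ⟪u, w' - x⟫ + L * D ^ 2 := by
    have h4 : ((k : ℝ) + 2) * (k + 3) / 2 * F x' ≤ ((k : ℝ) + 2) * (k + 3) / 2 *
        (F x + θ * ⟪u, w' - x⟫ + L / 2 * (θ ^ 2 * ‖w' - x‖ ^ 2)) := by gcongr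
    have h5 : ((k : ℝ) + 2) * (k + 3) / 2 *
        (F x + θ * ⟪u, w' - x⟫ + L / 2 * (θ ^ 2 * ‖w' - x‖ ^ 2)) =
        ((k : ℝ) + 2) * (k + 3) / 2 * F x + (k + 2) * (θ * (k + 3)) / 2 * ⟪u, w' - x⟫ +
          L / 2 * ((k + 2) * θ * (θ * (k + 3)) / 2 * ‖w' - x‖ ^ 2) := by ring
    rw [h5, hθ1] at h4
    have h6 : ((k : ℝ) + 2) * θ ≤ 2 := by nlinarith
    have h7 : L / 2 * (((k : ℝ) + 2) * θ * 2 / 2 * ‖w' - x‖ ^ 2) ≤ L / 2 * (2 * D ^ 2) := by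
      have : ((k : ℝ) + 2) * θ * 2 / 2 = (k + 2) * θ := by ring
      rw [this]
      gcongr
    linarith
  have hin : ⟪u, w' - xs⟫ = ⟪u, w' - x⟫ - ⟪u, xs - x⟫ := by
    rw [← inner_sub_right]; congr 1; abel
  -- the gradient term
  have h8 : ⟪u, w' - xs⟫ ≤ (Gs + L * D) * D := by
    refine (real_inner_le_norm _ _).trans ?_
    have := hGs x hxK
    exact mul_le_mul this (hD _ hwK' _ hxs) (norm_nonneg _) ((norm_nonneg _).trans this)
  have h9 : -⟪ε, w' - xs⟫ ≤ D * ‖ε‖ := by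
    have h10 := abs_le.1 (abs_real_inner_le_norm ε (w' - xs))
    have h11 : ‖ε‖ * ‖w' - xs‖ ≤ ‖ε‖ * D := by gcongr; exact hD _ hwK' _ hxs
    linarith [h10.1]
  -- The noise is paired with the old iterate w, of which it is independent. The remaining ⟪y, w -
  -- w'⟫ is split by Young's inequality, and its quadratic part is cancelled by -‖w - w'‖²/(2η) from
  -- the projected step.
  have h12 : -⟪y, w' - xs⟫ ≤ -⟪y, w - xs⟫ + (η / 2 * ‖y‖ ^ 2 + ‖w - w'‖ ^ 2 / (2 * η)) := by
    have h13 : ⟪y, w - xs⟫ - ⟪y, w' - xs⟫ = ⟪y, w - w'⟫ := by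
      rw [← inner_sub_right]; congr 1; abel
    have h14 := real_inner_le_norm y (w - w')
    have h15 : η / 2 * ‖y‖ ^ 2 + ‖w - w'‖ ^ 2 / (2 * η) - ‖y‖ * ‖w - w'‖ =
        (η * ‖y‖ - ‖w - w'‖) ^ 2 / (2 * η) := by field_simp; ring
    have h16 : 0 ≤ (η * ‖y‖ - ‖w - w'‖) ^ 2 / (2 * η) := by positivity
    linarith
  rw [inner_add_left, inner_add_left, inner_smul_left] at hstep
  simp only [conj_trivial] at hstep
  have h17 : (‖w - xs‖ ^ 2 - ‖w' - xs‖ ^ 2 - ‖w - w'‖ ^ 2) / (2 * η) =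
      ‖w - xs‖ ^ 2 / (2 * η) - ‖w' - xs‖ ^ 2 / (2 * η) - ‖w - w'‖ ^ 2 / (2 * η) := by ring
  rw [h17] at hstep
  -- The potential gains weight k + 2, whereas q carries the gradient with weight k + 1. The
  -- projected step treats k + 1 of these units; the leftover ⟪u, w' - xs⟫ costs (Gs + L D) D, which
  -- with L D² from smoothness makes Gs D + 2 L D².
  have h18 : ((k : ℝ) + 2) * (F x - F xs + ⟪u, w' - x⟫) ≤ (k + 2) * ⟪u, w' - xs⟫ := by
    gcongr
    linarith
  nlinarith

end Estimation

/-! ### Second moment of the gradient estimation error -/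

section Expectation

variable {d M m T : ℕ} {𝒵 : Fin M → Type*}
  {K : Set (EuclideanSpace ℝ (Fin d))}
  {g : ∀ i, 𝒵 i → EuclideanSpace ℝ (Fin d) → EuclideanSpace ℝ (Fin d)}
  {x₀ : EuclideanSpace ℝ (Fin d)} {α : ℕ → ℝ} {η G L D σ σL ξ ξL : ℝ} {v : Fin T → ℝ}

lemma trustedState_resampleRound (k : Fin T)
    (x : TrustedSpace d M T 𝒵 × RoundSpace d M 𝒵) :
    trustedState K g α η m x₀ (resampleRound k x).1 (resampleRound k x).2.1
      (resampleRound k x).2.2 k k.2.le =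
    trustedState K g α η m x₀ x.1.1 x.1.2.1 x.1.2.2 k k.2.le :=
  trustedState_congr k.1 k.2.le
    (fun _ ht _ => Function.update_of_ne (Fin.ne_of_lt ht) _ _)
    (fun _ ht => Function.update_of_ne (Fin.ne_of_lt ht) _ _)
    (fun _ ht => Function.update_of_ne (Fin.ne_of_lt ht) _ _)

variable [∀ i, MeasurableSpace (𝒵 i)] {𝒟 : ∀ i, Measure (𝒵 i)}

lemma StochasticOracle.measurable_trustedState (h : StochasticOracle K g 𝒟 G L σ σL ξ ξL)
    (hK : IsCompact K) (hc : Convex ℝ K) (hx₀ : x₀ ∈ K) (k : ℕ) (hk : k ≤ T) :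
    Measurable (fun ω : TrustedSpace d M T 𝒵 =>
      (trustedState K g α η m x₀ ω.1 ω.2.1 ω.2.2 k hk).w) ∧
    Measurable (fun ω : TrustedSpace d M T 𝒵 =>
      (trustedState K g α η m x₀ ω.1 ω.2.1 ω.2.2 k hk).x) ∧
    Measurable (fun ω : TrustedSpace d M T 𝒵 =>
      (trustedState K g α η m x₀ ω.1 ω.2.1 ω.2.2 k hk).xPrev) ∧
    Measurable (fun ω : TrustedSpace d M T 𝒵 =>
      (trustedState K g α η m x₀ ω.1 ω.2.1 ω.2.2 k hk).q) :=
  have hS : ∀ i t, Measurable fun ω : TrustedSpace d M T 𝒵 => ω.1 i t := fun i t =>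
    measurable_pi_iff.1 (measurable_pi_iff.1 measurable_fst i) t
  _root_.measurable_trustedState hK hc hx₀
    (fun i t _ hX => (h.measurable i).comp ((hS i t).prodMk hX))
    (measurable_fst.comp measurable_snd) (measurable_snd.comp measurable_snd) k hk

variable [∀ i, IsProbabilityMeasure (𝒟 i)]

lemma StochasticOracle.measurable_estimationError (h : StochasticOracle K g 𝒟 G L σ σL ξ ξL)
    (hK : IsCompact K) (hc : Convex ℝ K) (hx₀ : x₀ ∈ K) (hM : 1 ≤ M) (hL : 0 ≤ L) (k : ℕ)
    (hk : k ≤ T) : Measurable (fun ω : TrustedSpace d M T 𝒵 =>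
      estimationError K g 𝒟 α η m x₀ ω.1 ω.2.1 ω.2.2 k hk) := by
  obtain ⟨-, -, h3, h4⟩ := h.measurable_trustedState (α := α) (η := η) (m := m) hK hc hx₀ k hk
  have h5 : Measurable (fun ω : TrustedSpace d M T 𝒵 => globalGrad (meanGrad g 𝒟)
      (trustedState K g α η m x₀ ω.1 ω.2.1 ω.2.2 k hk).xPrev) :=
    (h.continuous_globalGrad hM hL).measurable.comp h3
  exact h4.sub (h5.const_smul (α k))

lemma StochasticOracle.norm_globalGrad_le (h : StochasticOracle K g 𝒟 G L σ σL ξ ξL)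
    (hM : 1 ≤ M) (x : EuclideanSpace ℝ (Fin d)) : ‖globalGrad (meanGrad g 𝒟) x‖ ≤ G := by
  have hM0 : (0 : ℝ) < M := by exact_mod_cast hM
  have hi : ∀ i, ‖meanGrad g 𝒟 i x‖ ≤ G := fun i => by
    refine (norm_integral_le_of_norm_le_const (.of_forall fun z => h.bound i z x)).trans ?_
    simp
  unfold globalGrad
  rw [norm_smul, norm_inv, Real.norm_natCast, inv_mul_le_iff₀ hM0]
  refine (norm_sum_le_of_le _ fun i _ => hi i).trans ?_
  simp

/-- A crude bound, needed only for integrability. The unbounded noise enters the error solely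
through the query points, where the gradients are bounded. -/
lemma StochasticOracle.exists_norm_estimationError_le
    (h : StochasticOracle K g 𝒟 G L σ σL ξ ξL) (hα : ∀ t, α t = t) (hM : 1 ≤ M) (k : ℕ)
    (hk : k ≤ T) : ∃ C, ∀ ω : TrustedSpace d M T 𝒵,
      ‖estimationError K g 𝒟 α η m x₀ ω.1 ω.2.1 ω.2.2 k hk‖ ≤ C := by
  induction k with
  | zero => exact ⟨0, fun ω => by rw [estimationError_zero hα, norm_zero]⟩
  | succ k ih =>
    obtain ⟨C, hC⟩ := ih (Nat.le_of_succ_le hk)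
    have hα0 : ∀ t, 0 ≤ α t := fun t => by rw [hα]; positivity
    have hsc : ∀ t (y : EuclideanSpace ℝ (Fin d)), ‖y‖ ≤ G → ‖α t • y‖ ≤ α t * G :=
      fun t y hy => by
        rw [norm_smul, Real.norm_eq_abs, abs_of_nonneg (hα0 t)]
        exact mul_le_mul_of_nonneg_left hy (hα0 t)
    have hdiff : ∀ y z : EuclideanSpace ℝ (Fin d), ‖y‖ ≤ G → ‖z‖ ≤ G →
        ‖α (k + 1) • y - α k • z‖ ≤ α (k + 1) * G + α k * G := fun y z hy hz =>
      (norm_sub_le _ _).trans (add_le_add (hsc _ _ hy) (hsc _ _ hz))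
    refine ⟨C + ((m : ℝ)⁻¹ * ∑ _i : Fin M, |α (k + 1) * G + α k * G| +
      (α (k + 1) * G + α k * G)), fun ω => ?_⟩
    rw [estimationError_succ]
    refine (norm_add_le _ _).trans (add_le_add (hC ω) ((norm_sub_le _ _).trans (add_le_add ?_
      (hdiff _ _ (h.norm_globalGrad_le hM _) (h.norm_globalGrad_le hM _)))))
    rw [norm_smul, norm_inv, Real.norm_natCast]
    refine mul_le_mul_of_nonneg_left ?_ (by positivity)
    refine (norm_sum_le_of_le _ fun i _ => (hdiff _ _ (h.bound i _ _) (h.bound i _ _)).trans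
      (le_abs_self _)).trans ?_
    exact Finset.sum_le_sum_of_subset_of_nonneg (Finset.subset_univ _) fun i _ _ => abs_nonneg _

/-- Given the past, each round adds a centered increment, so second moments add up and the growth is
linear in k rather than quadratic. -/
lemma StochasticOracle.integral_norm_estimationError_sq_le
    (h : StochasticOracle K g 𝒟 G L σ σL ξ ξL) (hK : IsCompact K) (hc : Convex ℝ K)
    (hx₀ : x₀ ∈ K) (hD : ∀ x ∈ K, ∀ y ∈ K, ‖x - y‖ ≤ D) (hα : ∀ t, α t = t) (hm : 1 ≤ m)
    (hmM : m ≤ M) (hL : 0 ≤ L) (hσ : 0 ≤ σ) (hσL : 0 ≤ σL) (hξ : 0 ≤ ξ) (hξL : 0 ≤ ξL)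
    (k : ℕ) (hk : k ≤ T) :
    Integrable (fun ω : TrustedSpace d M T 𝒵 =>
        ‖estimationError K g 𝒟 α η m x₀ ω.1 ω.2.1 ω.2.2 k hk‖ ^ 2) (trustedMeasure m 𝒟 v) ∧
    ∫ ω : TrustedSpace d M T 𝒵, ‖estimationError K g 𝒟 α η m x₀ ω.1 ω.2.1 ω.2.2 k hk‖ ^ 2
      ∂(trustedMeasure m 𝒟 v) ≤
      k * (((σ + 2 * σL * D) ^ 2 + (ξ + 2 * ξL * D) ^ 2) / m) := by
  have hP := isProbabilityMeasure_trustedMeasure (d := d) hmM 𝒟 v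
  have hU := isProbabilityMeasure_uniformOn_card hmM
  have hint : ∀ k (hk : k ≤ T), Integrable (fun ω : TrustedSpace d M T 𝒵 =>
      ‖estimationError K g 𝒟 α η m x₀ ω.1 ω.2.1 ω.2.2 k hk‖ ^ 2) (trustedMeasure m 𝒟 v) := by
    intro k hk
    obtain ⟨C, hC⟩ := h.exists_norm_estimationError_le (α := α) (η := η) (m := m) (x₀ := x₀) hα
      (hm.trans hmM) k hk
    refine integrable_of_norm_le ((h.measurable_estimationError hK hc hx₀ (hm.trans hmM) hL k
      hk).norm.pow_const 2).aestronglyMeasurable (C := C ^ 2) fun ω => ?_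
    rw [norm_pow, norm_norm]
    gcongr
    exact hC ω
  refine ⟨hint k hk, ?_⟩
  induction k with
  | zero => simp [estimationError_zero hα]
  | succ k ih =>
    have hstep := (measurePreserving_resampleRound (d := d) hmM 𝒟 v ⟨k, hk⟩).integral_le_of_resample
      (hint (k + 1) hk) ((hint k (Nat.le_of_succ_le hk)).add
        (integrable_const (((σ + 2 * σL * D) ^ 2 + (ξ + 2 * ξL * D) ^ 2) / m))) (by
        intro ω
        obtain ⟨-, m2, m3⟩ := trustedState_mem (grad := g) (η := η) (m := m) (S := ω.1)
          (sel := ω.2.1) (Y := ω.2.2) hK hc hx₀ hα k (Nat.le_of_succ_le hk)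
        have hxp := mul_norm_trustedState_sub_le (grad := g) (η := η) (m := m) (S := ω.1)
          (sel := ω.2.1) (Y := ω.2.2) hK hc hx₀ hα hD k (Nat.le_of_succ_le hk)
        have hst := fun r : RoundSpace d M 𝒵 => trustedState_resampleRound (K := K) (g := g)
          (α := α) (η := η) (m := m) (x₀ := x₀) ⟨k, hk⟩ (ω, r)
        have e : ∀ r : RoundSpace d M 𝒵, estimationError K g 𝒟 α η m x₀
            (resampleRound ⟨k, hk⟩ (ω, r)).1 (resampleRound ⟨k, hk⟩ (ω, r)).2.1
            (resampleRound ⟨k, hk⟩ (ω, r)).2.2 (k + 1) hk =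
            estimationError K g 𝒟 α η m x₀ ω.1 ω.2.1 ω.2.2 k (Nat.le_of_succ_le hk) +
            ((m : ℝ)⁻¹ • ∑ i ∈ r.2.1, roundMessage g α k
              (trustedState K g α η m x₀ ω.1 ω.2.1 ω.2.2 k (Nat.le_of_succ_le hk)).x
              (trustedState K g α η m x₀ ω.1 ω.2.1 ω.2.2 k (Nat.le_of_succ_le hk)).xPrev i (r.1 i) -
            (α (k + 1) • globalGrad (meanGrad g 𝒟)
              (trustedState K g α η m x₀ ω.1 ω.2.1 ω.2.2 k (Nat.le_of_succ_le hk)).x -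
             α k • globalGrad (meanGrad g 𝒟)
              (trustedState K g α η m x₀ ω.1 ω.2.1 ω.2.2 k
                (Nat.le_of_succ_le hk)).xPrev)) := by
          intro r
          rw [estimationError_succ]
          unfold estimationError
          rw [hst r]
          simp only [resampleRound, Function.update_self]
        simp_rw [e]
        exact h.integral_norm_add_roundError_sq_le hα hm hmM hL hσ hσL hξ hξL m2 m3 hxp _ _)
    refine hstep.trans ?_
    rw [integral_add' (hint k _) (integrable_const _), integral_const]
    have := ih (Nat.le_of_succ_le hk)
    simp only [probReal_univ, one_smul]
    push_cast
    linarith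

lemma sq_integral_norm_le {X : Type*} [MeasurableSpace X] {μ : Measure X}
    [IsProbabilityMeasure μ] {f : X → ℝ} (hf : MemLp f 2 μ) :
    (∫ x, f x ∂μ) ^ 2 ≤ ∫ x, f x ^ 2 ∂μ := by
  have h := variance_nonneg f μ
  rw [variance_eq_sub hf] at h
  simpa using h

end Expectation

/-! ### Expected growth of the potential -/

section ExpectedPotential

variable {d M m T : ℕ} {𝒵 : Fin M → Type*} [∀ i, MeasurableSpace (𝒵 i)]
  {K : Set (EuclideanSpace ℝ (Fin d))}
  {g : ∀ i, 𝒵 i → EuclideanSpace ℝ (Fin d) → EuclideanSpace ℝ (Fin d)}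
  {𝒟 : ∀ i, Measure (𝒵 i)} [∀ i, IsProbabilityMeasure (𝒟 i)]
  {x₀ : EuclideanSpace ℝ (Fin d)} {α : ℕ → ℝ} {η G L D σ σL ξ ξL : ℝ} {v : Fin T → ℝ}

lemma measurePreserving_trustedMeasure_noise (hmM : m ≤ M) (k : Fin T) :
    MeasurePreserving (fun ω : TrustedSpace d M T 𝒵 => ω.2.2 k) (trustedMeasure m 𝒟 v)
      (multivariateGaussian 0 (v k • (1 : Matrix (Fin d) (Fin d) ℝ))) := by
  have := isProbabilityMeasure_uniformOn_card hmM
  have : IsProbabilityMeasure (uniformSelection M m T) := by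
    unfold uniformSelection; infer_instance
  have h1 : MeasurePreserving Prod.snd
      ((uniformSelection M m T).prod (gaussianNoise d v)) (gaussianNoise d v) :=
    measurePreserving_snd
  have h2 : MeasurePreserving Prod.snd (trustedMeasure (d := d) m 𝒟 v)
      ((uniformSelection M m T).prod (gaussianNoise d v)) := measurePreserving_snd
  exact (measurePreserving_eval _ k).comp (h1.comp h2)

lemma integrable_norm_sq_noise (hmM : m ≤ M) (k : Fin T) :
    Integrable (fun ω : TrustedSpace d M T 𝒵 => ‖ω.2.2 k‖ ^ 2) (trustedMeasure m 𝒟 v) := by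
  have h1 : MemLp (fun ω : TrustedSpace d M T 𝒵 => ω.2.2 k) 2 (trustedMeasure m 𝒟 v) :=
    (IsGaussian.memLp_two_id (μ := multivariateGaussian 0
      (v k • (1 : Matrix (Fin d) (Fin d) ℝ)))).comp_measurePreserving
      (measurePreserving_trustedMeasure_noise hmM k)
  exact h1.integrable_norm_pow two_ne_zero

lemma integral_norm_sq_noise (hmM : m ≤ M) (k : Fin T) (hv : 0 ≤ v k) :
    ∫ ω : TrustedSpace d M T 𝒵, ‖ω.2.2 k‖ ^ 2 ∂(trustedMeasure m 𝒟 v) = d * v k := by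
  have hmp := measurePreserving_trustedMeasure_noise (𝒟 := 𝒟) (v := v) (d := d) hmM k
  rw [← integral_norm_sq_multivariateGaussian hv, ← hmp.map_eq,
    integral_map hmp.measurable.aemeasurable (by fun_prop)]

namespace StochasticOracle

lemma integrable_comp_query (h : StochasticOracle K g 𝒟 G L σ σL ξ ξL) (hK : IsCompact K)
    (hc : Convex ℝ K) (hx₀ : x₀ ∈ K) (hα : ∀ t, α t = t) (hmM : m ≤ M)
    {F : EuclideanSpace ℝ (Fin d) → ℝ} (hF : Continuous F) (k : ℕ) (hk : k ≤ T) :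
    Integrable (fun ω : TrustedSpace d M T 𝒵 =>
      F (trustedState K g α η m x₀ ω.1 ω.2.1 ω.2.2 k hk).x) (trustedMeasure m 𝒟 v) := by
  have := isProbabilityMeasure_trustedMeasure (d := d) hmM 𝒟 v
  obtain ⟨C, hC⟩ := hK.exists_bound_of_continuousOn hF.continuousOn
  exact integrable_of_norm_le (hF.measurable.comp
    (h.measurable_trustedState hK hc hx₀ k hk).2.1).aestronglyMeasurable
    fun ω => hC _ (trustedState_mem hK hc hx₀ hα k hk).2.1

lemma integrable_comp_iterate (h : StochasticOracle K g 𝒟 G L σ σL ξ ξL) (hK : IsCompact K)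
    (hc : Convex ℝ K) (hx₀ : x₀ ∈ K) (hα : ∀ t, α t = t) (hmM : m ≤ M)
    {F : EuclideanSpace ℝ (Fin d) → ℝ} (hF : Continuous F) (k : ℕ) (hk : k ≤ T) :
    Integrable (fun ω : TrustedSpace d M T 𝒵 =>
      F (trustedState K g α η m x₀ ω.1 ω.2.1 ω.2.2 k hk).w) (trustedMeasure m 𝒟 v) := by
  have := isProbabilityMeasure_trustedMeasure (d := d) hmM 𝒟 v
  obtain ⟨C, hC⟩ := hK.exists_bound_of_continuousOn hF.continuousOn
  exact integrable_of_norm_le (hF.measurable.comp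
    (h.measurable_trustedState hK hc hx₀ k hk).1).aestronglyMeasurable
    fun ω => hC _ (trustedState_mem hK hc hx₀ hα k hk).1

/-- The noise of a round is independent of the iterate at its beginning. -/
lemma integral_inner_noise_nonneg (h : StochasticOracle K g 𝒟 G L σ σL ξ ξL) (hK : IsCompact K)
    (hc : Convex ℝ K) (hx₀ : x₀ ∈ K) (hD : ∀ x ∈ K, ∀ y ∈ K, ‖x - y‖ ≤ D) (hα : ∀ t, α t = t)
    (hmM : m ≤ M) {xs : EuclideanSpace ℝ (Fin d)} (hxs : xs ∈ K) (k : ℕ) (hk : k + 1 ≤ T) :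
    Integrable (fun ω : TrustedSpace d M T 𝒵 => ⟪ω.2.2 ⟨k, hk⟩,
        (trustedState K g α η m x₀ ω.1 ω.2.1 ω.2.2 k (Nat.le_of_succ_le hk)).w - xs⟫)
      (trustedMeasure m 𝒟 v) ∧
    0 ≤ ∫ ω : TrustedSpace d M T 𝒵, ⟪ω.2.2 ⟨k, hk⟩,
        (trustedState K g α η m x₀ ω.1 ω.2.1 ω.2.2 k (Nat.le_of_succ_le hk)).w - xs⟫
      ∂(trustedMeasure m 𝒟 v) := by
  have := isProbabilityMeasure_trustedMeasure (d := d) hmM 𝒟 v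
  have := isProbabilityMeasure_uniformOn_card hmM
  have hY : Measurable fun ω : TrustedSpace d M T 𝒵 => ω.2.2 ⟨k, hk⟩ :=
    (measurePreserving_trustedMeasure_noise (𝒟 := 𝒟) (v := v) hmM ⟨k, hk⟩).measurable
  have hw := (h.measurable_trustedState (α := α) (η := η) (m := m) hK hc hx₀ k
    (Nat.le_of_succ_le hk)).1
  have hint : Integrable (fun ω : TrustedSpace d M T 𝒵 => ⟪ω.2.2 ⟨k, hk⟩,
      (trustedState K g α η m x₀ ω.1 ω.2.1 ω.2.2 k (Nat.le_of_succ_le hk)).w - xs⟫)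
      (trustedMeasure m 𝒟 v) := by
    refine ((integrable_norm_sq_noise (𝒟 := 𝒟) (v := v) hmM ⟨k, hk⟩).add
      (integrable_const (D ^ 2))).mono' (hY.inner (hw.sub_const xs)).aestronglyMeasurable
      (.of_forall fun ω => ?_)
    have h1 := abs_real_inner_le_norm (ω.2.2 ⟨k, hk⟩)
      ((trustedState K g α η m x₀ ω.1 ω.2.1 ω.2.2 k (Nat.le_of_succ_le hk)).w - xs)
    have h2 := hD _ (trustedState_mem (grad := g) (η := η) (m := m) (S := ω.1) (sel := ω.2.1)
      (Y := ω.2.2) hK hc hx₀ hα k (Nat.le_of_succ_le hk)).1 xs hxs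
    simp only [Pi.add_apply, Real.norm_eq_abs]
    nlinarith [norm_nonneg (ω.2.2 ⟨k, hk⟩), sq_nonneg (‖ω.2.2 ⟨k, hk⟩‖ - D),
      norm_nonneg ((trustedState K g α η m x₀ ω.1 ω.2.1 ω.2.2 k (Nat.le_of_succ_le hk)).w - xs),
      sq_nonneg (‖ω.2.2 ⟨k, hk⟩‖ + D)]
  refine ⟨hint, ?_⟩
  have hres := (measurePreserving_resampleRound (d := d) hmM 𝒟 v ⟨k, hk⟩).integral_le_of_resample
    hint.neg (integrable_const 0) (by
      intro ω
      have hst := fun r : RoundSpace d M 𝒵 => trustedState_resampleRound (K := K) (g := g)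
        (α := α) (η := η) (m := m) (x₀ := x₀) ⟨k, hk⟩ (ω, r)
      simp only [Pi.neg_apply]
      have e : ∀ r : RoundSpace d M 𝒵, -⟪(resampleRound ⟨k, hk⟩ (ω, r)).2.2 ⟨k, hk⟩,
          (trustedState K g α η m x₀ (resampleRound ⟨k, hk⟩ (ω, r)).1
            (resampleRound ⟨k, hk⟩ (ω, r)).2.1 (resampleRound ⟨k, hk⟩ (ω, r)).2.2 k
            (Nat.le_of_succ_le hk)).w - xs⟫ =
          -⟪(trustedState K g α η m x₀ ω.1 ω.2.1 ω.2.2 k (Nat.le_of_succ_le hk)).w - xs,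
            r.2.2⟫ := by
        intro r
        rw [hst r, real_inner_comm]
        simp only [resampleRound, Function.update_self]
      simp_rw [e]
      have h3 : MeasurePreserving (fun r : RoundSpace d M 𝒵 => r.2.2)
          (roundMeasure d m 𝒟 (v ⟨k, hk⟩))
          (multivariateGaussian 0 (v ⟨k, hk⟩ • (1 : Matrix (Fin d) (Fin d) ℝ))) :=
        (measurePreserving_snd (μ := uniformOn {A : Finset (Fin M) | A.card = m})).comp
          (measurePreserving_snd (μ := Measure.pi 𝒟))
      have h4 := integral_map (μ := roundMeasure d m 𝒟 (v ⟨k, hk⟩))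
        h3.measurable.aemeasurable (f := fun y => ⟪(trustedState K g α η m x₀ ω.1 ω.2.1 ω.2.2 k
          (Nat.le_of_succ_le hk)).w - xs, y⟫) (by fun_prop)
      rw [integral_neg, ← h4, h3.map_eq, integral_inner (f := fun y => y) IsGaussian.integrable_id,
        integral_id_multivariateGaussian]
      simp)
  have h5 : ∫ ω, -⟪ω.2.2 ⟨k, hk⟩,
        (trustedState K g α η m x₀ ω.1 ω.2.1 ω.2.2 k (Nat.le_of_succ_le hk)).w - xs⟫
      ∂(trustedMeasure m 𝒟 v) ≤ 0 := by simpa using hres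
  rw [integral_neg] at h5
  linarith

lemma integral_norm_estimationError_le (h : StochasticOracle K g 𝒟 G L σ σL ξ ξL)
    (hK : IsCompact K) (hc : Convex ℝ K)
    (hx₀ : x₀ ∈ K) (hD : ∀ x ∈ K, ∀ y ∈ K, ‖x - y‖ ≤ D) (hα : ∀ t, α t = t) (hm : 1 ≤ m)
    (hmM : m ≤ M) (hL : 0 ≤ L) (hσ : 0 ≤ σ) (hσL : 0 ≤ σL) (hξ : 0 ≤ ξ) (hξL : 0 ≤ ξL)
    (k : ℕ) (hk : k ≤ T) :
    Integrable (fun ω : TrustedSpace d M T 𝒵 =>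
        ‖estimationError K g 𝒟 α η m x₀ ω.1 ω.2.1 ω.2.2 k hk‖) (trustedMeasure m 𝒟 v) ∧
    ∫ ω : TrustedSpace d M T 𝒵, ‖estimationError K g 𝒟 α η m x₀ ω.1 ω.2.1 ω.2.2 k hk‖
      ∂(trustedMeasure m 𝒟 v) ≤
      √(T * (((σ + 2 * σL * D) ^ 2 + (ξ + 2 * ξL * D) ^ 2) / m)) := by
  have := isProbabilityMeasure_trustedMeasure (d := d) hmM 𝒟 v
  obtain ⟨C, hC⟩ := h.exists_norm_estimationError_le (α := α) (η := η) (m := m) (x₀ := x₀) hα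
    (hm.trans hmM) k hk
  have hmeas := (h.measurable_estimationError (α := α) (η := η) (m := m) hK hc hx₀
    (hm.trans hmM) hL k hk).norm
  have hmem : MemLp (fun ω : TrustedSpace d M T 𝒵 =>
      ‖estimationError K g 𝒟 α η m x₀ ω.1 ω.2.1 ω.2.2 k hk‖) 2 (trustedMeasure m 𝒟 v) :=
    MemLp.of_bound hmeas.aestronglyMeasurable C (.of_forall fun ω => by simpa using hC ω)
  refine ⟨hmem.integrable one_le_two, Real.le_sqrt_of_sq_le ((sq_integral_norm_le hmem).trans
    ((h.integral_norm_estimationError_sq_le hK hc hx₀ hD hα hm hmM hL hσ hσL hξ hξL k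
      hk).2.trans ?_))⟩
  have : (k : ℝ) ≤ T := by exact_mod_cast hk
  gcongr

/-- The expected potential grows at most linearly. -/
lemma integral_potential_le (h : StochasticOracle K g 𝒟 G L σ σL ξ ξL)
    (hK : IsCompact K) (hc : Convex ℝ K)
    (hx₀ : x₀ ∈ K) (hD : ∀ x ∈ K, ∀ y ∈ K, ‖x - y‖ ≤ D) (hα : ∀ t, α t = t) (hm : 1 ≤ m)
    (hmM : m ≤ M) (hL : 0 ≤ L) (hσ : 0 ≤ σ) (hσL : 0 ≤ σL) (hξ : 0 ≤ ξ) (hξL : 0 ≤ ξL)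
    (hη : 0 < η) {v₀ : ℝ} (hv₀ : 0 ≤ v₀) (hv : ∀ t, v t = v₀) {Gs : ℝ}
    {F : EuclideanSpace ℝ (Fin d) → ℝ} (hF : Continuous F)
    (hF₁ : ∀ x ∈ K, ∀ y ∈ K, F y ≤ F x + ⟪globalGrad (meanGrad g 𝒟) x, y - x⟫ +
      L / 2 * ‖y - x‖ ^ 2)
    (hF₂ : ∀ x ∈ K, ∀ y ∈ K, F x + ⟪globalGrad (meanGrad g 𝒟) x, y - x⟫ ≤ F y)
    (hGs : ∀ x ∈ K, ‖globalGrad (meanGrad g 𝒟) x‖ ≤ Gs + L * D)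
    {xs : EuclideanSpace ℝ (Fin d)} (hxs : xs ∈ K) (k : ℕ) (hk : k ≤ T) :
    ((k : ℝ) + 1) * (k + 2) / 2 * (∫ ω : TrustedSpace d M T 𝒵,
        F (trustedState K g α η m x₀ ω.1 ω.2.1 ω.2.2 k hk).x ∂(trustedMeasure m 𝒟 v) - F xs) +
      (∫ ω : TrustedSpace d M T 𝒵,
        ‖(trustedState K g α η m x₀ ω.1 ω.2.1 ω.2.2 k hk).w - xs‖ ^ 2
          ∂(trustedMeasure m 𝒟 v)) / (2 * η) ≤
    (Gs + L * D) * D + D ^ 2 / (2 * η) + k * (Gs * D + 2 * L * D ^ 2 +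
      D * √(T * (((σ + 2 * σL * D) ^ 2 + (ξ + 2 * ξL * D) ^ 2) / m)) + η / 2 * (d * v₀)) := by
  have := isProbabilityMeasure_trustedMeasure (d := d) hmM 𝒟 v
  have hD0 : 0 ≤ D := by simpa using hD _ hx₀ _ hx₀
  induction k with
  | zero =>
    -- Before the first round the weight is α_{1:1} = 1, and convexity bounds the initial gap by
    -- gradient norm times diameter.
    have h1 := hF₂ x₀ hx₀ xs hxs
    have h2 := hD x₀ hx₀ xs hxs
    have h3 : -⟪globalGrad (meanGrad g 𝒟) x₀, xs - x₀⟫ ≤ (Gs + L * D) * D := by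
      refine (neg_le_abs _).trans ((abs_real_inner_le_norm _ _).trans ?_)
      rw [norm_sub_rev]
      exact mul_le_mul (hGs x₀ hx₀) h2 (norm_nonneg _) ((norm_nonneg _).trans (hGs x₀ hx₀))
    have h4 : ‖x₀ - xs‖ ^ 2 / (2 * η) ≤ D ^ 2 / (2 * η) := by gcongr
    simp only [trustedState, integral_const, probReal_univ, one_smul, Nat.cast_zero]
    linarith
  | succ k ih =>
    have hk' := Nat.le_of_succ_le hk
    have hD2 : Continuous fun w : EuclideanSpace ℝ (Fin d) => ‖w - xs‖ ^ 2 := by fun_prop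
    have ix := fun k hk => h.integrable_comp_query (η := η) (v := v) hK hc hx₀ hα hmM hF k hk
    have iw := fun k hk => h.integrable_comp_iterate (η := η) (v := v) hK hc hx₀ hα hmM hD2 k hk
    obtain ⟨iε, hε⟩ := h.integral_norm_estimationError_le (η := η) (v := v) hK hc hx₀ hD hα hm hmM
      hL hσ hσL hξ hξL (k + 1) hk
    obtain ⟨iY, hY⟩ := h.integral_inner_noise_nonneg (η := η) (v := v) hK hc hx₀ hD hα hmM hxs k hk
    have iN := integrable_norm_sq_noise (𝒟 := 𝒟) (v := v) (d := d) hmM ⟨k, hk⟩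
    have hN := integral_norm_sq_noise (𝒟 := 𝒟) (v := v) (d := d) hmM ⟨k, hk⟩
      (by rw [hv]; exact hv₀)
    rw [hv] at hN
    have j1 := fun (c : ℝ) k hk => ((ix k hk).sub (integrable_const (F xs))).const_mul c
    have j2 := fun k hk => (iw k hk).div_const (2 * η)
    have key := integral_mono (μ := trustedMeasure m 𝒟 v)
      ((j1 (((k : ℝ) + 2) * (k + 3) / 2) (k + 1) hk).add (j2 (k + 1) hk))
      ((((((j1 (((k : ℝ) + 1) * (k + 2) / 2) k hk').add (j2 k hk')).add
        (integrable_const (Gs * D + 2 * L * D ^ 2))).add (iε.const_mul D)).sub iY).add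
        (iN.const_mul (η / 2)))
      (fun ω => potential_succ_le (S := ω.1) (sel := ω.2.1) (Y := ω.2.2) hK hc hx₀ hα hη hL hD hF₁
        hF₂ hGs hxs hk)
    rw [integral_add' (j1 _ _ hk) (j2 _ hk),
      integral_add' (((((j1 _ k hk').add (j2 k hk')).add
        (integrable_const _)).add (iε.const_mul D)).sub iY) (iN.const_mul (η / 2)),
      integral_sub' ((((j1 _ k hk').add (j2 k hk')).add
        (integrable_const _)).add (iε.const_mul D)) iY,
      integral_add' (((j1 _ k hk').add (j2 k hk')).add (integrable_const _)) (iε.const_mul D),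
      integral_add' ((j1 _ k hk').add (j2 k hk')) (integrable_const _),
      integral_add' (j1 _ k hk') (j2 k hk')] at key
    simp only [integral_const_mul, integral_div, Pi.sub_apply] at key
    rw [integral_sub (ix _ hk) (integrable_const _), integral_sub (ix _ hk') (integrable_const _)]
      at key
    simp only [integral_const, probReal_univ, one_smul] at key
    rw [hN] at key
    have ih := ih hk'
    have hε' := mul_le_mul_of_nonneg_left hε hD0
    push_cast
    have e : ((k : ℝ) + 1 + 1) * (k + 1 + 2) / 2 = (k + 2) * (k + 3) / 2 := by ring
    rw [e]
    linarith

end StochasticOracle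

end ExpectedPotential

/-! ### The rate of convergence -/

section Rate

/-- Multiply by 2/(T(T+1)) ≤ 2/T². The smoothness terms LD² (1 + 2T + 2(T-1)) ≤ 4T LD² force the
factor 4D; the gradient, error and noise terms fit inside it with room to spare. -/
lemma le_rate_of_weighted_le {T D G L A N X : ℝ} (hT : 1 ≤ T) (hD : 0 ≤ D) (hG : 0 ≤ G)
    (hL : 0 ≤ L) (hA : 0 ≤ A) (hN : 0 ≤ N)
    (h : T * (T + 1) / 2 * X ≤ (G + L * D) * D + (D * N * T + 2 * L * T * D ^ 2) +
      (T - 1) * (G * D + 2 * L * D ^ 2 + D * A) + D * N * T) :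
    X ≤ 4 * D * ((G + 2 * L * D) / T + A / T + 2 * N / T) := by
  have hT0 : 0 < T := by linarith
  have e : 4 * D * ((G + 2 * L * D) / T + A / T + 2 * N / T) =
      4 * D * (G + 2 * L * D + A + 2 * N) / T := by ring
  rw [e, le_div_iff₀ hT0]
  by_contra! hX
  have hW : 0 ≤ 4 * D * (G + 2 * L * D + A + 2 * N) := by positivity
  have hX0 : 0 ≤ X := by
    by_contra! hneg
    nlinarith
  have h1 : T * (T * X) ≤ T * (4 * D * (G + 2 * L * D + A + 2 * N)) := by
    have h2 : 0 ≤ T * X := by positivity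
    have h3 : 0 ≤ L * D ^ 2 := by positivity
    have h4 : 0 ≤ T * (D * G) := by positivity
    have h5 : 0 ≤ T * (D * A) := by positivity
    have h6 : 0 ≤ T * (D * N) := by positivity
    have h7 : 0 ≤ D * A := by positivity
    nlinarith
  have h8 := le_of_mul_le_mul_left h1 hT0
  linarith

/-- D²/(2η) is the larger of the values at the two candidates for η, hence at most their sum. -/
lemma sq_div_step_le {ρ D S T L η m r : ℝ} (hρ : 0 < ρ) (hD : 0 < D) (hS : 0 < S) (hT : 0 < T)
    (hL : 0 < L) (hm : 0 < m) (hr : 0 < r)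
    (hη : η = min (ρ * D * m / (2 * S * T * r)) (1 / (4 * L * T))) :
    0 < η ∧ D ^ 2 / (2 * η) ≤ D * (S * r / (ρ * m)) * T + 2 * L * T * D ^ 2 := by
  have ha : D ^ 2 / (2 * (ρ * D * m / (2 * S * T * r))) = D * (S * r / (ρ * m)) * T := by
    field_simp
  have hb : D ^ 2 / (2 * (1 / (4 * L * T))) = 2 * L * T * D ^ 2 := by
    field_simp
    norm_num
  refine ⟨by rw [hη]; positivity, ?_⟩
  rcases min_choice (ρ * D * m / (2 * S * T * r)) (1 / (4 * L * T)) with h | h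
  · rw [hη, h, ha]
    have : 0 ≤ 2 * L * T * D ^ 2 := by positivity
    linarith
  · rw [hη, h, hb]
    have : 0 ≤ D * (S * r / (ρ * m)) * T := by positivity
    linarith

variable {d M m T : ℕ} {𝒵 : Fin M → Type*} [∀ i, MeasurableSpace (𝒵 i)]
  {K : Set (EuclideanSpace ℝ (Fin d))}
  {g : ∀ i, 𝒵 i → EuclideanSpace ℝ (Fin d) → EuclideanSpace ℝ (Fin d)}
  {𝒟 : ∀ i, Measure (𝒵 i)} [∀ i, IsProbabilityMeasure (𝒟 i)]
  {x₀ : EuclideanSpace ℝ (Fin d)} {α : ℕ → ℝ} {η G L D ρ S σ σL ξ ξL : ℝ} {v : Fin T → ℝ}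

/-- The excess loss of the trusted-server algorithm for a stochastic oracle. -/
theorem StochasticOracle.integral_query_sub_le (h : StochasticOracle K g 𝒟 G L σ σL ξ ξL)
    (hK : IsCompact K) (hc : Convex ℝ K)
    (hx₀ : x₀ ∈ K) (hD : ∀ x ∈ K, ∀ y ∈ K, ‖x - y‖ ≤ D) (hα : ∀ t, α t = t) (hd : 1 ≤ d)
    (hm : 1 ≤ m) (hmM : m ≤ M) (hT : 1 ≤ T) (hD0 : 0 < D) (hL : 0 < L) (hρ : 0 < ρ) (hS : 0 < S)
    (hσ : 0 ≤ σ) (hσL : 0 ≤ σL) (hξ : 0 ≤ ξ) (hξL : 0 ≤ ξL)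
    (hη : η = min (ρ * D * m / (2 * S * T * √d)) (1 / (4 * L * T)))
    (hv : ∀ t, v t = 4 * S ^ 2 * T / (ρ ^ 2 * m ^ 2)) {Gs : ℝ} (hGs0 : 0 ≤ Gs)
    {F : EuclideanSpace ℝ (Fin d) → ℝ} (hF : Continuous F)
    (hF₁ : ∀ x ∈ K, ∀ y ∈ K, F y ≤ F x + ⟪globalGrad (meanGrad g 𝒟) x, y - x⟫ +
      L / 2 * ‖y - x‖ ^ 2)
    (hF₂ : ∀ x ∈ K, ∀ y ∈ K, F x + ⟪globalGrad (meanGrad g 𝒟) x, y - x⟫ ≤ F y)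
    (hGs : ∀ x ∈ K, ‖globalGrad (meanGrad g 𝒟) x‖ ≤ Gs + L * D)
    {xs : EuclideanSpace ℝ (Fin d)} (hxs : xs ∈ K) (hT' : T - 1 ≤ T) :
    ∫ ω : TrustedSpace d M T 𝒵,
        F (trustedState K g α η m x₀ ω.1 ω.2.1 ω.2.2 (T - 1) hT').x
          ∂(trustedMeasure m 𝒟 v) - F xs ≤
      4 * D * ((Gs + 2 * L * D) / T
          + √((σ + 2 * σL * D) ^ 2 + (ξ + 2 * ξL * D) ^ 2) / √(m * T)
          + 2 * S * √d / (ρ * m * T)) := by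
  have hm0 : (0 : ℝ) < m := by exact_mod_cast hm
  have hT0 : (0 : ℝ) < T := by exact_mod_cast hT
  have hT1 : (1 : ℝ) ≤ T := by exact_mod_cast hT
  have hr : (0 : ℝ) < √d := Real.sqrt_pos.2 (by exact_mod_cast hd)
  have hrd : √(d : ℝ) ^ 2 = d := Real.sq_sqrt (Nat.cast_nonneg d)
  obtain ⟨hη0, hη1⟩ := sq_div_step_le hρ hD0 hS hT0 hL hm0 hr hη
  -- The output x_T is the query point after T - 1 rounds, so the last round does not count.
  have key := h.integral_potential_le (v := v) hK hc hx₀ hD hα hm hmM hL.le hσ hσL hξ hξL hη0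
    (by positivity) hv hF hF₁ hF₂ hGs hxs (T - 1) hT'
  rw [Nat.cast_sub hT, Nat.cast_one] at key
  set c := (σ + 2 * σL * D) ^ 2 + (ξ + 2 * ξL * D) ^ 2 with hcdef
  set X := ∫ ω : TrustedSpace d M T 𝒵,
        F (trustedState K g α η m x₀ ω.1 ω.2.1 ω.2.2 (T - 1) hT').x
          ∂(trustedMeasure m 𝒟 v) - F xs with hX
  -- The first entry of the minimum defining η balances the accumulated noise against D²/(2η).
  have hnoise : η / 2 * (d * (4 * S ^ 2 * T / (ρ ^ 2 * m ^ 2))) ≤ D * (S * √d / (ρ * m)) := by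
    have h1 : η ≤ ρ * D * m / (2 * S * T * √d) := hη.le.trans (min_le_left _ _)
    calc η / 2 * (d * (4 * S ^ 2 * T / (ρ ^ 2 * m ^ 2)))
        ≤ ρ * D * m / (2 * S * T * √d) / 2 * (d * (4 * S ^ 2 * T / (ρ ^ 2 * m ^ 2))) := by
          gcongr
      _ = D * (S * √d / (ρ * m)) := by
          rw [← hrd]
          simp only [Real.sqrt_sq hr.le]
          field_simp
          norm_num
  have hnoise' : ((T : ℝ) - 1) * (η / 2 * (d * (4 * S ^ 2 * T / (ρ ^ 2 * m ^ 2)))) ≤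
      D * (S * √d / (ρ * m)) * T := by
    have h2 : ((T : ℝ) - 1) * (η / 2 * (d * (4 * S ^ 2 * T / (ρ ^ 2 * m ^ 2)))) ≤
        T * (D * (S * √d / (ρ * m))) := by
      gcongr
      linarith
    linarith
  have hw : 0 ≤ (∫ ω : TrustedSpace d M T 𝒵,
      ‖(trustedState K g α η m x₀ ω.1 ω.2.1 ω.2.2 (T - 1) hT').w - xs‖ ^ 2
        ∂(trustedMeasure m 𝒟 v)) / (2 * η) := by
    have : 0 ≤ ∫ ω : TrustedSpace d M T 𝒵,
      ‖(trustedState K g α η m x₀ ω.1 ω.2.1 ω.2.2 (T - 1) hT').w - xs‖ ^ 2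
        ∂(trustedMeasure m 𝒟 v) := integral_nonneg fun ω => by positivity
    positivity
  have hA : √c / √(m * T) = √(T * (c / m)) / T := by
    rw [← Real.sqrt_div' _ (by positivity), eq_div_iff hT0.ne']
    nth_rewrite 2 [← Real.sqrt_sq hT0.le]
    rw [← Real.sqrt_mul' _ (by positivity)]
    congr 1
    field_simp
  have hN : 2 * S * √d / (ρ * m * T) = 2 * (S * √d / (ρ * m)) / T := by field_simp
  rw [hA, hN]
  refine le_rate_of_weighted_le hT1 hD0.le hGs0 hL.le (Real.sqrt_nonneg _) (by positivity) ?_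
  have e : ((T : ℝ) - 1 + 1) * (T - 1 + 2) / 2 = T * (T + 1) / 2 := by ring
  rw [e] at key
  linarith

end Rate

/-! ### The population objective -/

section Objective

variable {E : Type*} [NormedAddCommGroup E] {M : ℕ}
  {𝒵 : Fin M → Type*} [∀ i, MeasurableSpace (𝒵 i)] {f : ∀ i, 𝒵 i → E → ℝ}
  {𝒟 : ∀ i, Measure (𝒵 i)} {gradLoc : Fin M → E → E} {K : Set E} {G : ℝ}

lemma abs_localLoss_sub_le [∀ i, IsProbabilityMeasure (𝒟 i)]
    (hLip : ∀ i z, ∀ x ∈ K, ∀ y ∈ K, |f i z x - f i z y| ≤ G * ‖x - y‖)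
    (hfi : ∀ i, ∀ x ∈ K, Integrable (fun z => f i z x) (𝒟 i)) (i : Fin M) {x y : E}
    (hx : x ∈ K) (hy : y ∈ K) :
    |localLoss f 𝒟 i x - localLoss f 𝒟 i y| ≤ G * ‖x - y‖ := by
  rw [localLoss, localLoss, ← integral_sub (hfi i x hx) (hfi i y hy), ← Real.norm_eq_abs]
  refine (norm_integral_le_of_norm_le_const (C := G * ‖x - y‖)
    (.of_forall fun z => hLip i z x hx y hy)).trans (by simp)

variable [InnerProductSpace ℝ E]

/-- The first-order remainder of f is the average of the local remainders, so smoothness and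
convexity inequalities pass from the machines to f. -/
lemma globalLoss_sub_sub_inner (x y : E) :
    globalLoss f 𝒟 y - globalLoss f 𝒟 x - ⟪globalGrad gradLoc x, y - x⟫ =
      (M : ℝ)⁻¹ * ∑ i, (localLoss f 𝒟 i y - localLoss f 𝒟 i x - ⟪gradLoc i x, y - x⟫) := by
  rw [globalLoss, globalLoss, globalGrad, inner_smul_left, sum_inner, Finset.sum_sub_distrib,
    Finset.sum_sub_distrib]
  simp only [conj_trivial]
  ring

lemma globalLoss_le_of_localLoss_le (hM : 1 ≤ M) {x y : E} {C : ℝ}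
    (h : ∀ i, localLoss f 𝒟 i y - localLoss f 𝒟 i x - ⟪gradLoc i x, y - x⟫ ≤ C) :
    globalLoss f 𝒟 y ≤ globalLoss f 𝒟 x + ⟪globalGrad gradLoc x, y - x⟫ + C := by
  have hM0 : (0 : ℝ) < M := by exact_mod_cast hM
  have h1 := globalLoss_sub_sub_inner (f := f) (𝒟 := 𝒟) (gradLoc := gradLoc) x y
  have h2 : (M : ℝ)⁻¹ * ∑ i, (localLoss f 𝒟 i y - localLoss f 𝒟 i x - ⟪gradLoc i x, y - x⟫) ≤
      C := by
    rw [inv_mul_le_iff₀ hM0]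
    refine (Finset.sum_le_sum fun i _ => h i).trans ?_
    simp
  linarith

lemma le_globalLoss_of_le_localLoss {x y : E}
    (h : ∀ i, localLoss f 𝒟 i x + ⟪gradLoc i x, y - x⟫ ≤ localLoss f 𝒟 i y) :
    globalLoss f 𝒟 x + ⟪globalGrad gradLoc x, y - x⟫ ≤ globalLoss f 𝒟 y := by
  have h1 := globalLoss_sub_sub_inner (f := f) (𝒟 := 𝒟) (gradLoc := gradLoc) x y
  have h2 : 0 ≤ (M : ℝ)⁻¹ * ∑ i, (localLoss f 𝒟 i y - localLoss f 𝒟 i x -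
      ⟪gradLoc i x, y - x⟫) :=
    mul_nonneg (by positivity) (Finset.sum_nonneg fun i _ => by linarith [h i])
  linarith

lemma globalGrad_eq_map {M : ℕ} {gradLoc γ : Fin M → E → E} {x : E} {p : E →L[ℝ] E}
    (h : ∀ i, γ i x = p (gradLoc i x)) : globalGrad γ x = p (globalGrad gradLoc x) := by
  simp only [globalGrad, map_smul, map_sum, h]

/-- Lipschitz bounds hold on K only; precomposing with the projection gives a continuous function on
the whole space that agrees with f at all query points. -/
lemma continuous_globalLoss_projOn [∀ i, IsProbabilityMeasure (𝒟 i)] (hK : IsCompact K)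
    (hc : Convex ℝ K) (hne : K.Nonempty)
    (hLip : ∀ i z, ∀ x ∈ K, ∀ y ∈ K, |f i z x - f i z y| ≤ G * ‖x - y‖)
    (hfi : ∀ i, ∀ x ∈ K, Integrable (fun z => f i z x) (𝒟 i)) :
    Continuous fun x => globalLoss f 𝒟 (projOn K x) := by
  have h1 : ∀ i, ContinuousOn (localLoss f 𝒟 i) K := fun i =>
    (LipschitzOnWith.of_dist_le_mul (K := G.toNNReal) fun x hx y hy => by
      rw [Real.dist_eq, dist_eq_norm]
      refine (abs_localLoss_sub_le hLip hfi i hx hy).trans ?_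
      gcongr
      exact Real.le_coe_toNNReal G).continuousOn
  have h2 : ContinuousOn (globalLoss f 𝒟) K :=
    continuousOn_const.mul (continuousOn_finsetSum _ fun i _ => h1 i)
  exact h2.comp_continuous (continuous_projOn hK hc hne) fun x => projOn_mem hK hne x

end Objective

/-! ### Tangential gradients as a stochastic oracle for the population objective -/

section Population

variable {E : Type*} [NormedAddCommGroup E] [InnerProductSpace ℝ E] [FiniteDimensional ℝ E]
  {K : Set E}

lemma HasGradientWithinAt.of_abs_sub_le {φ : E → ℝ} {u x : E} {C : ℝ}
    (h : ∀ y ∈ K, |φ y - φ x - ⟪u, y - x⟫| ≤ C * ‖y - x‖ ^ 2) :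
    HasGradientWithinAt φ u K x := by
  rw [hasGradientWithinAt_iff_isLittleO]
  have h1 : (fun y => φ y - φ x - ⟪u, y - x⟫) =O[nhdsWithin x K] fun y => ‖y - x‖ ^ 2 := by
    refine Asymptotics.IsBigO.of_bound C ?_
    filter_upwards [self_mem_nhdsWithin] with y hy
    simpa using h y hy
  exact h1.trans_isLittleO
    ((Asymptotics.isLittleO_pow_sub_sub x one_lt_two).mono nhdsWithin_le_nhds)

lemma tangentProj_tangentProj {x : E} (hx : x ∈ K) (v : E) :
    tangentProj K (tangentProj K v) = tangentProj K v :=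
  tangentProj_eq_of_inner_eq hx fun _ hy => inner_tangentProj v hy hx

lemma abs_sub_sub_inner_le_of_smooth {φ : E → ℝ} {g : E → E} {L : ℝ} (hc : Convex ℝ K)
    (h : ∀ x ∈ K, HasGradientWithinAt φ (g x) K x)
    (hS : ∀ x ∈ K, ∀ y ∈ K, ‖g x - g y‖ ≤ L * ‖x - y‖) {x y : E} (hx : x ∈ K) (hy : y ∈ K) :
    |φ y - φ x - ⟪g x, y - x⟫| ≤ L / 2 * ‖y - x‖ ^ 2 := by
  have h1 := le_add_inner_add_sq_of_smooth hc h hS hx hy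
  -- The lower bound is the descent lemma for -φ.
  have h2 := le_add_inner_add_sq_of_smooth (φ := fun x => -φ x) (g := fun x => -g x) (L := L) hc
    (fun x hx => by
      rw [hasGradientWithinAt_iff_hasFDerivWithinAt, map_neg]
      exact (h x hx).hasFDerivWithinAt.neg)
    (fun x hx y hy => by rw [← norm_neg]; simpa [sub_eq_neg_add, add_comm] using hS x hx y hy)
    hx hy
  rw [inner_neg_left] at h2
  rw [abs_le]
  constructor <;> linarith

variable {M : ℕ} {𝒵 : Fin M → Type*} {f : ∀ i, 𝒵 i → E → ℝ} {grad : ∀ i, 𝒵 i → E → E}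
  {G L : ℝ}

lemma tangentGrad_of_mem (hK : IsCompact K) (hc : Convex ℝ K) {x : E} (hx : x ∈ K) (i : Fin M)
    (z : 𝒵 i) : tangentGrad K grad i z x = tangentProj K (grad i z x) := by
  rw [tangentGrad, projOn_of_mem hK hc hx]

variable [MeasurableSpace E] [BorelSpace E] [∀ i, MeasurableSpace (𝒵 i)]

/-- Carathéodory functions are jointly measurable: the extended gradient is continuous in x and
measurable in z. -/
lemma measurable_tangentGrad (hK : IsCompact K) (hc : Convex ℝ K) (hne : K.Nonempty) (hL : 0 ≤ L)
    (hSmooth : ∀ i z, ∀ x ∈ K, ∀ y ∈ K, ‖grad i z x - grad i z y‖ ≤ L * ‖x - y‖)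
    (hgm : ∀ i, ∀ x ∈ K, Measurable fun z => grad i z x) (i : Fin M) :
    Measurable fun p : 𝒵 i × E => tangentGrad K grad i p.1 p.2 := by
  have h1 : Measurable (Function.uncurry fun (x : E) (z : 𝒵 i) => tangentGrad K grad i z x) :=
    measurable_uncurry_of_continuous_of_measurable
      (fun z => (LipschitzWith.of_dist_le_mul (K := L.toNNReal) fun x y => by
        simpa [dist_eq_norm, Real.coe_toNNReal _ hL] using
          norm_tangentGrad_sub_le hK hc hne hL hSmooth i z x y).continuous)
      (fun x => (tangentProj K).continuous.measurable.comp (hgm i _ (projOn_mem hK hne x)))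
  exact h1.comp measurable_swap

/-- The moment hypotheses are lower Lebesgue integrals, which rules out the value 0 that a Bochner
integral takes when the integrand is not integrable. The tangential part can only be smaller. -/
lemma integral_norm_tangentProj_sq_le {X : Type*} [MeasurableSpace X] {μ : Measure X} {u : X → E}
    (hu : Measurable u) {B : ℝ} (hB : 0 ≤ B)
    (h : ∫⁻ z, ENNReal.ofReal (‖u z‖ ^ 2) ∂μ ≤ ENNReal.ofReal B) :
    ∫ z, ‖tangentProj K (u z)‖ ^ 2 ∂μ ≤ B := by
  have hm : Measurable fun z => ‖tangentProj K (u z)‖ ^ 2 :=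
    ((tangentProj K).continuous.measurable.comp hu).norm.pow_const 2
  rw [integral_eq_lintegral_of_nonneg_ae (.of_forall fun z => by positivity)
    hm.aestronglyMeasurable]
  refine ENNReal.toReal_le_of_le_ofReal hB (le_trans (lintegral_mono fun z => ?_) h)
  gcongr
  exact norm_tangentProj_le _

variable {𝒟 : ∀ i, Measure (𝒵 i)} {gradLoc : Fin M → E → E}

/-- The tangential gradients of the samples form a stochastic oracle. -/
lemma stochasticOracle_tangentGrad (hK : IsCompact K) (hc : Convex ℝ K) (hne : K.Nonempty)
    (hG : 0 ≤ G) (hL : 0 ≤ L)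
    (hgrad : ∀ i z, ∀ x ∈ K, HasGradientWithinAt (f i z) (grad i z x) K x)
    (hLip : ∀ i z, ∀ x ∈ K, ∀ y ∈ K, |f i z x - f i z y| ≤ G * ‖x - y‖)
    (hSmooth : ∀ i z, ∀ x ∈ K, ∀ y ∈ K, ‖grad i z x - grad i z y‖ ≤ L * ‖x - y‖)
    (hgm : ∀ i, ∀ x ∈ K, Measurable fun z => grad i z x)
    (hmean : ∀ i, ∀ x ∈ K, meanGrad (tangentGrad K grad) 𝒟 i x = tangentProj K (gradLoc i x))
    {σ σL ξ ξL : ℝ}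
    (hσ : ∀ i, ∀ x ∈ K,
      ∫⁻ z, ENNReal.ofReal (‖grad i z x - gradLoc i x‖ ^ 2) ∂(𝒟 i) ≤ ENNReal.ofReal (σ ^ 2))
    (hσL : ∀ i, ∀ x ∈ K, ∀ y ∈ K,
      ∫⁻ z, ENNReal.ofReal
          (‖(grad i z x - gradLoc i x) - (grad i z y - gradLoc i y)‖ ^ 2) ∂(𝒟 i)
        ≤ ENNReal.ofReal (σL ^ 2 * ‖x - y‖ ^ 2))
    (hξ : ∀ x ∈ K, (M : ℝ)⁻¹ * ∑ i, ‖gradLoc i x - globalGrad gradLoc x‖ ^ 2 ≤ ξ ^ 2)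
    (hξL : ∀ x ∈ K, ∀ y ∈ K,
      (M : ℝ)⁻¹ * ∑ i, ‖(gradLoc i x - globalGrad gradLoc x)
          - (gradLoc i y - globalGrad gradLoc y)‖ ^ 2 ≤ ξL ^ 2 * ‖x - y‖ ^ 2) :
    StochasticOracle K (tangentGrad K grad) 𝒟 G L σ σL ξ ξL := by
  have hglob : ∀ x ∈ K, globalGrad (meanGrad (tangentGrad K grad) 𝒟) x =
      tangentProj K (globalGrad gradLoc x) := fun x hx =>
    globalGrad_eq_map fun i => hmean i x hx
  refine ⟨measurable_tangentGrad hK hc hne hL hSmooth hgm, fun i z x =>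
    norm_tangentProj_gradient_le hG hc (hgrad i z) (hLip i z) (hSmooth i z)
      (projOn_mem hK hne x), norm_tangentGrad_sub_le hK hc hne hL hSmooth, fun i x hx => ?_,
    fun i x hx y hy => ?_, fun x hx => ?_, fun x hx y hy => ?_⟩
  · simp_rw [hmean i x hx, tangentGrad_of_mem hK hc hx, ← map_sub]
    exact integral_norm_tangentProj_sq_le ((hgm i x hx).sub_const _) (sq_nonneg σ) (hσ i x hx)
  · simp_rw [hmean i x hx, hmean i y hy, tangentGrad_of_mem hK hc hx, tangentGrad_of_mem hK hc hy,
      ← map_sub]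
    refine integral_norm_tangentProj_sq_le
      (((hgm i x hx).sub_const _).sub ((hgm i y hy).sub_const _)) (by positivity) ?_
    rw [mul_pow]
    exact hσL i x hx y hy
  · simp_rw [hglob x hx, hmean _ x hx, ← map_sub]
    refine le_trans ?_ (hξ x hx)
    gcongr
    exact norm_tangentProj_le _
  · simp_rw [hglob x hx, hglob y hy, hmean _ x hx, hmean _ y hy, ← map_sub]
    rw [mul_pow]
    refine le_trans ?_ (hξL x hx y hy)
    gcongr
    exact norm_tangentProj_le _

variable [∀ i, IsProbabilityMeasure (𝒟 i)]

lemma integrable_tangentGrad (hK : IsCompact K) (hc : Convex ℝ K) (hne : K.Nonempty)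
    (hG : 0 ≤ G) (hL : 0 ≤ L)
    (hgrad : ∀ i z, ∀ x ∈ K, HasGradientWithinAt (f i z) (grad i z x) K x)
    (hLip : ∀ i z, ∀ x ∈ K, ∀ y ∈ K, |f i z x - f i z y| ≤ G * ‖x - y‖)
    (hSmooth : ∀ i z, ∀ x ∈ K, ∀ y ∈ K, ‖grad i z x - grad i z y‖ ≤ L * ‖x - y‖)
    (hgm : ∀ i, ∀ x ∈ K, Measurable fun z => grad i z x) (i : Fin M) (x : E) :
    Integrable (fun z => tangentGrad K grad i z x) (𝒟 i) :=
  integrable_of_norm_le ((measurable_tangentGrad hK hc hne hL hSmooth hgm i).comp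
    (measurable_id.prodMk measurable_const)).aestronglyMeasurable
    fun z => norm_tangentProj_gradient_le hG hc (hgrad i z) (hLip i z) (hSmooth i z)
      (projOn_mem hK hne x)

/-- The first-order expansion of the local objectives. -/
lemma abs_localLoss_sub_sub_inner_le (hK : IsCompact K) (hc : Convex ℝ K) (hG : 0 ≤ G)
    (hL : 0 ≤ L) (hgrad : ∀ i z, ∀ x ∈ K, HasGradientWithinAt (f i z) (grad i z x) K x)
    (hLip : ∀ i z, ∀ x ∈ K, ∀ y ∈ K, |f i z x - f i z y| ≤ G * ‖x - y‖)
    (hSmooth : ∀ i z, ∀ x ∈ K, ∀ y ∈ K, ‖grad i z x - grad i z y‖ ≤ L * ‖x - y‖)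
    (hgm : ∀ i, ∀ x ∈ K, Measurable fun z => grad i z x)
    (hfi : ∀ i, ∀ x ∈ K, Integrable (fun z => f i z x) (𝒟 i)) (i : Fin M) {x y : E}
    (hx : x ∈ K) (hy : y ∈ K) :
    |localLoss f 𝒟 i y - localLoss f 𝒟 i x - ⟪meanGrad (tangentGrad K grad) 𝒟 i x, y - x⟫| ≤
      L / 2 * ‖y - x‖ ^ 2 := by
  have hgi := integrable_tangentGrad (𝒟 := 𝒟) hK hc ⟨x, hx⟩ hG hL hgrad hLip hSmooth hgm i x
  have e : localLoss f 𝒟 i y - localLoss f 𝒟 i x -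
      ⟪meanGrad (tangentGrad K grad) 𝒟 i x, y - x⟫ =
      ∫ z, (f i z y - f i z x - ⟪y - x, tangentGrad K grad i z x⟫) ∂(𝒟 i) := by
    have h1 : Integrable (fun z => f i z y - f i z x) (𝒟 i) := (hfi i y hy).sub (hfi i x hx)
    rw [integral_sub h1 (hgi.const_inner _), integral_sub (hfi i y hy) (hfi i x hx),
      integral_inner hgi, real_inner_comm]
    rfl
  rw [e, ← Real.norm_eq_abs]
  refine (norm_integral_le_of_norm_le_const (C := L / 2 * ‖y - x‖ ^ 2)
    (.of_forall fun z => ?_)).trans (by simp)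
  rw [Real.norm_eq_abs, tangentGrad_of_mem hK hc hx, real_inner_comm, inner_tangentProj _ hy hx]
  exact abs_sub_sub_inner_le_of_smooth hc (hgrad i z) (hSmooth i z) hx hy

/-- The mean of the tangential gradients is the tangential gradient of the local objective. -/
lemma meanGrad_tangentGrad_eq (hK : IsCompact K) (hc : Convex ℝ K) (hG : 0 ≤ G)
    (hL : 0 ≤ L) (hgrad : ∀ i z, ∀ x ∈ K, HasGradientWithinAt (f i z) (grad i z x) K x)
    (hLip : ∀ i z, ∀ x ∈ K, ∀ y ∈ K, |f i z x - f i z y| ≤ G * ‖x - y‖)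
    (hSmooth : ∀ i z, ∀ x ∈ K, ∀ y ∈ K, ‖grad i z x - grad i z y‖ ≤ L * ‖x - y‖)
    (hgm : ∀ i, ∀ x ∈ K, Measurable fun z => grad i z x)
    (hfi : ∀ i, ∀ x ∈ K, Integrable (fun z => f i z x) (𝒟 i)) (i : Fin M) {x u : E}
    (hx : x ∈ K) (hu : HasGradientWithinAt (localLoss f 𝒟 i) u K x) :
    meanGrad (tangentGrad K grad) 𝒟 i x = tangentProj K u := by
  -- Integrating the uniform quadratic remainder shows that the mean tangential gradient is a
  -- gradient of the local loss within K, which replaces differentiation under the integral. Two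
  -- such gradients agree along the directions of K, and the mean is already tangential.
  have h1 : HasGradientWithinAt (localLoss f 𝒟 i) (meanGrad (tangentGrad K grad) 𝒟 i x) K x :=
    .of_abs_sub_le fun y hy => abs_localLoss_sub_sub_inner_le hK hc hG hL hgrad hLip hSmooth hgm
      hfi i hx hy
  have h2 : tangentProj K (meanGrad (tangentGrad K grad) 𝒟 i x) =
      meanGrad (tangentGrad K grad) 𝒟 i x := by
    unfold meanGrad
    rw [← (tangentProj K).integral_comp_comm
      (integrable_tangentGrad hK hc ⟨x, hx⟩ hG hL hgrad hLip hSmooth hgm i x)]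
    simp only [tangentGrad, tangentProj_tangentProj hx]
  rw [← h2]
  exact tangentProj_eq_of_inner_eq hx fun y hy => h1.inner_eq hc hu hx hy

end Population

end

/-! ### Assembly of the privacy guarantee and the excess-loss bound -/

theorem mainTheorem3 {d M m T : ℕ} (hd : 1 ≤ d) (hm : 1 ≤ m) (hmM : m ≤ M) (hT : 1 ≤ T)
    {D G L ρ : ℝ} (hD : 0 < D) (hG : 0 < G) (hL : 0 < L) (hρ : 0 < ρ)
    -- the domain
    (K : Set (EuclideanSpace ℝ (Fin d))) (hK_compact : IsCompact K) (hK_convex : Convex ℝ K)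
    (hK_diam : ∀ x ∈ K, ∀ y ∈ K, ‖x - y‖ ≤ D)
    (x₀ : EuclideanSpace ℝ (Fin d)) (hx₀ : x₀ ∈ K)
    -- the losses `f i z x = f_i(x; z)` and their gradients `grad i z x = ∇f_i(x; z)` on `K`
    {𝒵 : Fin M → Type*} [∀ i, MeasurableSpace (𝒵 i)]
    (f : ∀ i, 𝒵 i → EuclideanSpace ℝ (Fin d) → ℝ)
    (grad : ∀ i, 𝒵 i → EuclideanSpace ℝ (Fin d) → EuclideanSpace ℝ (Fin d))
    (hgrad : ∀ i z, ∀ x ∈ K, HasGradientWithinAt (f i z) (grad i z x) K x)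
    (hLip : ∀ i z, ∀ x ∈ K, ∀ y ∈ K, |f i z x - f i z y| ≤ G * ‖x - y‖)
    (hSmooth : ∀ i z, ∀ x ∈ K, ∀ y ∈ K, ‖grad i z x - grad i z y‖ ≤ L * ‖x - y‖)
    -- the parameters of the algorithm
    (S η : ℝ) (hS : S = G + 2 * L * D)
    (hη : η = min (ρ * D * m / (2 * S * T * √d)) (1 / (4 * L * T)))
    (α : ℕ → ℝ) (hα : ∀ t, α t = t)
    (v : Fin T → ℝ) (hv : ∀ t, v t = 4 * S ^ 2 * T / (ρ ^ 2 * m ^ 2)) :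
    -- privacy of the query points, for any (possibly random) choice of subsets of size `m`
    (∀ ν : Measure (Fin T → Finset (Fin M)), IsProbabilityMeasure ν →
      (∀ᵐ sel ∂ν, ∀ t, (sel t).card = m) →
      IsZCDP (fun Dat : FedDataset T 𝒵 => trustedLaw K grad α η m v x₀ ν Dat) 0 (ρ ^ 2 / 2)) ∧
    -- excess loss of the output `x_T` for i.i.d. data and i.i.d. uniform subsets of size `m`
    (∀ 𝒟 : ∀ i, Measure (𝒵 i), (∀ i, IsProbabilityMeasure (𝒟 i)) →
      (∀ i, ∀ x ∈ K, Measurable fun z => f i z x) →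
      (∀ i, ∀ x ∈ K, Measurable fun z => grad i z x) →
      (∀ i, ∀ x ∈ K, Integrable (fun z => f i z x) (𝒟 i)) →
      (∀ i, ConvexOn ℝ K (localLoss f 𝒟 i)) →
      -- the gradients `gradLoc i x = ∇f_i(x)` of the local objectives on `K`
      ∀ gradLoc : Fin M → EuclideanSpace ℝ (Fin d) → EuclideanSpace ℝ (Fin d),
      (∀ i, ∀ x ∈ K, HasGradientWithinAt (localLoss f 𝒟 i) (gradLoc i x) K x) →
      -- bounded variance, smoothness variance, heterogeneity and smoothness heterogeneity
      ∀ σ σL ξ ξL : ℝ, 0 ≤ σ → 0 ≤ σL → 0 ≤ ξ → 0 ≤ ξL →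
      (∀ i, ∀ x ∈ K,
        ∫⁻ z, ENNReal.ofReal (‖grad i z x - gradLoc i x‖ ^ 2) ∂(𝒟 i) ≤ ENNReal.ofReal (σ ^ 2)) →
      (∀ i, ∀ x ∈ K, ∀ y ∈ K,
        ∫⁻ z, ENNReal.ofReal
            (‖(grad i z x - gradLoc i x) - (grad i z y - gradLoc i y)‖ ^ 2) ∂(𝒟 i)
          ≤ ENNReal.ofReal (σL ^ 2 * ‖x - y‖ ^ 2)) →
      (∀ x ∈ K, (M : ℝ)⁻¹ * ∑ i, ‖gradLoc i x - globalGrad gradLoc x‖ ^ 2 ≤ ξ ^ 2) →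
      (∀ x ∈ K, ∀ y ∈ K,
        (M : ℝ)⁻¹ * ∑ i, ‖(gradLoc i x - globalGrad gradLoc x)
            - (gradLoc i y - globalGrad gradLoc y)‖ ^ 2 ≤ ξL ^ 2 * ‖x - y‖ ^ 2) →
      ∀ xs ∈ K, IsMinOn (globalLoss f 𝒟) K xs →
      let P := (sampleLaw T 𝒟).prod
        ((uniformSelection M m T).prod (gaussianNoise d v))
      let xT : FedDataset T 𝒵 × (Fin T → Finset (Fin M)) × (Fin T → EuclideanSpace ℝ (Fin d)) →
          EuclideanSpace ℝ (Fin d) :=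
        fun ω => trustedQueries K grad α η m x₀ ω.1 ω.2.1 ω.2.2 ⟨T - 1, by omega⟩
      Integrable (fun ω => globalLoss f 𝒟 (xT ω)) P ∧
      ∫ ω, globalLoss f 𝒟 (xT ω) ∂P - globalLoss f 𝒟 xs ≤
        4 * D * ((‖globalGrad gradLoc xs‖ + 2 * L * D) / T
          + √((σ + 2 * σL * D) ^ 2 + (ξ + 2 * ξL * D) ^ 2) / √(m * T)
          + 2 * S * √d / (ρ * m * T))) := by
  have hD' : 0 ≤ D := hD.le
  have hS0 : 0 < S := by rw [hS]; positivity
  have hne : K.Nonempty := ⟨x₀, hx₀⟩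
  refine ⟨fun ν hν _ => isZCDP_trustedLaw hm hT hρ hK_compact hK_convex hK_diam hx₀ hG.le hL.le f
    hgrad hLip hSmooth hS hS0 hα hv ν, ?_⟩
  intro 𝒟 h𝒟 _ hgm hfi hconv gradLoc hloc σ σL ξ ξL hσ0 hσL0 hξ0 hξL0 hσ hσL hξ hξL xs hxs _ P xT
  have hmean : ∀ i, ∀ x ∈ K, meanGrad (tangentGrad K grad) 𝒟 i x = tangentProj K (gradLoc i x) :=
    fun i x hx => meanGrad_tangentGrad_eq hK_compact hK_convex hG.le hL.le hgrad hLip hSmooth hgm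
      hfi i hx (hloc i x hx)
  have hor := stochasticOracle_tangentGrad hK_compact hK_convex hne hG.le hL.le hgrad hLip hSmooth
    hgm hmean hσ hσL hξ hξL
  have hF := continuous_globalLoss_projOn (f := f) (𝒟 := 𝒟) hK_compact hK_convex hne hLip hfi
  have hM : 1 ≤ M := hm.trans hmM
  have hxT : (fun ω => globalLoss f 𝒟 (xT ω)) = fun ω => globalLoss f 𝒟 (projOn K
      (trustedState K (tangentGrad K grad) α η m x₀ ω.1 ω.2.1 ω.2.2 (T - 1)
        (Nat.sub_le T 1)).x) := by
    funext ω
    rw [projOn_of_mem hK_compact hK_convex (trustedState_mem hK_compact hK_convex hx₀ hα _ _).2.1]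
    simp only [xT]
    rw [trustedQueries_tangentGrad hK_compact hK_convex hx₀ hα]
    rfl
  rw [hxT]
  refine ⟨hor.integrable_comp_query (v := v) hK_compact hK_convex hx₀ hα hmM hF (T - 1)
    (Nat.sub_le T 1), ?_⟩
  have hglob : ∀ x ∈ K, globalGrad (meanGrad (tangentGrad K grad) 𝒟) x =
      tangentProj K (globalGrad gradLoc x) := fun x hx =>
    globalGrad_eq_map fun i => hmean i x hx
  have key := hor.integral_query_sub_le (v := v) hK_compact hK_convex hx₀ hK_diam hα hd hm hmM hT
    hD hL hρ hS0 hσ0 hσL0 hξ0 hξL0 hη hv (norm_nonneg (globalGrad gradLoc xs)) hF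
    (fun x hx y hy => by
      rw [projOn_of_mem hK_compact hK_convex hx, projOn_of_mem hK_compact hK_convex hy]
      exact globalLoss_le_of_localLoss_le hM fun i => (le_abs_self _).trans
        (abs_localLoss_sub_sub_inner_le hK_compact hK_convex hG.le hL.le hgrad hLip hSmooth hgm hfi
          i hx hy))
    (fun x hx y hy => by
      rw [projOn_of_mem hK_compact hK_convex hx, projOn_of_mem hK_compact hK_convex hy, hglob x hx,
        inner_tangentProj _ hy hx]
      exact le_globalLoss_of_le_localLoss fun i => (hconv i).add_inner_le (hloc i x hx) hx hy)
    (fun x hx => by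
      -- The Lipschitz bound from the minimizer gives G* + LD in place of G; the tangential part of
      -- ∇f(x*) is no longer than ∇f(x*).
      have h1 := hor.norm_globalGrad_sub_le hM x xs
      have h2 := norm_le_norm_add_norm_sub' (globalGrad (meanGrad (tangentGrad K grad) 𝒟) x)
        (globalGrad (meanGrad (tangentGrad K grad) 𝒟) xs)
      have h3 := norm_tangentProj_le (K := K) (globalGrad gradLoc xs)
      rw [← hglob xs hxs] at h3
      have h4 : L * ‖x - xs‖ ≤ L * D := by gcongr; exact hK_diam x hx xs hxs
      linarith)
    hxs (Nat.sub_le T 1)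
  rwa [projOn_of_mem hK_compact hK_convex hxs] at key
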